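/- **Setting.** Concept names, role names, individual names and provenance variables $\mathsf X$ form countably infinite sets. Roles are $P ::= R \mid R^-$, and $\mathrm{inv}(R)=R^-$, $\mathrm{inv}(R^-)=R$. An $\mathcal{ELHI}_\bot$ axiom is a concept inclusion (GCI) $C\sqsubseteq D$ with $C ::= \top\mid A\mid \exists P.C\mid C\sqcap C$ and $D ::= A\mid \exists P\mid\bot$, a role inclusion $P\sqsubseteq Q$, a negative role inclusion $P\sqcap Q\sqsubseteq\bot$, or an assertion $A(a)$ or $R(a,b)$. $\mathsf{Why}[\mathsf X]$ is the universal additively and multiplicatively idempotent commutative semiring over $\mathsf X$; a monomial $m$ is a product of finitely many variables, and $|m|$ is its number of distinct variables. A $\mathsf{Why}[\mathsf X]$-annotated ontology $\mathcal O$ is a finite set of axioms, each annotated with a variable from $\mathsf X$ or with $1$. An annotated interpretation $\mathcal I$ has a domain $\Delta$ and interprets individual names by elements of $\Delta$, concept names by subsets of $\Delta\times\mathsf{Why}[\mathsf X]$ and role names by subsets of $\Delta\times\Delta\times\mathsf{Why}[\mathsf X]$, with $(R^-)^{\mathcal I}=\{(d,e,\kappa)\mid(e,d,\kappa)\in R^{\mathcal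 I}\}$, $\top^{\mathcal I}=\Delta\times\{1\}$, $\bot^{\mathcal I}=\emptyset$, $(C\sqcap C')^{\mathcal I}=\{(d,\kappa\kappa')\mid (d,\kappa)\in C^{\mathcal I},(d,\kappa')\in C'^{\mathcal I}\}$, $(\exists P.C)^{\mathcal I}=\{(d,\kappa\kappa')\mid \exists e:\ (d,e,\kappa)\in P^{\mathcal I},(e,\kappa')\in C^{\mathcal I}\}$, and $\exists P=\exists P.\top$. It satisfies $(C\sqsubseteq D,\kappa)$ if $(d,\kappa')\in C^{\mathcal I}$ implies $(d,\kappa\kappa')\in D^{\mathcal I}$, and likewise for $(P\sqsubseteq Q,\kappa)$; it satisfies $(P\sqcap Q\sqsubseteq\bot,\kappa)$ if no pair $(d,e)$ occurs both in $P^{\mathcal I}$ and in $Q^{\mathcal I}$ (with whatever annotations); it satisfies $(A(a),\kappa)$ if $(a^{\mathcal I},\kappa)\in A^{\mathcal I}$, and $(R(a,b),\kappa)$ if $(a^{\mathcal I},b^{\mathcal I},\kappa)\in R^{\mathcal I}$. Write $\mathcal O\models(\alpha,m)$ if every annotated interpretation that satisfies all annotated axioms of $\mathcal O$ satisfies $(\alpha,m)$.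 $\mathcal O$ belongs to $\mathcal{ELHI}_\bot^{restr}$ if (i) it is in normal form, i.e. all its GCIs have one of the shapes $A\sqsubseteq B$, $A\sqcap A'\sqsubseteq B$, $\exists P.A\sqsubseteq B$, $A\sqsubseteq\exists P$ with $A,A'$ concept names or $\top$ and $B$ a concept name or $\bot$; and (ii) for every role $P$ for which there is a concept name $C$ such that the non-annotated $\mathcal O$ entails $C\sqsubseteq\exists P$ in the standard semantics, every GCI $\exists\mathrm{inv}(P).A\sqsubseteq B$ in $\mathcal O$ has $A=\top$. **Theorem.** There is an algorithm that, given a $\mathsf{Why}[\mathsf X]$-annotated ontology $\mathcal O$ in $\mathcal{ELHI}_\bot^{restr}$, an $\mathcal{ELHI}_\bot$ axiom (assertion, role inclusion or GCI) $\alpha$ and a monomial $m$, decides whether $\mathcal O\models(\alpha,m)$ in time at most $$q(n)\cdot 2^{c\,(|m|+w(\alpha))},$$ where $q$ is a fixed polynomial, $c$ a fixed constant, $n$ is the size of a standard (binary) encoding of the input $(\mathcal O,\alpha,m)$, $w(C\sqsubseteq D)$ is the number of occurrences of concept names and existential restrictions in $C$, and $w(\alpha)=0$ for every other $\alpha$.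 In particular, for assertions, role inclusions and GCIs in normal form (for which $w(\alpha)\le 2$), the decision takes time polynomial in the size of the input and exponential only in $|m|$. -/

import Mathlib

namespace DLProv

/-! ## Syntax

The sets of concept names, role names, individual names and provenance variables are countably
infinite; each of them is a copy of `ℕ`. -/

abbrev ConceptName := ℕ
abbrev RoleName := ℕ
abbrev IndName := ℕ
abbrev PVar := ℕ

/-- Roles `P ::= R | R⁻`. -/
inductive Role where
  | name (R : RoleName)
  | inv (R : RoleName)

/-- The role `inv(P)`: `inv(R) = R⁻` and `inv(R⁻) = R`. -/
def Role.inverse : Role → Role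
  | .name R => .inv R
  | .inv R => .name R

/-- Concepts that may stand on the left of a concept inclusion:
`C ::= ⊤ | A | ∃P.C | C ⊓ C`. -/
inductive Concept where
  | top
  | atom (A : ConceptName)
  | ex (P : Role) (C : Concept)
  | inter (C D : Concept)

/-- Concepts that may stand on the right of a concept inclusion: `D ::= A | ∃P | ⊥`. -/
inductive RConcept where
  | atom (A : ConceptName)
  | ex (P : Role)
  | bot

/-- The axioms (inclusions and assertions) of `ELHI_⊥`. -/
inductive Ax where
  /-- concept inclusion `C ⊑ D` -/
  | gci (C : Concept) (D : RConcept)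
  /-- positive role inclusion `P ⊑ Q` -/
  | ri (P Q : Role)
  /-- negative role inclusion `P ⊓ Q ⊑ ⊥` -/
  | nri (P Q : Role)
  /-- concept assertion `A(a)` -/
  | ca (A : ConceptName) (a : IndName)
  /-- role assertion `R(a,b)` -/
  | ra (R : RoleName) (a b : IndName)

/-- A finite annotated ontology: every axiom carries a provenance variable `some x`
or the trivial annotation `none`, which stands for `1`. -/
abbrev AnnOntology := List (Ax × Option PVar)

/-- The axioms of an annotated ontology, without their annotations. -/
def axiomsOf (O : AnnOntology) : Set Ax := {β | ∃ l, (β, l) ∈ O}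

/-- Number of concept names and existential restrictions in a concept, with multiplicity. -/
def Concept.numAtoms : Concept → ℕ
  | .top => 0
  | .atom _ => 1
  | .ex _ C => C.numAtoms + 1
  | .inter C D => C.numAtoms + D.numAtoms

/-- For a concept inclusion the number of atoms of its left-hand side, for any other axiom `0`. -/
def Ax.lhsAtoms : Ax → ℕ
  | .gci C _ => C.numAtoms
  | _ => 0

/-! ## Standard semantics -/

structure Interp where
  Dom : Type
  ind : IndName → Dom
  con : ConceptName → Set Dom
  rol : RoleName → Set (Dom × Dom)

namespace Interp

def role (I : Interp) : Role → Set (I.Dom × I.Dom)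
  | .name R => I.rol R
  | .inv R => {p | (p.2, p.1) ∈ I.rol R}

def concept (I : Interp) : Concept → Set I.Dom
  | .top => Set.univ
  | .atom A => I.con A
  | .ex P C => {d | ∃ e, (d, e) ∈ I.role P ∧ e ∈ I.concept C}
  | .inter C D => I.concept C ∩ I.concept D

def rconcept (I : Interp) : RConcept → Set I.Dom
  | .atom A => I.con A
  | .ex P => I.concept (.ex P .top)
  | .bot => ∅

def Sat (I : Interp) : Ax → Prop
  | .gci C D => I.concept C ⊆ I.rconcept D
  | .ri P Q => I.role P ⊆ I.role Q
  | .nri P Q => I.role P ∩ I.role Q = ∅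
  | .ca A a => I.ind a ∈ I.con A
  | .ra R a b => (I.ind a, I.ind b) ∈ I.rol R

end Interp

/-- `O ⊨ α`, for a non-annotated ontology. -/
def StdEntails (O : Set Ax) (α : Ax) : Prop :=
  ∀ I : Interp, (∀ β ∈ O, I.Sat β) → I.Sat α

/-! ## The why-provenance semiring -/

inductive IdemRel : MvPolynomial PVar ℕ → MvPolynomial PVar ℕ → Prop
  | add (f : MvPolynomial PVar ℕ) : IdemRel (f + f) f
  | mul (f : MvPolynomial PVar ℕ) : IdemRel (f * f) f

/-- `Why[X]`, the universal additively and multiplicatively idempotent commutative semiring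
over the variables `X`: provenance polynomials modulo `f + f = f` and `f * f = f`. -/
abbrev Why : Type := RingQuot IdemRel

noncomputable def whyVar (x : PVar) : Why := RingQuot.mkRingHom IdemRel (MvPolynomial.X x)

/-- A monomial is a finite product of variables; by idempotency, a finite set of variables. -/
noncomputable def monomial (m : Finset PVar) : Why := ∏ x ∈ m, whyVar x

noncomputable def annot : Option PVar → Why
  | none => 1
  | some x => whyVar x

/-! ## Annotated semantics -/

/-- `K`-annotated interpretations. -/
structure AnnInterp (K : Type) where
  Dom : Type
  ind : IndName → Dom
  con : ConceptName → Set (Dom × K)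
  rol : RoleName → Set (Dom × Dom × K)

namespace AnnInterp

variable {K : Type} [CommSemiring K]

def role (I : AnnInterp K) : Role → Set (I.Dom × I.Dom × K)
  | .name R => I.rol R
  | .inv R => {p | (p.2.1, p.1, p.2.2) ∈ I.rol R}

def concept (I : AnnInterp K) : Concept → Set (I.Dom × K)
  | .top => {p | p.2 = 1}
  | .atom A => I.con A
  | .ex P C => {p | ∃ e k l, (p.1, e, k) ∈ I.role P ∧ (e, l) ∈ I.concept C ∧ p.2 = k * l}
  | .inter C D => {p | ∃ k l, (p.1, k) ∈ I.concept C ∧ (p.1, l) ∈ I.concept D ∧ p.2 = k * l}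

def rconcept (I : AnnInterp K) : RConcept → Set (I.Dom × K)
  | .atom A => I.con A
  | .ex P => I.concept (.ex P .top)
  | .bot => ∅

/-- `I ⊨ (α, k)`. -/
def Sat (I : AnnInterp K) (k : K) : Ax → Prop
  | .gci C D => ∀ d l, (d, l) ∈ I.concept C → (d, k * l) ∈ I.rconcept D
  | .ri P Q => ∀ d e l, (d, e, l) ∈ I.role P → (d, e, k * l) ∈ I.role Q
  | .nri P Q => ∀ d e l l', (d, e, l) ∈ I.role P → (d, e, l') ∉ I.role Q
  | .ca A a => (I.ind a, k) ∈ I.con A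
  | .ra R a b => (I.ind a, I.ind b, k) ∈ I.rol R

end AnnInterp

/-- `O ⊨ (α, k)` for a `Why[X]`-annotated ontology `O`. -/
def Entails (O : AnnOntology) (α : Ax) (k : Why) : Prop :=
  ∀ I : AnnInterp Why, (∀ β ∈ O, I.Sat (annot β.2) β.1) → I.Sat k α

/-! ## Normal form and the restricted fragment -/

/-- A concept name or `⊤`. -/
def Concept.IsSimple : Concept → Prop
  | .top => True
  | .atom _ => True
  | _ => False

/-- A concept name or `⊥`. -/
def RConcept.IsSimple : RConcept → Prop
  | .ex _ => False
  | _ => True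

/-- Normal form: every concept inclusion has one of the shapes
`A ⊑ B`, `A ⊓ A' ⊑ B`, `∃P.A ⊑ B`, `A ⊑ ∃P`,
with `A, A'` concept names or `⊤`, and `B` a concept name or `⊥`. -/
def Ax.IsNormal : Ax → Prop
  | .gci (.inter C C') D => C.IsSimple ∧ C'.IsSimple ∧ D.IsSimple
  | .gci (.ex _ C) D => C.IsSimple ∧ D.IsSimple
  | _ => True

/-- `O` belongs to the fragment `ELHI_⊥^restr`. -/
def IsRestr (O : Set Ax) : Prop :=
  (∀ β ∈ O, β.IsNormal) ∧
  ∀ P : Role, (∃ C : ConceptName, StdEntails O (.gci (.atom C) (.ex P))) →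
    ∀ (A : Concept) (B : RConcept), Ax.gci (.ex P.inverse A) B ∈ O → A = .top

/-! ## A machine model with a step count

Programs are first-order functional programs over binary trees (the data of S-expressions).
A program is a finite list of function bodies; each function has one argument, and the body is an
expression over variables, pairing, projections, a test for `nil`, local definitions and calls of
functions of the program.  Evaluation is call by value, and every evaluated node of an expression
costs one step.  Each step handles a bounded number of pointers, and trees are never copied or
compared in a single step, so that this model and Turing machines simulate each other with
polynomial overhead. -/

inductive Val where
  | nil
  | pair (l r : Val)

/-- Number of nodes of a tree. -/
def Val.size : Val → ℕ
  | .nil => 1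
  | .pair l r => l.size + r.size + 1

def Val.fst : Val → Val
  | .nil => .nil
  | .pair l _ => l

def Val.snd : Val → Val
  | .nil => .nil
  | .pair _ r => r

inductive Exp where
  /-- the `i`-th most recently bound variable -/
  | var (i : ℕ)
  | nil
  | pair (a b : Exp)
  | fst (a : Exp)
  | snd (a : Exp)
  /-- `a` if `c` is not `nil`, and `b` otherwise -/
  | ite (c a b : Exp)
  /-- bind the value of `a` in `b` -/
  | letIn (a b : Exp)
  /-- call the function number `f` of the program -/
  | call (f : ℕ) (a : Exp)

abbrev Prog := List Exp

/-- `Eval p env e v t`: in the program `p` and the environment `env`, the expression `e` evaluates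
to `v` in exactly `t` steps. -/
inductive Eval (p : Prog) : List Val → Exp → Val → ℕ → Prop
  | var {env i v} : env[i]? = some v → Eval p env (.var i) v 1
  | nil {env} : Eval p env .nil .nil 1
  | pair {env a b v w s t} : Eval p env a v s → Eval p env b w t →
      Eval p env (.pair a b) (.pair v w) (s + t + 1)
  | fst {env a v t} : Eval p env a v t → Eval p env (.fst a) v.fst (t + 1)
  | snd {env a v t} : Eval p env a v t → Eval p env (.snd a) v.snd (t + 1)
  | ite_pair {env c a b l r v s t} : Eval p env c (.pair l r) s → Eval p env a v t →
      Eval p env (.ite c a b) v (s + t + 1)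
  | ite_nil {env c a b v s t} : Eval p env c .nil s → Eval p env b v t →
      Eval p env (.ite c a b) v (s + t + 1)
  | letIn {env a b v w s t} : Eval p env a v s → Eval p (v :: env) b w t →
      Eval p env (.letIn a b) w (s + t + 1)
  | call {env f body a v w s t} : p[f]? = some body → Eval p env a v s → Eval p [v] body w t →
      Eval p env (.call f a) w (s + t + 1)

/-- The program `p`, started in its function number `0` on the argument `x`, halts with the
output `y` after `t` steps. -/
def Prog.Runs (p : Prog) (x y : Val) (t : ℕ) : Prop := Eval p [x] (.call 0 (.var 0)) y t

/-! ## Encoding of the input; names are written in binary -/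

def encBool : Bool → Val
  | false => .nil
  | true => .pair .nil .nil

def encList {α : Type} (f : α → Val) : List α → Val
  | [] => .nil
  | a :: l => .pair (f a) (encList f l)

def encNat (n : ℕ) : Val := encList encBool n.bits

def encRole : Role → Val
  | .name R => .pair (encBool false) (encNat R)
  | .inv R => .pair (encBool true) (encNat R)

def encConcept : Concept → Val
  | .top => .pair (encNat 0) .nil
  | .atom A => .pair (encNat 1) (encNat A)
  | .ex P C => .pair (encNat 2) (.pair (encRole P) (encConcept C))
  | .inter C D => .pair (encNat 3) (.pair (encConcept C) (encConcept D))

def encRConcept : RConcept → Val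
  | .atom A => .pair (encNat 0) (encNat A)
  | .ex P => .pair (encNat 1) (encRole P)
  | .bot => .pair (encNat 2) .nil

def encAx : Ax → Val
  | .gci C D => .pair (encNat 0) (.pair (encConcept C) (encRConcept D))
  | .ri P Q => .pair (encNat 1) (.pair (encRole P) (encRole Q))
  | .nri P Q => .pair (encNat 2) (.pair (encRole P) (encRole Q))
  | .ca A a => .pair (encNat 3) (.pair (encNat A) (encNat a))
  | .ra R a b => .pair (encNat 4) (.pair (encNat R) (.pair (encNat a) (encNat b)))

def encLabel : Option PVar → Val
  | none => .nil
  | some x => .pair (encNat x) .nil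

def encOntology (O : AnnOntology) : Val :=
  encList (fun β => .pair (encAx β.1) (encLabel β.2)) O

/-- A monomial is given as the increasing list of its variables. -/
def encMonomial (m : Finset PVar) : Val := encList encNat (m.sort (· ≤ ·))

/-- The input of the decision problem `O ⊨ (α, m)`. -/
def encInput (O : AnnOntology) (α : Ax) (m : Finset PVar) : Val :=
  .pair (encOntology O) (.pair (encAx α) (encMonomial m))

end DLProv

/-! The query is frozen into data. For `C ⊑ D` the tree `C` becomes assertions about fresh
individuals, with one fresh provenance variable for each concept name and each existential
restriction. Then `(C ⊑ D, m)` is entailed iff the root of the tree gets the conclusion with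
annotation exactly `m` times all fresh variables, or the data contradict the ontology. Other axioms
are treated likewise (`entails_iff`). By idempotence a product of variables is a finite set of
variables, its label.

Entailment is captured by the calculus `Con`. Models may need infinitely many anonymous elements,
but one context per generating role `P` suffices. First, by the restriction, an inclusion that
carries information from a parent down to a generated child only asks for `⊤` at the parent, so the
facts at the child do not depend on those of the parent. Second, labels at a child matter only up to
the annotation of its incoming edge: a fact at the child returns to the parent multiplied by that
annotation, and idempotence absorbs further copies of it. Soundness is `TInterp.Models.con`.
Completeness uses a canonical model made of words of generated edges (`Word.Holds.ex`, `canon_sat`),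
and `monomial_injective`, which recovers a label from its value in `Why`.

In every rule the labels of the premises are contained in the label of the conclusion. A derivation
with label `V` therefore only meets subsets of `V`: there are `2 ^ |V|` of them, with `|V| ≤ |m| +
w(α) + 1`, and polynomially many contexts and concepts, and saturation stops after at most as many
rounds as there are possible facts. Inconsistency, where the label is irrelevant, is decided with
all labels erased.

For the running time, the class `Poly` of polynomial-time functions on encoded data is closed under
composition, case analysis, folds and saturation. The exponential factor is isolated in one place:
the input is padded by a tree with `2 ^ (|V| + 1) - 1` nodes, and everything else is polynomial in
the padded size (`Computes.padded`). -/

namespace DLProv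

/-! ## Linking of programs -/

/-- Renumber the calls in an expression, for a program that starts at position `d` of a larger one. -/
def Exp.shift (d : ℕ) : Exp → Exp
  | .var i => .var i
  | .nil => .nil
  | .pair a b => .pair (a.shift d) (b.shift d)
  | .fst a => .fst (a.shift d)
  | .snd a => .snd (a.shift d)
  | .ite c a b => .ite (c.shift d) (a.shift d) (b.shift d)
  | .letIn a b => .letIn (a.shift d) (b.shift d)
  | .call f a => .call (f + d) (a.shift d)

/-- The program `p` sits in `P` from position `d` on. -/
def Embeds (p : Prog) (d : ℕ) (P : Prog) : Prop :=
  ∀ f body, p[f]? = some body → P[f + d]? = some (body.shift d)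

theorem Eval.shift {p P : Prog} {d : ℕ} (h : Embeds p d P) {env e v t} (he : Eval p env e v t) :
    Eval P env (e.shift d) v t := by
  induction he with
  | var h => exact .var h
  | nil => exact .nil
  | pair _ _ h1 h2 => exact .pair h1 h2
  | fst _ h1 => exact .fst h1
  | snd _ h1 => exact .snd h1
  | ite_pair _ _ h1 h2 => exact .ite_pair h1 h2
  | ite_nil _ _ h1 h2 => exact .ite_nil h1 h2
  | letIn _ _ h1 h2 => exact .letIn h1 h2
  | call hb _ _ h1 h2 => exact .call (h _ _ hb) h1 h2

/-- Evaluation within a given number of steps. -/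
def EvalLE (p : Prog) (env : List Val) (e : Exp) (v : Val) (T : ℕ) : Prop :=
  ∃ t ≤ T, Eval p env e v t

namespace EvalLE

variable {p : Prog} {env : List Val} {a b c : Exp} {v w : Val} {s t : ℕ}

theorem mono (h : EvalLE p env a v s) (hst : s ≤ t) : EvalLE p env a v t :=
  h.imp fun _ h => ⟨h.1.trans hst, h.2⟩

theorem var {i : ℕ} (h : env[i]? = some v) : EvalLE p env (.var i) v 1 := ⟨1, le_rfl, .var h⟩

theorem arg (x : Val) : EvalLE p [x] (.var 0) x 1 := .var rfl

theorem nil : EvalLE p env .nil .nil 1 := ⟨1, le_rfl, .nil⟩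

theorem pair (h1 : EvalLE p env a v s) (h2 : EvalLE p env b w t) :
    EvalLE p env (.pair a b) (.pair v w) (s + t + 1) := by
  obtain ⟨s', hs, h1⟩ := h1
  obtain ⟨t', ht, h2⟩ := h2
  exact ⟨s' + t' + 1, by omega, .pair h1 h2⟩

theorem fst (h : EvalLE p env a v s) : EvalLE p env (.fst a) v.fst (s + 1) := by
  obtain ⟨s', hs, h⟩ := h
  exact ⟨s' + 1, by omega, .fst h⟩

theorem snd (h : EvalLE p env a v s) : EvalLE p env (.snd a) v.snd (s + 1) := by
  obtain ⟨s', hs, h⟩ := h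
  exact ⟨s' + 1, by omega, .snd h⟩

theorem ite_pair {l r : Val} (h1 : EvalLE p env c (.pair l r) s) (h2 : EvalLE p env a v t) :
    EvalLE p env (.ite c a b) v (s + t + 1) := by
  obtain ⟨s', hs, h1⟩ := h1
  obtain ⟨t', ht, h2⟩ := h2
  exact ⟨s' + t' + 1, by omega, .ite_pair h1 h2⟩

theorem ite_nil (h1 : EvalLE p env c .nil s) (h2 : EvalLE p env b v t) :
    EvalLE p env (.ite c a b) v (s + t + 1) := by
  obtain ⟨s', hs, h1⟩ := h1
  obtain ⟨t', ht, h2⟩ := h2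
  exact ⟨s' + t' + 1, by omega, .ite_nil h1 h2⟩

theorem call {f : ℕ} {body : Exp} (hf : p[f]? = some body) (h1 : EvalLE p env a v s)
    (h2 : EvalLE p [v] body w t) : EvalLE p env (.call f a) w (s + t + 1) := by
  obtain ⟨s', hs, h1⟩ := h1
  obtain ⟨t', ht, h2⟩ := h2
  exact ⟨s' + t' + 1, by omega, .call hf h1 h2⟩

/-- Calling a linked program. -/
theorem link {P : Prog} {d : ℕ} {x y : Val} (h : Embeds p d P)
    (hr : EvalLE p [x] (.call 0 (.var 0)) y t) (ha : EvalLE P env a x s) :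
    EvalLE P env (.call d a) y (s + t) := by
  obtain ⟨t', ht, hr⟩ := hr
  obtain ⟨s', hs, ha⟩ := ha
  cases hr with
  -- The outer call of the given run is replayed at position `d`, with its argument computed by `a`
  -- instead of read from a variable, so no extra step arises.
  | @call _ _ body _ v _ s₀ t₀ hb h1 h2 =>
    cases h1 with
    | var hv =>
      obtain rfl : x = v := by simpa using hv
      exact ⟨s' + t₀ + 1, by omega, .call (by simpa using h _ _ hb) ha (h2.shift h)⟩

end EvalLE

theorem Embeds.append {A p B : Prog} : Embeds p A.length (A ++ (p.map (Exp.shift A.length) ++ B)) := by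
  intro f body hf
  have hlt : f < p.length := (List.getElem?_eq_some_iff.1 hf).1
  rw [List.getElem?_append_right (by omega), Nat.add_sub_cancel,
    List.getElem?_append_left (by simpa using hlt), List.getElem?_map, hf]
  rfl

/-- `main`, followed by the programs `p`, `q` and `r`. -/
def linked (main p q r : Prog) : Prog :=
  main ++ (p.map (Exp.shift main.length) ++
    (q.map (Exp.shift (main.length + p.length)) ++
      (r.map (Exp.shift (main.length + p.length + q.length)) ++ [])))

theorem embeds_linked_fst (main p q r : Prog) : Embeds p main.length (linked main p q r) :=
  Embeds.append

theorem embeds_linked_snd (main p q r : Prog) :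
    Embeds q (main.length + p.length) (linked main p q r) := by
  have := @Embeds.append (main ++ p.map (Exp.shift main.length)) q
    (r.map (Exp.shift (main.length + p.length + q.length)) ++ [])
  simpa [linked] using this

theorem embeds_linked_trd (main p q r : Prog) :
    Embeds r (main.length + p.length + q.length) (linked main p q r) := by
  have := @Embeds.append (main ++ p.map (Exp.shift main.length) ++
    q.map (Exp.shift (main.length + p.length))) r []
  simpa [linked, ← Nat.add_assoc] using this

theorem linked_main {main p q r : Prog} {f : ℕ} {body : Exp} (h : main[f]? = some body) :
    (linked main p q r)[f]? = some body := by
  have hlt : f < main.length := (List.getElem?_eq_some_iff.1 h).1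
  rw [linked, List.getElem?_append_left hlt, h]

/-! ## Polynomial bounds -/

/-- The function is bounded by a polynomial. -/
def PolyBounded (f : ℕ → ℕ) : Prop := ∃ k, ∀ n, f n ≤ (n + 2) ^ k

namespace PolyBounded

variable {f g : ℕ → ℕ}

/-- The base `n + 2` is at least `2` even for `n = 0`, so constants are covered by `c ≤ 2 ^ c`. -/
theorem const (c : ℕ) : PolyBounded fun _ => c :=
  ⟨c, fun n => (Nat.lt_two_pow_self).le.trans (Nat.pow_le_pow_left (by omega) c)⟩

theorem id : PolyBounded fun n => n := ⟨1, fun n => by simp⟩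

theorem mul (hf : PolyBounded f) (hg : PolyBounded g) : PolyBounded fun n => f n * g n := by
  obtain ⟨k, hk⟩ := hf
  obtain ⟨l, hl⟩ := hg
  exact ⟨k + l, fun n => by rw [pow_add]; exact Nat.mul_le_mul (hk n) (hl n)⟩

theorem add (hf : PolyBounded f) (hg : PolyBounded g) : PolyBounded fun n => f n + g n := by
  obtain ⟨k, hk⟩ := hf
  obtain ⟨l, hl⟩ := hg
  refine ⟨k + l + 1, fun n => ?_⟩
  have h1 : (n + 2) ^ k ≤ (n + 2) ^ (k + l) := Nat.pow_le_pow_right (by omega) (by omega)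
  have h2 : (n + 2) ^ l ≤ (n + 2) ^ (k + l) := Nat.pow_le_pow_right (by omega) (by omega)
  calc f n + g n ≤ (n + 2) ^ (k + l) * 2 := by have := hk n; have := hl n; omega
    _ ≤ (n + 2) ^ (k + l + 1) := by rw [pow_succ]; exact Nat.mul_le_mul_left _ (by omega)

theorem pow (hf : PolyBounded f) (k : ℕ) : PolyBounded fun n => f n ^ k := by
  obtain ⟨l, hl⟩ := hf
  exact ⟨l * k, fun n => by rw [pow_mul]; exact Nat.pow_le_pow_left (hl n) k⟩

theorem add_two_pow (hf : PolyBounded f) (k : ℕ) : PolyBounded fun n => (f n + 2) ^ k :=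
  (hf.add (const 2)).pow k

theorem two_pow (k : ℕ) : PolyBounded fun n => (n + 2) ^ k := id.add_two_pow k

end PolyBounded

/-! ## Polynomial-time functions between encoded types -/

/-- Types with an encoding by trees. -/
class Enc (α : Type) where
  enc : α → Val

open Enc (enc)

/-- The size of the encoding. -/
def sz {α : Type} [Enc α] (a : α) : ℕ := (enc a).size

instance : Enc Val := ⟨id⟩
instance : Enc Bool := ⟨encBool⟩
instance : Enc Unit := ⟨fun _ => .nil⟩
instance : Enc ℕ := ⟨encNat⟩
instance : Enc Role := ⟨encRole⟩
instance : Enc Concept := ⟨encConcept⟩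
instance : Enc RConcept := ⟨encRConcept⟩
instance : Enc Ax := ⟨encAx⟩
instance : Enc (Option ℕ) := ⟨encLabel⟩
instance {α : Type} [Enc α] : Enc (List α) := ⟨encList enc⟩
instance {α β : Type} [Enc α] [Enc β] : Enc (α × β) := ⟨fun x => .pair (enc x.1) (enc x.2)⟩
instance {α β : Type} [Enc α] [Enc β] : Enc (α ⊕ β) :=
  ⟨Sum.elim (fun a => .pair .nil (enc a)) (fun b => .pair (.pair .nil .nil) (enc b))⟩
instance {α : Type} [Enc α] {p : α → Prop} : Enc {a // p a} := ⟨fun a => enc a.1⟩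

theorem Val.size_pos (v : Val) : 0 < v.size := by cases v <;> simp [Val.size]

theorem Val.size_fst_le (v : Val) : v.fst.size ≤ v.size := by
  cases v <;> simp [Val.size, Val.fst]; omega

theorem Val.size_snd_le (v : Val) : v.snd.size ≤ v.size := by
  cases v <;> simp [Val.size, Val.snd]; omega

section sizes

variable {α β : Type} [Enc α] [Enc β]

theorem sz_pos (a : α) : 0 < sz a := Val.size_pos _

theorem sz_prod (x : α × β) : sz x = sz x.1 + sz x.2 + 1 := rfl

theorem sz_nil : sz ([] : List α) = 1 := rfl

theorem sz_cons (a : α) (l : List α) : sz (a :: l) = sz a + sz l + 1 := rfl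

theorem sz_lt_of_mem {a : α} {l : List α} (h : a ∈ l) : sz a < sz l := by
  induction l with
  | nil => cases h
  | cons b l ih =>
    rw [sz_cons]
    rcases List.mem_cons.1 h with rfl | h
    · omega
    · have := ih h; omega

theorem length_lt_sz (l : List α) : l.length < sz l := by
  induction l with
  | nil => simp [sz_nil]
  | cons b l ih => rw [sz_cons, List.length_cons]; omega

theorem sz_le_of_sublist {l l' : List α} (h : l.Sublist l') : sz l ≤ sz l' := by
  induction h with
  | slnil => exact le_rfl
  | cons a _ ih => rw [sz_cons]; omega
  | cons_cons a _ ih => rw [sz_cons, sz_cons]; omega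

theorem sz_append (l l' : List α) : sz (l ++ l') + 1 = sz l + sz l' := by
  induction l with
  | nil => simp [sz_nil]; omega
  | cons b l ih => rw [List.cons_append, sz_cons, sz_cons]; omega

theorem sz_list_le {l : List α} {B : ℕ} (h : ∀ a ∈ l, sz a ≤ B) : sz l ≤ l.length * (B + 1) + 1 := by
  induction l with
  | nil => simp [sz_nil]
  | cons b l ih =>
    have h1 := h b (by simp)
    have h2 := ih fun a ha => h a (by simp [ha])
    rw [sz_cons, List.length_cons, Nat.add_mul]
    omega

end sizes

/-- The program `p` computes `f` within the time bound `T` (as a function of the input). -/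
def Computes {α β : Type} [Enc α] [Enc β] (p : Prog) (f : α → β) (T : α → ℕ) : Prop :=
  ∀ a, EvalLE p [enc a] (.call 0 (.var 0)) (enc (f a)) (T a)

/-- Functions computable in polynomial time, with values of polynomial size. -/
@[fun_prop]
def Poly {α β : Type} [Enc α] [Enc β] (f : α → β) : Prop :=
  ∃ (p : Prog) (k : ℕ), Computes p f (fun a => (sz a + 2) ^ k) ∧ ∀ a, sz (f a) ≤ (sz a + 2) ^ k

theorem Computes.mono {α β : Type} [Enc α] [Enc β] {p : Prog} {f : α → β} {S T : α → ℕ}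
    (h : Computes p f S) (hST : ∀ a, S a ≤ T a) : Computes p f T :=
  fun a => (h a).mono (hST a)

namespace Poly

variable {α β γ δ : Type} [Enc α] [Enc β] [Enc γ] [Enc δ]

theorem of_bounds {f : α → β} {p : Prog} {T S : ℕ → ℕ} (hT : PolyBounded T) (hS : PolyBounded S)
    (hp : Computes p f fun a => T (sz a)) (hs : ∀ a, sz (f a) ≤ S (sz a)) : Poly f := by
  obtain ⟨k, hk⟩ := hT.add hS
  exact ⟨p, k, hp.mono fun a => le_trans (Nat.le_add_right _ _) (hk _),
    fun a => (hs a).trans (le_trans (Nat.le_add_left _ _) (hk _))⟩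

theorem size_bound {f : α → β} (h : Poly f) : ∃ k, ∀ a, sz (f a) ≤ (sz a + 2) ^ k :=
  let ⟨_, k, _, hk⟩ := h
  ⟨k, hk⟩

/-- Being polynomial-time only depends on the function on encodings. -/
theorem transfer {f : α → β} {g : γ → δ} (hg : Poly g)
    (h : ∀ a, ∃ c, enc c = enc a ∧ enc (g c) = enc (f a)) : Poly f := by
  obtain ⟨p, k, hp, hk⟩ := hg
  refine ⟨p, k, fun a => ?_, fun a => ?_⟩ <;> obtain ⟨c, h1, h2⟩ := h a
  · have := hp c
    simp only [sz] at this ⊢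
    rwa [h1, h2] at this
  · have := hk c
    simp only [sz] at this ⊢
    rwa [h1, h2] at this

theorem of_val {f : α → β} {g : Val → Val} (hg : Poly g) (h : ∀ a, g (enc a) = enc (f a)) : Poly f :=
  hg.transfer fun a => ⟨enc a, rfl, h a⟩

/-- A function computed in constant time by a single expression. -/
theorem of_exp {f : α → β} (e : Exp) (T : ℕ) {S : ℕ → ℕ} (hS : PolyBounded S)
    (he : ∀ a, EvalLE [e] [enc a] e (enc (f a)) T) (hs : ∀ a, sz (f a) ≤ S (sz a)) : Poly f :=
  of_bounds (PolyBounded.const (1 + T + 1)) hS (fun a => .call rfl (.var rfl) (he a)) hs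

@[fun_prop]
theorem id : Poly fun a : α => a :=
  of_exp (.var 0) 1 PolyBounded.id (fun _ => .var rfl) fun _ => le_rfl

/-- The expression for a fixed tree. -/
def _root_.DLProv.Val.toExp : Val → Exp
  | .nil => .nil
  | .pair l r => .pair l.toExp r.toExp

theorem _root_.DLProv.EvalLE.toExp {p : Prog} {env : List Val} (v : Val) :
    EvalLE p env v.toExp v v.size := by
  induction v with
  | nil => exact .nil
  | pair l r hl hr => exact hl.pair hr

@[fun_prop]
theorem const (b : β) : Poly fun _ : α => b :=
  of_exp (enc b).toExp (sz b) (PolyBounded.const (sz b)) (fun _ => .toExp _) fun _ => le_rfl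

/-- The running time of `g` is measured at `f a`; this is why `Poly` also demands a polynomial bound
on the size of values. -/
theorem comp {g : β → γ} {f : α → β} (hg : Poly g) (hf : Poly f) : Poly fun a => g (f a) := by
  obtain ⟨p, k, hp, hk⟩ := hf
  obtain ⟨q, l, hq, hl⟩ := hg
  have hB := ((PolyBounded.two_pow k).add_two_pow l)
  refine of_bounds (p := linked [.call 1 (.call (1 + q.length) (.var 0))] q p [])
    (((((PolyBounded.const 1).add (PolyBounded.two_pow k)).add hB)).add (PolyBounded.const 2))
    hB ?_ ?_
  · intro a
    have h1 := EvalLE.link (embeds_linked_snd [.call 1 (.call (1 + q.length) (.var 0))] q p [])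
      (hp a) (.var (env := [enc a]) (i := 0) rfl)
    have h2 := EvalLE.link (embeds_linked_fst [.call 1 (.call (1 + q.length) (.var 0))] q p [])
      (hq (f a)) h1
    refine (EvalLE.call (linked_main rfl) (.var rfl) h2).mono ?_
    have := Nat.pow_le_pow_left (Nat.add_le_add_right (hk a) 2) l
    dsimp only
    omega
  · exact fun a => (hl _).trans (Nat.pow_le_pow_left (Nat.add_le_add_right (hk a) 2) l)

@[fun_prop]
theorem comp' {g : β → γ} {f : α → β} (hg : Poly g) (hf : Poly f) : Poly (g ∘ f) := hg.comp hf

@[fun_prop]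
theorem prodMk {f : α → β} {g : α → γ} (hf : Poly f) (hg : Poly g) :
    Poly fun a => (f a, g a) := by
  obtain ⟨p, k, hp, hk⟩ := hf
  obtain ⟨q, l, hq, hl⟩ := hg
  have hB := ((PolyBounded.two_pow k).add (PolyBounded.two_pow l)).add (PolyBounded.const 5)
  refine of_bounds (p := linked [.pair (.call 1 (.var 0)) (.call (1 + p.length) (.var 0))] p q [])
    hB hB ?_ ?_
  · intro a
    have h1 := EvalLE.link
      (embeds_linked_fst [.pair (.call 1 (.var 0)) (.call (1 + p.length) (.var 0))] p q [])
      (hp a) (.var (env := [enc a]) (i := 0) rfl)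
    have h2 := EvalLE.link
      (embeds_linked_snd [.pair (.call 1 (.var 0)) (.call (1 + p.length) (.var 0))] p q [])
      (hq a) (.var (env := [enc a]) (i := 0) rfl)
    refine (EvalLE.call (linked_main rfl) (.var rfl) (h1.pair h2)).mono ?_
    dsimp only
    omega
  · intro a
    have := hk a; have := hl a
    rw [sz_prod]; dsimp only; omega

theorem fst_id : Poly (Prod.fst : α × β → α) :=
  of_exp (.fst (.var 0)) 2 PolyBounded.id (fun x => (EvalLE.arg (enc x)).fst) fun x => by
    rw [sz_prod]; omega

theorem snd_id : Poly (Prod.snd : α × β → β) :=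
  of_exp (.snd (.var 0)) 2 PolyBounded.id (fun x => (EvalLE.arg (enc x)).snd) fun x => by
    rw [sz_prod]; omega

@[fun_prop]
theorem fst {f : α → β × γ} (hf : Poly f) : Poly fun a => (f a).1 := fst_id.comp hf

@[fun_prop]
theorem snd {f : α → β × γ} (hf : Poly f) : Poly fun a => (f a).2 := snd_id.comp hf

@[fun_prop]
theorem valFst {f : α → Val} (hf : Poly f) : Poly fun a => (f a).fst :=
  comp (of_exp (f := Val.fst) (.fst (.var 0)) 2 PolyBounded.id (fun v => (EvalLE.arg v).fst)
    fun v => v.size_fst_le) hf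

@[fun_prop]
theorem valSnd {f : α → Val} (hf : Poly f) : Poly fun a => (f a).snd :=
  comp (of_exp (f := Val.snd) (.snd (.var 0)) 2 PolyBounded.id (fun v => (EvalLE.arg v).snd)
    fun v => v.size_snd_le) hf

@[fun_prop]
theorem valPair {f g : α → Val} (hf : Poly f) (hg : Poly g) : Poly fun a => Val.pair (f a) (g a) :=
  (hf.prodMk hg).transfer fun a => ⟨a, rfl, rfl⟩

@[fun_prop]
theorem enc_comp {f : α → β} (hf : Poly f) : Poly fun a => enc (f a) :=
  hf.transfer fun a => ⟨a, rfl, rfl⟩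

-- Both branches are evaluated before the choice, which is harmless since both are total and
-- polynomial.
@[fun_prop]
theorem cond {c : α → Bool} {f g : α → β} (hc : Poly c) (hf : Poly f) (hg : Poly g) :
    Poly fun a => bif c a then f a else g a := by
  have h : Poly fun x : Bool × β × β => bif x.1 then x.2.1 else x.2.2 := by
    refine of_exp (.ite (.fst (.var 0)) (.fst (.snd (.var 0))) (.snd (.snd (.var 0)))) 6
      PolyBounded.id ?_ ?_
    · rintro ⟨_ | _, x, y⟩
      · exact .ite_nil (EvalLE.arg (enc (false, x, y))).fst (EvalLE.arg (enc (false, x, y))).snd.snd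
      · exact .ite_pair (EvalLE.arg (enc (true, x, y))).fst (EvalLE.arg (enc (true, x, y))).snd.fst
    · rintro ⟨_ | _, x, y⟩ <;> simp only [sz_prod, cond_true, cond_false] <;> omega
  exact h.comp (hc.prodMk (hf.prodMk hg))

@[fun_prop]
theorem and {p q : α → Bool} (hp : Poly p) (hq : Poly q) : Poly fun a => p a && q a := by
  have h : (fun a => p a && q a) = fun a => bif p a then q a else false := by
    funext a; cases p a <;> rfl
  rw [h]
  fun_prop

@[fun_prop]
theorem or {p q : α → Bool} (hp : Poly p) (hq : Poly q) : Poly fun a => p a || q a := by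
  have h : (fun a => p a || q a) = fun a => bif p a then true else q a := by
    funext a; cases p a <;> rfl
  rw [h]
  fun_prop

/-- Structural equality test. -/
def _root_.DLProv.Val.beq : Val → Val → Bool
  | .nil, .nil => true
  | .pair a b, .pair c d => a.beq c && b.beq d
  | _, _ => false

theorem _root_.DLProv.Val.beq_iff {v w : Val} : v.beq w = true ↔ v = w := by
  induction v generalizing w with
  | nil => cases w <;> simp [Val.beq]
  | pair a b ha hb => cases w <;> simp [Val.beq, ha, hb]

/-- The body of a program for the equality test. -/
def beqExp : Exp :=
  .ite (.fst (.var 0))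
    (.ite (.snd (.var 0))
      (.ite (.call 0 (.pair (.fst (.fst (.var 0))) (.fst (.snd (.var 0)))))
        (.call 0 (.pair (.snd (.fst (.var 0))) (.snd (.snd (.var 0))))) .nil)
      .nil)
    (.ite (.snd (.var 0)) .nil (.pair .nil .nil))

/-- The recursion visits each node of the first tree at most once and spends fewer than `30` steps
there, so the bound does not involve `w`. -/
theorem evalLE_beqExp (v w : Val) :
    EvalLE [beqExp] [.pair v w] beqExp (enc (v.beq w)) (30 * v.size) := by
  induction v generalizing w with
  | nil =>
    have hx := EvalLE.arg (p := [beqExp]) (.pair .nil w)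
    cases w with
    | nil => exact (EvalLE.ite_nil hx.fst (.ite_nil hx.snd (.pair .nil .nil))).mono (by simp [Val.size])
    | pair c d => exact (EvalLE.ite_nil hx.fst (.ite_pair hx.snd .nil)).mono (by simp [Val.size])
  | pair a b ha hb =>
    have hx := EvalLE.arg (p := [beqExp]) (.pair (.pair a b) w)
    cases w with
    | nil =>
      exact (EvalLE.ite_pair hx.fst (.ite_nil hx.snd .nil)).mono (by simp only [Val.size]; omega)
    | pair c d =>
      have h1 := EvalLE.call (f := 0) (body := beqExp) rfl (.pair hx.fst.fst hx.snd.fst) (ha c)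
      have h2 := EvalLE.call (f := 0) (body := beqExp) rfl (.pair hx.fst.snd hx.snd.snd) (hb d)
      have h3 : EvalLE [beqExp] [.pair (.pair a b) (.pair c d)]
          (.ite (.call 0 (.pair (.fst (.fst (.var 0))) (.fst (.snd (.var 0)))))
            (.call 0 (.pair (.snd (.fst (.var 0))) (.snd (.snd (.var 0))))) .nil)
          (enc ((Val.pair a b).beq (.pair c d))) (22 + 30 * a.size + 30 * b.size) := by
        rw [Val.beq]
        cases hac : a.beq c with
        | true =>
          rw [hac] at h1
          exact (EvalLE.ite_pair h1 h2).mono (by omega)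
        | false =>
          rw [hac] at h1
          exact (EvalLE.ite_nil h1 .nil).mono (by omega)
      exact (EvalLE.ite_pair hx.fst (.ite_pair hx.snd h3)).mono (by simp only [Val.size]; omega)

theorem valBeq : Poly fun x : Val × Val => x.1.beq x.2 :=
  of_bounds (p := [beqExp]) (((PolyBounded.const 30).mul PolyBounded.id).add (PolyBounded.const 2))
    (PolyBounded.const 3)
    (fun x => (EvalLE.call rfl (.var rfl) (evalLE_beqExp x.1 x.2)).mono (by
      simp only [sz_prod]; simp only [sz, enc, id_eq]; omega))
    (fun x => by cases x.1.beq x.2 <;> simp [sz, enc, encBool, Val.size])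

end Poly

end DLProv


namespace DLProv

open Enc (enc)

/-! ## Injectivity of encodings -/

/-- Types whose encoding is injective. -/
class InjEnc (α : Type) [Enc α] : Prop where
  inj : ∀ a b : α, enc a = enc b → a = b

section inj

variable {α β : Type} [Enc α] [Enc β] [InjEnc α] [InjEnc β]

instance : InjEnc Bool := ⟨fun a b h => by
  cases a <;> cases b <;> first | rfl | cases h⟩

instance : InjEnc (List α) := ⟨fun l => by
  induction l with
  | nil => intro l' h; cases l' <;> first | rfl | cases h
  | cons a l ih =>
    intro l' h
    cases l' with
    | nil => cases h
    | cons b l' =>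
      injection h with h1 h2
      rw [InjEnc.inj _ _ h1, ih _ h2]⟩

instance : InjEnc ℕ := ⟨fun a b h => by
  have h1 : a.bits = b.bits := InjEnc.inj (α := List Bool) _ _ h
  apply Nat.digits.injective 2
  rw [Nat.digits_two_eq_bits, Nat.digits_two_eq_bits, h1]⟩

instance : InjEnc (α × β) := ⟨fun a b h => by
  injection h with h1 h2
  exact Prod.ext (InjEnc.inj _ _ h1) (InjEnc.inj _ _ h2)⟩

instance : InjEnc (α ⊕ β) := ⟨fun a b h => by
  rcases a with a | a <;> rcases b with b | b <;> injection h with h1 h2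
  · rw [InjEnc.inj _ _ h2]
  · cases h1
  · cases h1
  · rw [InjEnc.inj _ _ h2]⟩

instance : InjEnc Role := ⟨fun a b h => by
  rcases a with a | a <;> rcases b with b | b <;> injection h with h1 h2
  · rw [InjEnc.inj (α := ℕ) _ _ h2]
  · cases h1
  · cases h1
  · rw [InjEnc.inj (α := ℕ) _ _ h2]⟩

end inj

/-! ### Equality tests, sums and list operations in polynomial time. -/

namespace Poly

variable {Γ α β σ : Type} [Enc Γ] [Enc α] [Enc β] [Enc σ]

-- The decision may be classical: the program compares the two encodings, and injectivity of the
-- encoding makes the answers agree.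
@[fun_prop]
theorem decide_eq [InjEnc α] [DecidableEq α] {f g : Γ → α} (hf : Poly f) (hg : Poly g) :
    Poly fun x => decide (f x = g x) := by
  have h : (fun x => decide (f x = g x)) = fun x => (enc (f x)).beq (enc (g x)) := by
    funext x
    rw [Bool.eq_iff_iff, decide_eq_true_iff, Val.beq_iff]
    exact ⟨congrArg _, InjEnc.inj _ _⟩
  rw [h]
  exact valBeq.comp (f := fun x => (enc (f x), enc (g x))) (by fun_prop)

@[fun_prop]
theorem inl {f : Γ → α} (hf : Poly f) : Poly fun x => (Sum.inl (f x) : α ⊕ β) :=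
  Poly.transfer (g := fun x => Val.pair .nil (enc (f x))) (by fun_prop) fun a => ⟨a, rfl, rfl⟩

@[fun_prop]
theorem inr {f : Γ → β} (hf : Poly f) : Poly fun x => (Sum.inr (f x) : α ⊕ β) :=
  Poly.transfer (g := fun x => Val.pair (.pair .nil .nil) (enc (f x))) (by fun_prop)
    fun a => ⟨a, rfl, rfl⟩

@[fun_prop]
theorem cons {f : Γ → α} {l : Γ → List α} (hf : Poly f) (hl : Poly l) :
    Poly fun x => f x :: l x :=
  (hf.prodMk hl).transfer fun a => ⟨a, rfl, rfl⟩

/-- The function that runs through the list; its argument is `(env, (init, l))`, and the step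
function has number `3`. -/
def foldrExp (d : ℕ) : Exp :=
  .ite (.snd (.snd (.var 0)))
    (.call d (.pair (.fst (.var 0)) (.pair (.fst (.snd (.snd (.var 0))))
      (.call 1 (.pair (.fst (.var 0)) (.pair (.fst (.snd (.var 0))) (.snd (.snd (.snd (.var 0))))))))))
    (.fst (.snd (.var 0)))

/-- The loop descends to the end of the list before it applies a step, so its accumulators are the
folds over suffixes of `l`. `M` bounds the cost of one step. -/
theorem evalLE_foldrExp {P : Prog} {d M : ℕ} (hF : P[1]? = some (foldrExp d)) {g : Γ}
    {step : α → σ → σ} {init : σ} {l : List α}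
    (hs : ∀ a s, (a :: s) <:+ l → ∀ env e t, EvalLE P env e (enc (g, a, s.foldr step init)) t →
      EvalLE P env (.call d e) (enc (step a (s.foldr step init))) (t + M)) :
    EvalLE P [enc (g, init, l)] (foldrExp d) (enc (l.foldr step init)) (l.length * (M + 30) + 10) := by
  induction l with
  | nil =>
    have hx := EvalLE.arg (p := P) (enc (g, init, ([] : List α)))
    exact (EvalLE.ite_nil hx.snd.snd hx.snd.fst).mono (by omega)
  | cons a l ih =>
    have hx := EvalLE.arg (p := P) (enc (g, init, a :: l))
    have h1 := EvalLE.call hF (hx.fst.pair (hx.snd.fst.pair hx.snd.snd.snd))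
      (ih fun b s hb => hs b s (hb.trans (List.suffix_cons _ _)))
    have h2 := hs a l List.suffix_rfl _ _ _ (hx.fst.pair (hx.snd.snd.fst.pair h1))
    refine (EvalLE.ite_pair hx.snd.snd h2).mono ?_
    rw [List.length_cons, Nat.add_mul]
    omega

/-- A polynomial step is not enough, since iterating it may square the size of the accumulator each
time; `hb` bounds all accumulators that occur. -/
theorem foldr {l : Γ → List α} {init : Γ → σ} {step : Γ → α → σ → σ} (hl : Poly l)
    (hinit : Poly init) (hstep : Poly fun x : Γ × α × σ => step x.1 x.2.1 x.2.2)
    (hb : ∃ k, ∀ g s, s <:+ l g → sz (s.foldr (step g) (init g)) ≤ (sz g + 2) ^ k) :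
    Poly fun g => (l g).foldr (step g) (init g) := by
  have hcore : Poly fun g => (g, init g, l g) := by fun_prop
  obtain ⟨p, k, hp, hk⟩ := hcore
  obtain ⟨q, m, hq, -⟩ := hstep
  obtain ⟨n, hn⟩ := hb
  have hM : PolyBounded fun N => (N + (N + 2) ^ k + (N + 2) ^ n + 2 + 2) ^ m :=
    (((PolyBounded.id.add (PolyBounded.two_pow k)).add (PolyBounded.two_pow n)).add
      (PolyBounded.const 2)).add_two_pow m
  have hT := ((((PolyBounded.two_pow k).mul (hM.add (PolyBounded.const 30)))).add
    (PolyBounded.two_pow k)).add (PolyBounded.const 30)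
  -- Function `0` prepares the triple `(g, init, l)` with `p`, which is linked at `2 + q.length`;
  -- function `1` is the loop; the step program `q` starts at `2`.
  let main : Prog := [.call 1 (.call (2 + q.length) (.var 0)), foldrExp 2]
  refine of_bounds (p := linked main q p []) hT (PolyBounded.two_pow n) (fun g => ?_)
    fun g => hn g _ List.suffix_rfl
  have h1 := EvalLE.link (embeds_linked_snd main q p []) (hp g) (EvalLE.arg (enc g))
  have hsz := hk g
  simp only [sz_prod] at hsz
  have h2 := evalLE_foldrExp (P := linked main q p []) (d := 2)
    (M := (sz g + (sz g + 2) ^ k + (sz g + 2) ^ n + 2 + 2) ^ m) (linked_main rfl)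
    (g := g) (step := step g) (init := init g) (l := l g) (by
      intro a s hs env e t he
      refine (EvalLE.link (embeds_linked_fst main q p []) (hq (g, a, s.foldr (step g) (init g)))
        he).mono (Nat.add_le_add_left (Nat.pow_le_pow_left (Nat.add_le_add_right ?_ 2) m) t)
      have h3 := hn g s ((List.suffix_cons a s).trans hs)
      have h4 : sz a < sz (l g) := sz_lt_of_mem (hs.subset List.mem_cons_self)
      simp only [sz_prod]
      omega)
  refine (EvalLE.call (linked_main rfl) (EvalLE.arg (enc g))
    (EvalLE.call (linked_main rfl) h1 h2)).mono ?_
  have h5 : (l g).length ≤ (sz g + 2) ^ k := by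
    have := length_lt_sz (l g)
    omega
  have h6 := Nat.mul_le_mul_right ((sz g + (sz g + 2) ^ k + (sz g + 2) ^ n + 2 + 2) ^ m + 30) h5
  dsimp only
  omega

/-- A variant of `Poly.foldr` with a bound in terms of the environment and the list. -/
theorem foldr' {l : Γ → List α} {init : Γ → σ} {step : Γ → α → σ → σ} (hl : Poly l)
    (hinit : Poly init) (hstep : Poly fun x : Γ × α × σ => step x.1 x.2.1 x.2.2)
    {B : ℕ → ℕ} (hB : PolyBounded B)
    (hb : ∀ g (s : List α), sz (s.foldr (step g) (init g)) ≤ B (sz g + sz s)) :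
    Poly fun g => (l g).foldr (step g) (init g) := by
  refine foldr hl hinit hstep ?_
  obtain ⟨n, hn⟩ := hl.size_bound
  obtain ⟨k, hk⟩ := hB
  obtain ⟨K, hK⟩ := (PolyBounded.id.add (PolyBounded.two_pow n)).add_two_pow k
  refine ⟨K, fun g s hs => (hb g s).trans ((hk _).trans (le_trans (Nat.pow_le_pow_left ?_ k) (hK _)))⟩
  have := sz_le_of_sublist hs.sublist
  have := hn g
  omega

@[fun_prop]
theorem append {l l' : Γ → List α} (hl : Poly l) (hl' : Poly l') : Poly fun g => l g ++ l' g := by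
  have h : Poly fun x : List α × List α => x.1.foldr (fun a s => a :: s) x.2 := by
    refine foldr' (by fun_prop) (by fun_prop) (by fun_prop) PolyBounded.id fun g s => ?_
    have := sz_append s g.2
    rw [show s.foldr (fun a s => a :: s) g.2 = s ++ g.2 from List.foldr_cons_eq_append' .. |>.trans rfl]
    rw [sz_prod]
    omega
  refine (h.comp (hl.prodMk hl')).transfer fun g => ⟨g, rfl, ?_⟩
  simp

@[fun_prop]
theorem map {l : Γ → List α} {f : Γ → α → β} (hl : Poly l) (hf : Poly fun x : Γ × α => f x.1 x.2) :
    Poly fun g => (l g).map (f g) := by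
  obtain ⟨k, hk⟩ := hf.size_bound
  have h : Poly fun g => (l g).foldr (fun a s => f g a :: s) [] := by
    refine foldr' hl (by fun_prop) ?_ ((PolyBounded.id.mul
      ((PolyBounded.id.add_two_pow k).add (PolyBounded.const 1))).add (PolyBounded.const 1)) ?_
    · exact cons (hf.comp (f := fun x : Γ × α × List β => (x.1, x.2.1)) (by fun_prop)) (by fun_prop)
    · intro g s
      have h1 : s.foldr (fun a s => f g a :: s) [] = s.map (f g) := by
        induction s <;> simp_all
      rw [h1]
      refine (sz_list_le (B := (sz g + sz s + 2) ^ k) ?_).trans ?_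
      · intro b hb
        obtain ⟨a, ha, rfl⟩ := List.mem_map.1 hb
        refine (hk (g, a)).trans (Nat.pow_le_pow_left ?_ k)
        have := sz_lt_of_mem ha
        simp only [sz_prod]
        omega
      · rw [List.length_map]
        have := length_lt_sz s
        exact Nat.add_le_add_right (Nat.mul_le_mul_right _ (by omega)) 1
  refine h.transfer fun g => ⟨g, rfl, congrArg _ ?_⟩
  induction l g <;> simp_all

@[fun_prop]
theorem flatMap {l : Γ → List α} {f : Γ → α → List β} (hl : Poly l)
    (hf : Poly fun x : Γ × α => f x.1 x.2) : Poly fun g => (l g).flatMap (f g) := by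
  obtain ⟨k, hk⟩ := hf.size_bound
  have h : Poly fun g => (l g).foldr (fun a s => f g a ++ s) [] := by
    refine foldr' hl (by fun_prop) ?_ ((PolyBounded.id.mul
      (PolyBounded.id.add_two_pow k)).add (PolyBounded.const 1)) ?_
    · exact append (hf.comp (f := fun x : Γ × α × List β => (x.1, x.2.1)) (by fun_prop)) (by fun_prop)
    · intro g s
      have h2 : ∀ N, (∀ a ∈ s, sz (f g a) ≤ N) →
          sz (s.foldr (fun a s => f g a ++ s) []) ≤ s.length * N + 1 := by
        intro N hN
        induction s with
        | nil => simp [sz_nil]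
        | cons a s ih =>
          have h3 := ih fun a ha => hN a (by simp [ha])
          have h4 := hN a (by simp)
          have h5 := sz_append (f g a) (s.foldr (fun a s => f g a ++ s) [])
          rw [List.foldr_cons, List.length_cons, Nat.add_mul]
          omega
      refine (h2 ((sz g + sz s + 2) ^ k) ?_).trans ?_
      · intro a ha
        refine (hk (g, a)).trans (Nat.pow_le_pow_left ?_ k)
        have := sz_lt_of_mem ha
        simp only [sz_prod]
        omega
      · have := length_lt_sz s
        exact Nat.add_le_add_right (Nat.mul_le_mul_right _ (by omega)) 1
  refine h.transfer fun g => ⟨g, rfl, congrArg _ ?_⟩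
  induction l g <;> simp_all

@[fun_prop]
theorem filter {l : Γ → List α} {p : Γ → α → Bool} (hl : Poly l)
    (hp : Poly fun x : Γ × α => p x.1 x.2) : Poly fun g => (l g).filter (p g) := by
  have h : Poly fun g => (l g).flatMap fun a => bif p g a then [a] else [] := by fun_prop
  refine h.transfer fun g => ⟨g, rfl, congrArg _ ?_⟩
  induction l g with
  | nil => rfl
  | cons a s ih => cases h : p g a <;> simp_all

theorem sz_bool_le (b : Bool) : sz b ≤ 3 := by cases b <;> simp [sz, enc, encBool, Val.size]

@[fun_prop]
theorem any {l : Γ → List α} {p : Γ → α → Bool} (hl : Poly l)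
    (hp : Poly fun x : Γ × α => p x.1 x.2) : Poly fun g => (l g).any (p g) := by
  have h : Poly fun g => (l g).foldr (fun a s => p g a || s) false := by
    refine foldr' hl (by fun_prop) ?_ (PolyBounded.const 3) fun g s => sz_bool_le _
    exact or (hp.comp (f := fun x : Γ × α × Bool => (x.1, x.2.1)) (by fun_prop)) (by fun_prop)
  refine h.transfer fun g => ⟨g, rfl, congrArg _ ?_⟩
  induction l g <;> simp_all

@[fun_prop]
theorem all {l : Γ → List α} {p : Γ → α → Bool} (hl : Poly l)
    (hp : Poly fun x : Γ × α => p x.1 x.2) : Poly fun g => (l g).all (p g) := by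
  have h : Poly fun g => (l g).foldr (fun a s => p g a && s) true := by
    refine foldr' hl (by fun_prop) ?_ (PolyBounded.const 3) fun g s => sz_bool_le _
    exact and (hp.comp (f := fun x : Γ × α × Bool => (x.1, x.2.1)) (by fun_prop)) (by fun_prop)
  refine h.transfer fun g => ⟨g, rfl, congrArg _ ?_⟩
  induction l g <;> simp_all

end Poly

end DLProv


namespace DLProv

open Enc (enc)

/-! ## Saturation -/

/-- Close under the one-step consequence `step`, inside the finite universe `U`. -/
def saturate {F : Type} (U : List F) (step : List F → F → Bool) : List F :=
  U.foldr (fun _ S => U.filter (step S)) []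

section saturate

variable {F : Type} {U : List F} {step : List F → F → Bool}

theorem saturate_subset (D : F → Prop)
    (hD : ∀ S f, (∀ g ∈ S, D g) → step S f = true → D f) : ∀ f ∈ saturate U step, D f := by
  have h : ∀ l : List F, ∀ f ∈ l.foldr (fun _ S => U.filter (step S)) [], D f := by
    intro l
    induction l with
    | nil => simp
    | cons a l ih =>
      intro f hf
      exact hD _ f ih (List.mem_filter.1 hf).2
  exact h U

/-- For a monotone step the stages form an increasing chain of sublists of `U`. Each round adds an
element or is stationary, so `U.length` rounds reach a fixed point. -/
theorem saturate_closed (hmono : ∀ S S' f, S ⊆ S' → step S f = true → step S' f = true) {f : F}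
    (hU : f ∈ U) (hf : step (saturate U step) f = true) : f ∈ saturate U step := by
  have hsub : ∀ S S', S ⊆ S' → (U.filter (step S)).Sublist (U.filter (step S')) := fun S S' hS =>
    List.monotone_filter_right U fun x hx => hmono _ _ _ hS hx
  have hinc : ∀ l : List F, (l.foldr (fun _ S => U.filter (step S)) []).Sublist
      (U.filter (step (l.foldr (fun _ S => U.filter (step S)) []))) := by
    intro l
    induction l with
    | nil => exact List.nil_sublist _
    | cons a l ih => exact hsub _ _ ih.subset
  -- After as many rounds as `l` has elements, the stage has grown to at least that many elements or
  -- is already a fixed point.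
  have hlen : ∀ l : List F, l.length ≤ (l.foldr (fun _ S => U.filter (step S)) []).length ∨
      l.foldr (fun _ S => U.filter (step S)) [] =
        U.filter (step (l.foldr (fun _ S => U.filter (step S)) [])) := by
    intro l
    induction l with
    | nil => exact .inl le_rfl
    | cons a l ih =>
      rcases ih with ih | ih
      · rcases (hinc l).length_le.eq_or_lt with h | h
        · right
          have := (hinc l).eq_of_length h
          rw [List.foldr_cons, ← this, ← this]
        · left
          rw [List.length_cons, List.foldr_cons]
          omega
      · right
        rw [List.foldr_cons, ← ih, ← ih]
  have hfix : saturate U step = U.filter (step (saturate U step)) := by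
    rcases hlen U with h | h
    · exact (hinc U).eq_of_length (le_antisymm (hinc U).length_le ((List.length_filter_le _ _).trans h))
    · exact h
  rw [hfix]
  exact List.mem_filter.2 ⟨hU, hf⟩

end saturate

-- No growth can occur: every stage is a sublist of `U`.
@[fun_prop]
theorem Poly.saturate {Γ F : Type} [Enc Γ] [Enc F] {U : Γ → List F} {step : Γ → List F → F → Bool}
    (hU : Poly U) (hs : Poly fun x : Γ × List F × F => step x.1 x.2.1 x.2.2) :
    Poly fun g => saturate (U g) (step g) := by
  obtain ⟨k, hk⟩ := hU.size_bound
  refine foldr (step := fun g _ S => (U g).filter (step g S)) hU (by fun_prop) ?_ ⟨k, ?_⟩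
  · exact filter (hU.comp (by fun_prop))
      (hs.comp (f := fun x : (Γ × F × List F) × F => (x.1.1, x.1.2.2, x.2)) (by fun_prop))
  · intro g s _
    refine le_trans ?_ (hk g)
    cases s with
    | nil => exact sz_pos _
    | cons a s => exact sz_le_of_sublist List.filter_sublist

/-! ### Enumeration of all labels below a given one. -/

/-- All sublists of a list. -/
def sublistsOf {α : Type} (l : List α) : List (List α) :=
  l.foldr (fun a (s : List (List α)) => s ++ s.map fun m => a :: m) [[]]

section sublists

variable {α : Type}

theorem filter_mem_sublistsOf (l : List α) (p : α → Bool) : l.filter p ∈ sublistsOf l := by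
  induction l with
  | nil => simp [sublistsOf]
  | cons a l ih =>
    rw [sublistsOf, List.foldr_cons, List.mem_append, List.mem_map]
    cases h : p a with
    | false => rw [List.filter_cons_of_neg (by simp [h])]; exact .inl ih
    | true => exact .inr ⟨_, ih, by simp [h]⟩

theorem sublist_of_mem_sublistsOf {l m : List α} (h : m ∈ sublistsOf l) : m.Sublist l := by
  induction l generalizing m with
  | nil => simp_all [sublistsOf]
  | cons a l ih =>
    rw [sublistsOf, List.foldr_cons, List.mem_append, List.mem_map] at h
    rcases h with h | ⟨m, h, rfl⟩
    · exact (ih h).cons a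
    · exact (ih h).cons_cons a

theorem length_sublistsOf (l : List α) : (sublistsOf l).length = 2 ^ l.length := by
  induction l with
  | nil => rfl
  | cons a l ih =>
    rw [sublistsOf] at ih ⊢
    rw [List.foldr_cons, List.length_append, List.length_map, ih, List.length_cons, pow_succ]
    omega

/-- The output has `2 ^ |V|` entries; it is polynomial only because `hpad` assumes an input that is
already that large. -/
theorem Poly.sublistsOf {Γ : Type} [Enc Γ] [Enc α] {V : Γ → List α} (hV : Poly V)
    (hpad : ∃ k, ∀ g, 2 ^ (V g).length ≤ (sz g + 2) ^ k) : Poly fun g => sublistsOf (V g) := by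
  obtain ⟨k, hk⟩ := hpad
  obtain ⟨m, hm⟩ := hV.size_bound
  obtain ⟨K, hK⟩ := ((PolyBounded.two_pow k).mul
    ((PolyBounded.two_pow m).add (PolyBounded.const 1))).add (PolyBounded.const 1)
  refine foldr (step := fun _ a (s : List (List α)) => s ++ s.map fun m => a :: m) hV (by fun_prop) (by fun_prop)
    ⟨K, fun g s hs => le_trans ?_ (hK (sz g))⟩
  refine (sz_list_le (l := DLProv.sublistsOf s) (B := (sz g + 2) ^ m) ?_).trans ?_
  · intro t ht
    exact (sz_le_of_sublist ((sublist_of_mem_sublistsOf ht).trans hs.sublist)).trans (hm g)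
  · rw [length_sublistsOf]
    have := (Nat.pow_le_pow_right (n := 2) (by omega) hs.length_le).trans (hk g)
    exact Nat.add_le_add_right (Nat.mul_le_mul_right _ this) 1

end sublists

/-! ## Rule databases and derivations -/

/-- Positions in a concept. -/
abbrev Path := List Bool

/-- Individuals: those of the ontology, and fresh ones. -/
abbrev Ind := ℕ ⊕ Path

/-- Variables: those of the ontology, and fresh ones. -/
abbrev Var := ℕ ⊕ Path

/-- Labels, products of variables. -/
abbrev Lab := List Var

/-- The element a fact is about: an individual, or an anonymous element generated for a role. -/
abbrev Ctx := Ind ⊕ Role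

/-- Concepts that occur in facts: `⊤`, `⊥`, concept names, and two auxiliary concepts. -/
inductive BC where
  | top
  | bot
  | goal
  | tok
  | atom (A : ConceptName)
  deriving DecidableEq

noncomputable instance : DecidableEq Role := Classical.decEq _

/-- An annotated ontology in normal form, as lists of rules. -/
structure DB where
  /-- assertions `A(a)` -/
  ca : List (BC × Ind × Lab)
  /-- assertions `P(a,b)` -/
  ra : List (Role × Ind × Ind × Lab)
  /-- inclusions `A ⊓ A' ⊑ B` -/
  im : List (BC × BC × BC × Lab)
  /-- inclusions `∃P.A ⊑ B` -/
  ex : List (Role × BC × BC × Lab)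
  /-- inclusions `A ⊑ ∃P` -/
  gen : List (BC × Role × Lab)
  /-- role inclusions -/
  ri : List (Role × Role × Lab)
  /-- negative role inclusions -/
  nri : List (Role × Role)
  /-- the individual that the query is about -/
  root : Ind

/-- Derived role inclusions. -/
inductive Sub (db : DB) (P : Role) : Role → Finset Var → Prop
  | refl : Sub db P P ∅
  | step {Q Q' : Role} {n : Finset Var} {v : Lab} :
      Sub db P Q n → (Q, Q', v) ∈ db.ri → Sub db P Q' (n ∪ v.toFinset)

/-- Derived facts.  Facts about an anonymous element are meant up to multiplication with the
annotation of the edge that leads to it. -/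
inductive Con (db : DB) : Ctx → BC → Finset Var → Prop
  | top (X : Ctx) : Con db X .top ∅
  | ca {A : BC} {a : Ind} {v : Lab} : (A, a, v) ∈ db.ca → Con db (.inl a) A v.toFinset
  | im {X : Ctx} {A A' B : BC} {v : Lab} {n n' : Finset Var} :
      (A, A', B, v) ∈ db.im → Con db X A n → Con db X A' n' → Con db X B (v.toFinset ∪ n ∪ n')
  | named {P Q : Role} {a b : Ind} {A B : BC} {v w : Lab} {n n' : Finset Var} :
      (P, a, b, v) ∈ db.ra → Sub db P Q n → (Q, A, B, w) ∈ db.ex → Con db (.inl b) A n' →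
      Con db (.inl a) B (v.toFinset ∪ n ∪ w.toFinset ∪ n')
  -- The label `n''` is known only up to the annotation `v ∪ n` of the generated edge, which the
  -- conclusion contains anyway.
  | succ {X : Ctx} {P Q : Role} {A A' B : BC} {v w : Lab} {n n' n'' : Finset Var} :
      (A, P, v) ∈ db.gen → Con db X A n → Sub db P Q n' → (Q, A', B, w) ∈ db.ex →
      Con db (.inr P) A' n'' → Con db X B (v.toFinset ∪ n ∪ n' ∪ w.toFinset ∪ n'')
  -- Only `⊤` is read at the parent, so the context need not record which parent it is. The
  -- annotation of the edge is left out of the label.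
  | pred {P Q : Role} {B : BC} {w : Lab} {n : Finset Var} :
      Sub db P Q n → (Q.inverse, BC.top, B, w) ∈ db.ex → Con db (.inr P) B (n ∪ w.toFinset)
  | nriNamed {P P' Q Q' : Role} {a b : Ind} {v v' : Lab} {n n' : Finset Var} :
      (P, a, b, v) ∈ db.ra → (P', a, b, v') ∈ db.ra → Sub db P Q n → Sub db P' Q' n' →
      (Q, Q') ∈ db.nri → Con db (.inl a) .bot (v.toFinset ∪ n ∪ v'.toFinset ∪ n')
  | nriAnon {P Q Q' : Role} {n n' : Finset Var} :
      Sub db P Q n → Sub db P Q' n' → (Q, Q') ∈ db.nri → Con db (.inr P) .bot (n ∪ n')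

/-! ## The decision procedure for derivability -/

/-- The two lists have the same elements. -/
def sameElems (n l : Lab) : Bool :=
  n.all (fun x => l.any fun y => decide (y = x)) && l.all fun x => n.any fun y => decide (y = x)

theorem sameElems_iff {n l : Lab} : sameElems n l = true ↔ n.toFinset = l.toFinset := by
  simp only [sameElems, Bool.and_eq_true, List.all_eq_true, List.any_eq_true,
    decide_eq_true_iff, exists_eq_right, Finset.ext_iff, List.mem_toFinset]
  exact ⟨fun h x => ⟨h.1 x, h.2 x⟩, fun h => ⟨fun x => (h x).1, fun x => (h x).2⟩⟩

abbrev SubFact := Role × Role × Lab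
abbrev ConFact := Ctx × BC × Lab

noncomputable section

/-- These lists span the universe for saturation: a derivation that ends in a listed context uses
listed contexts, concepts and roles only. -/
def DB.roles (db : DB) : List Role :=
  db.ra.map (fun r => r.1) ++ db.gen.map (fun r => r.2.1) ++ db.ri.map (fun r => r.2.1)

def DB.inds (db : DB) : List Ind :=
  db.root :: (db.ca.map (fun r => r.2.1) ++ db.ra.map (fun r => r.2.1) ++
    db.ra.map (fun r => r.2.2.1))

def DB.ctxs (db : DB) : List Ctx :=
  db.inds.map Sum.inl ++ db.gen.map fun r => Sum.inr r.2.1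

def DB.bcs (db : DB) : List BC :=
  BC.top :: BC.bot :: (db.ca.map (fun r => r.1) ++ db.im.map (fun r => r.2.2.1) ++
    db.ex.map (fun r => r.2.2.1))

/-- One-step consequences for role inclusions. -/
def subStep (db : DB) (S : List SubFact) (f : SubFact) : Bool :=
  (decide (f.1 = f.2.1) && sameElems f.2.2 []) ||
  S.any fun g => db.ri.any fun r => decide (g.1 = f.1) && decide (r.1 = g.2.1) &&
    decide (r.2.1 = f.2.1) && sameElems f.2.2 (g.2.2 ++ r.2.2)

def subRun (db : DB) (L : List Lab) : List SubFact :=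
  saturate (db.roles.flatMap fun P => db.roles.flatMap fun Q => L.map fun n => (P, Q, n))
    (subStep db)

/-- One-step consequences for facts. -/
def conStep (db : DB) (T : List SubFact) (S : List ConFact) (f : ConFact) : Bool :=
  (decide (f.2.1 = .top) && sameElems f.2.2 []) ||
  (db.ca.any fun r => decide (f.1 = .inl r.2.1) && decide (f.2.1 = r.1) &&
    sameElems f.2.2 r.2.2) ||
  (db.im.any fun r => decide (f.2.1 = r.2.2.1) && S.any fun g => S.any fun h =>
    decide (g.1 = f.1) && decide (h.1 = f.1) && decide (g.2.1 = r.1) && decide (h.2.1 = r.2.1) &&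
    sameElems f.2.2 (r.2.2.2 ++ g.2.2 ++ h.2.2)) ||
  (db.ra.any fun e => decide (f.1 = .inl e.2.1) && T.any fun t => db.ex.any fun r => S.any fun g =>
    decide (t.1 = e.1) && decide (r.1 = t.2.1) && decide (g.1 = .inl e.2.2.1) &&
    decide (g.2.1 = r.2.1) && decide (f.2.1 = r.2.2.1) &&
    sameElems f.2.2 (e.2.2.2 ++ t.2.2 ++ r.2.2.2 ++ g.2.2)) ||
  (db.gen.any fun e => S.any fun g => T.any fun t => db.ex.any fun r => S.any fun h =>
    decide (g.1 = f.1) && decide (g.2.1 = e.1) && decide (t.1 = e.2.1) && decide (r.1 = t.2.1) &&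
    decide (h.1 = .inr e.2.1) && decide (h.2.1 = r.2.1) && decide (f.2.1 = r.2.2.1) &&
    sameElems f.2.2 (e.2.2 ++ g.2.2 ++ t.2.2 ++ r.2.2.2 ++ h.2.2)) ||
  (T.any fun t => db.ex.any fun r => decide (f.1 = .inr t.1) && decide (r.1 = t.2.1.inverse) &&
    decide (r.2.1 = .top) && decide (f.2.1 = r.2.2.1) && sameElems f.2.2 (t.2.2 ++ r.2.2.2)) ||
  (db.ra.any fun e => db.ra.any fun e' => T.any fun t => T.any fun t' => db.nri.any fun r =>
    decide (f.1 = .inl e.2.1) && decide (e'.2.1 = e.2.1) && decide (e'.2.2.1 = e.2.2.1) &&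
    decide (t.1 = e.1) && decide (t'.1 = e'.1) && decide (r = (t.2.1, t'.2.1)) &&
    decide (f.2.1 = .bot) && sameElems f.2.2 (e.2.2.2 ++ t.2.2 ++ e'.2.2.2 ++ t'.2.2)) ||
  (T.any fun t => T.any fun t' => db.nri.any fun r =>
    decide (f.1 = .inr t.1) && decide (t'.1 = t.1) && decide (r = (t.2.1, t'.2.1)) &&
    decide (f.2.1 = .bot) && sameElems f.2.2 (t.2.2 ++ t'.2.2))

/-- All facts over the given labels that are derivable. -/
def conRun (db : DB) (L : List Lab) : List ConFact :=
  saturate (db.ctxs.flatMap fun X => db.bcs.flatMap fun B => L.map fun n => (X, B, n))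
    (conStep db (subRun db L))

end

theorem subStep_sound {db : DB} {S : List SubFact} {f : SubFact}
    (hS : ∀ g ∈ S, Sub db g.1 g.2.1 g.2.2.toFinset) (h : subStep db S f = true) :
    Sub db f.1 f.2.1 f.2.2.toFinset := by
  obtain ⟨P, Q, n⟩ := f
  simp only [subStep, Bool.or_eq_true, Bool.and_eq_true, List.any_eq_true, decide_eq_true_iff,
    sameElems_iff, Prod.exists] at h
  rcases h with ⟨rfl, h⟩ | ⟨_, Q', m, hg, _, _, v, hr, ⟨⟨rfl, rfl⟩, rfl⟩, h⟩
  · rw [h]; exact .refl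
  · rw [h, List.toFinset_append]
    exact .step (hS _ hg) hr

theorem subStep_mono (db : DB) (S S' : List SubFact) (f : SubFact) (hS : S ⊆ S')
    (h : subStep db S f = true) : subStep db S' f = true := by
  simp only [subStep, Bool.or_eq_true, Bool.and_eq_true, List.any_eq_true] at h ⊢
  rcases h with h | ⟨g, hg, h⟩
  · exact .inl h
  · exact .inr ⟨g, hS hg, h⟩

theorem subRun_sound {db : DB} {L : List Lab} :
    ∀ f ∈ subRun db L, Sub db f.1 f.2.1 f.2.2.toFinset :=
  saturate_subset _ fun _ _ hS h => subStep_sound hS h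

theorem conStep_sound {db : DB} {T : List SubFact} {S : List ConFact} {f : ConFact}
    (hT : ∀ g ∈ T, Sub db g.1 g.2.1 g.2.2.toFinset) (hS : ∀ g ∈ S, Con db g.1 g.2.1 g.2.2.toFinset)
    (h : conStep db T S f = true) : Con db f.1 f.2.1 f.2.2.toFinset := by
  obtain ⟨X, B, n⟩ := f
  simp only [conStep, Bool.or_eq_true, Bool.and_eq_true, List.any_eq_true, decide_eq_true_iff,
    sameElems_iff, Prod.exists] at h
  rcases h with ((((((h | h) | h) | h) | h) | h) | h) | h
  · obtain ⟨rfl, h⟩ := h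
    rw [h]; exact .top X
  · obtain ⟨A, a, v, hr, ⟨rfl, rfl⟩, h⟩ := h
    rw [h]; exact .ca hr
  · obtain ⟨A, A', _, v, hr, rfl, X', _, m, hg, _, _, m', hh, ⟨⟨⟨rfl, rfl⟩, rfl⟩, rfl⟩, h⟩ := h
    simp only [h, List.toFinset_append]
    exact .im hr (hS _ hg) (hS _ hh)
  · obtain ⟨P, a, b, v, he, rfl, _, Q, m, ht, _, A, _, w, hr, _, _, m', hg,
      ⟨⟨⟨⟨rfl, rfl⟩, rfl⟩, rfl⟩, rfl⟩, h⟩ := h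
    simp only [h, List.toFinset_append]
    exact .named he (hT _ ht) hr (hS _ hg)
  · obtain ⟨A, P, v, he, _, _, m, hg, _, Q, m', ht, _, A', _, w, hr, _, _, m'', hh,
      ⟨⟨⟨⟨⟨⟨rfl, rfl⟩, rfl⟩, rfl⟩, rfl⟩, rfl⟩, rfl⟩, h⟩ := h
    simp only [h, List.toFinset_append]
    exact .succ he (hS _ hg) (hT _ ht) hr (hS _ hh)
  · obtain ⟨P, Q, m, ht, _, _, _, w, hr, ⟨⟨⟨rfl, rfl⟩, rfl⟩, rfl⟩, h⟩ := h
    simp only [h, List.toFinset_append]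
    exact .pred (hT _ ht) hr
  · obtain ⟨P, a, b, v, he, P', _, _, v', he', _, Q, m, ht, _, Q', m', ht', _, _, hr,
      ⟨⟨⟨⟨⟨⟨rfl, rfl⟩, rfl⟩, rfl⟩, rfl⟩, h1⟩, rfl⟩, h⟩ := h
    obtain ⟨rfl, rfl⟩ := Prod.mk.inj h1
    simp only [h, List.toFinset_append]
    exact .nriNamed he he' (hT _ ht) (hT _ ht') hr
  · obtain ⟨P, Q, m, ht, _, Q', m', ht', _, _, hr, ⟨⟨⟨rfl, rfl⟩, h1⟩, rfl⟩, h⟩ := h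
    obtain ⟨rfl, rfl⟩ := Prod.mk.inj h1
    simp only [h, List.toFinset_append]
    exact .nriAnon (hT _ ht) (hT _ ht') hr

theorem conStep_mono (db : DB) (T : List SubFact) (S S' : List ConFact) (f : ConFact) (hS : S ⊆ S')
    (h : conStep db T S f = true) : conStep db T S' f = true := by
  have hany : ∀ p q : ConFact → Bool, (∀ g, p g = true → q g = true) → S.any p = true →
      S'.any q = true := by
    intro p q hpq h
    obtain ⟨g, hg, h⟩ := List.any_eq_true.1 h
    exact List.any_eq_true.2 ⟨g, hS hg, hpq g h⟩
  have hany' : ∀ {α : Type} (l : List α) (p q : α → Bool), (∀ g, p g = true → q g = true) →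
      l.any p = true → l.any q = true := by
    intro α l p q hpq h
    obtain ⟨g, hg, h⟩ := List.any_eq_true.1 h
    exact List.any_eq_true.2 ⟨g, hg, hpq g h⟩
  simp only [conStep, Bool.or_eq_true] at h ⊢
  rcases h with ((((((h | h) | h) | h) | h) | h) | h) | h
  · simp only [h, true_or]
  · simp only [h, true_or, or_true]
  · have h' : _ := hany' db.im _ (fun r => decide (f.2.1 = r.2.2.1) && S'.any fun g => S'.any fun h =>
      decide (g.1 = f.1) && decide (h.1 = f.1) && decide (g.2.1 = r.1) && decide (h.2.1 = r.2.1) &&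
      sameElems f.2.2 (r.2.2.2 ++ g.2.2 ++ h.2.2)) (fun r hr => by
        rw [Bool.and_eq_true] at hr ⊢
        exact ⟨hr.1, hany _ _ (fun g hg => hany _ _ (fun _ h => h) hg) hr.2⟩) h
    simp only [h', true_or, or_true]
  · have h' : _ := hany' db.ra _ (fun e => decide (f.1 = .inl e.2.1) && T.any fun t =>
      db.ex.any fun r => S'.any fun g =>
      decide (t.1 = e.1) && decide (r.1 = t.2.1) && decide (g.1 = .inl e.2.2.1) &&
      decide (g.2.1 = r.2.1) && decide (f.2.1 = r.2.2.1) &&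
      sameElems f.2.2 (e.2.2.2 ++ t.2.2 ++ r.2.2.2 ++ g.2.2)) (fun r hr => by
        rw [Bool.and_eq_true] at hr ⊢
        exact ⟨hr.1, hany' _ _ _ (fun t ht => hany' _ _ _ (fun r hr => hany _ _ (fun _ h => h) hr) ht)
          hr.2⟩) h
    simp only [h', true_or, or_true]
  · have h' : _ := hany' db.gen _ (fun e => S'.any fun g => T.any fun t => db.ex.any fun r =>
      S'.any fun h =>
      decide (g.1 = f.1) && decide (g.2.1 = e.1) && decide (t.1 = e.2.1) && decide (r.1 = t.2.1) &&
      decide (h.1 = .inr e.2.1) && decide (h.2.1 = r.2.1) && decide (f.2.1 = r.2.2.1) &&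
      sameElems f.2.2 (e.2.2 ++ g.2.2 ++ t.2.2 ++ r.2.2.2 ++ h.2.2)) (fun r hr =>
        hany _ _ (fun g hg => hany' _ _ _ (fun t ht => hany' _ _ _ (fun r hr =>
          hany _ _ (fun _ h => h) hr) ht) hg) hr) h
    simp only [h', true_or, or_true]
  all_goals simp only [h, true_or, or_true]

theorem conRun_sound {db : DB} {L : List Lab} :
    ∀ f ∈ conRun db L, Con db f.1 f.2.1 f.2.2.toFinset :=
  saturate_subset _ fun _ _ hS h => conStep_sound subRun_sound hS h

end DLProv


namespace DLProv

open Enc (enc)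

/-- The sublist of `V` with the elements in `N`. -/
def restrictTo (V : Lab) (N : Finset Var) : Lab := V.filter fun x => decide (x ∈ N)

theorem toFinset_restrictTo {V : Lab} {N : Finset Var} (h : N ⊆ V.toFinset) :
    (restrictTo V N).toFinset = N := by
  ext x
  have := @h x
  simp only [restrictTo, List.mem_toFinset, List.mem_filter, decide_eq_true_iff] at this ⊢
  tauto

theorem restrictTo_mem (V : Lab) (N : Finset Var) : restrictTo V N ∈ sublistsOf V :=
  filter_mem_sublistsOf _ _

/-- Labels only grow along a derivation, so each label below `N ⊆ V` has a representative among the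
sublists of `V`. The list `restrictTo V N` serves as the canonical one. -/
theorem subRun_complete {db : DB} {V : Lab} {P Q : Role} {N : Finset Var} (h : Sub db P Q N)
    (hP : P ∈ db.roles) (hN : N ⊆ V.toFinset) :
    Q ∈ db.roles ∧ (P, Q, restrictTo V N) ∈ subRun db (sublistsOf V) := by
  have huniv : ∀ {Q n}, Q ∈ db.roles → n ∈ sublistsOf V → (P, Q, n) ∈
      db.roles.flatMap fun P => db.roles.flatMap fun Q => (sublistsOf V).map fun n => (P, Q, n) := by
    intro Q n hQ hn
    simp only [List.mem_flatMap, List.mem_map]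
    exact ⟨P, hP, Q, hQ, n, hn, rfl⟩
  induction h with
  | refl =>
    refine ⟨hP, saturate_closed (subStep_mono db) (huniv hP (restrictTo_mem V ∅)) ?_⟩
    simp [subStep, sameElems_iff, toFinset_restrictTo hN]
  | @step Q Q' n v h hr ih =>
    have ih := (ih (Finset.subset_union_left.trans hN)).2
    have hQ' : Q' ∈ db.roles := List.mem_append_right _ (List.mem_map.2 ⟨_, hr, rfl⟩)
    refine ⟨hQ', saturate_closed (subStep_mono db) (huniv hQ' (restrictTo_mem V _)) ?_⟩
    simp only [subStep, Bool.or_eq_true, Bool.and_eq_true, List.any_eq_true, decide_eq_true_iff,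
      sameElems_iff]
    refine .inr ⟨_, ih, _, hr, ⟨⟨rfl, rfl⟩, rfl⟩, ?_⟩
    rw [List.toFinset_append, toFinset_restrictTo hN,
      toFinset_restrictTo (Finset.subset_union_left.trans hN)]

/-- Besides the labels, the contexts stay in the universe: `named` leads to an individual of an
assertion and `succ` to a generating role. -/
theorem conRun_complete {db : DB} {V : Lab} {X : Ctx} {B : BC} {N : Finset Var} (h : Con db X B N)
    (hX : X ∈ db.ctxs) (hN : N ⊆ V.toFinset) :
    (X, B, restrictTo V N) ∈ conRun db (sublistsOf V) := by
  have huniv : ∀ {X B n}, X ∈ db.ctxs → B ∈ db.bcs → n ∈ sublistsOf V → (X, B, n) ∈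
      db.ctxs.flatMap fun X => db.bcs.flatMap fun B => (sublistsOf V).map fun n => (X, B, n) := by
    intro X B n hX hB hn
    simp only [List.mem_flatMap, List.mem_map]
    exact ⟨X, hX, B, hB, n, hn, rfl⟩
  have hbcs : ∀ {X B N}, Con db X B N → B ∈ db.bcs := by
    intro X B N h
    cases h with
    | top => simp [DB.bcs]
    | ca h => simp only [DB.bcs, List.mem_cons, List.mem_append, List.mem_map]; exact .inr (.inr (.inl (.inl ⟨_, h, rfl⟩)))
    | im h => simp only [DB.bcs, List.mem_cons, List.mem_append, List.mem_map]; exact .inr (.inr (.inl (.inr ⟨_, h, rfl⟩)))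
    | named _ _ h | succ _ _ _ h | pred _ h =>
      simp only [DB.bcs, List.mem_cons, List.mem_append, List.mem_map]; exact .inr (.inr (.inr ⟨_, h, rfl⟩))
    | nriNamed | nriAnon => simp [DB.bcs]
  have hra : ∀ {P a b v}, (P, a, b, v) ∈ db.ra → P ∈ db.roles ∧ Sum.inl a ∈ db.ctxs ∧
      Sum.inl b ∈ db.ctxs := by
    intro P a b v h
    simp only [DB.roles, DB.ctxs, DB.inds, List.mem_cons, List.mem_append, List.mem_map]
    exact ⟨.inl (.inl ⟨_, h, rfl⟩), .inl ⟨a, .inr (.inl (.inr ⟨_, h, rfl⟩)), rfl⟩,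
      .inl ⟨b, .inr (.inr ⟨_, h, rfl⟩), rfl⟩⟩
  have hgen : ∀ {A P v}, (A, P, v) ∈ db.gen → P ∈ db.roles ∧ Sum.inr P ∈ db.ctxs := by
    intro A P v h
    simp only [DB.roles, DB.ctxs, List.mem_append, List.mem_map]
    exact ⟨.inl (.inr ⟨_, h, rfl⟩), .inr ⟨_, h, rfl⟩⟩
  have hanon : ∀ {P}, Sum.inr P ∈ db.ctxs → P ∈ db.roles := by
    intro P h
    simp only [DB.ctxs, List.mem_append, List.mem_map] at h
    rcases h with ⟨_, _, h⟩ | ⟨r, hr, h⟩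
    · cases h
    · cases h; exact (hgen hr).1
  induction h with
  | top X =>
    refine saturate_closed (conStep_mono db _) (huniv hX (hbcs (.top X)) (restrictTo_mem V _)) ?_
    simp [conStep, sameElems_iff, toFinset_restrictTo hN]
  | @ca A a v hr =>
    refine saturate_closed (conStep_mono db _) (huniv hX (hbcs (.ca hr)) (restrictTo_mem V _)) ?_
    have : (db.ca.any fun r => decide ((Sum.inl a : Ctx) = .inl r.2.1) && decide (A = r.1) &&
        sameElems (restrictTo V v.toFinset) r.2.2) = true := by
      simp only [Bool.and_eq_true, List.any_eq_true, decide_eq_true_iff, sameElems_iff]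
      exact ⟨_, hr, ⟨rfl, rfl⟩, toFinset_restrictTo hN⟩
    simp only [conStep, this, Bool.or_true, Bool.true_or]
  | @im X A A' B v n n' hr h1 h2 ih1 ih2 =>
    refine saturate_closed (conStep_mono db _) (huniv hX (hbcs (.im hr h1 h2)) (restrictTo_mem V _)) ?_
    obtain ⟨hvn, hn'⟩ := Finset.union_subset_iff.1 hN
    obtain ⟨hv, hn⟩ := Finset.union_subset_iff.1 hvn
    simp only [conStep, Bool.or_eq_true, Bool.and_eq_true, List.any_eq_true, decide_eq_true_iff,
      sameElems_iff]
    refine .inl (.inl (.inl (.inl (.inl (.inr ⟨_, hr, rfl, _, ih1 hX hn, _, ih2 hX hn',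
      ⟨⟨⟨rfl, rfl⟩, rfl⟩, rfl⟩, ?_⟩)))))
    simp only [List.toFinset_append, toFinset_restrictTo, *]
  | @named P Q a b A B v w n n' he hs hr h ih =>
    refine saturate_closed (conStep_mono db _) (huniv hX (hbcs (.named he hs hr h))
      (restrictTo_mem V _)) ?_
    obtain ⟨hvnw, hn'⟩ := Finset.union_subset_iff.1 hN
    obtain ⟨hvn, hw⟩ := Finset.union_subset_iff.1 hvnw
    obtain ⟨hv, hn⟩ := Finset.union_subset_iff.1 hvn
    simp only [conStep, Bool.or_eq_true, Bool.and_eq_true, List.any_eq_true, decide_eq_true_iff,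
      sameElems_iff]
    refine .inl (.inl (.inl (.inl (.inr ⟨_, he, rfl, _, (subRun_complete hs (hra he).1 hn).2, _, hr,
      _, ih (hra he).2.2 hn', ⟨⟨⟨⟨rfl, rfl⟩, rfl⟩, rfl⟩, rfl⟩, ?_⟩))))
    simp only [List.toFinset_append, toFinset_restrictTo, *]
  | @succ X P Q A A' B v w n n' n'' he h1 hs hr h2 ih1 ih2 =>
    refine saturate_closed (conStep_mono db _) (huniv hX (hbcs (.succ he h1 hs hr h2))
      (restrictTo_mem V _)) ?_
    obtain ⟨h3, hn''⟩ := Finset.union_subset_iff.1 hN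
    obtain ⟨h4, hw⟩ := Finset.union_subset_iff.1 h3
    obtain ⟨h5, hn'⟩ := Finset.union_subset_iff.1 h4
    obtain ⟨hv, hn⟩ := Finset.union_subset_iff.1 h5
    simp only [conStep, Bool.or_eq_true, Bool.and_eq_true, List.any_eq_true, decide_eq_true_iff,
      sameElems_iff]
    refine .inl (.inl (.inl (.inr ⟨_, he, _, ih1 hX hn, _, (subRun_complete hs (hgen he).1 hn').2, _,
      hr, _, ih2 (hgen he).2 hn'', ⟨⟨⟨⟨⟨⟨rfl, rfl⟩, rfl⟩, rfl⟩, rfl⟩, rfl⟩, rfl⟩, ?_⟩)))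
    simp only [List.toFinset_append, toFinset_restrictTo, *]
  | @pred P Q B w n hs hr =>
    refine saturate_closed (conStep_mono db _) (huniv hX (hbcs (.pred hs hr))
      (restrictTo_mem V _)) ?_
    obtain ⟨hn, hw⟩ := Finset.union_subset_iff.1 hN
    simp only [conStep, Bool.or_eq_true, Bool.and_eq_true, List.any_eq_true, decide_eq_true_iff,
      sameElems_iff]
    refine .inl (.inl (.inr ⟨_, (subRun_complete hs (hanon hX) hn).2, _, hr,
      ⟨⟨⟨rfl, rfl⟩, rfl⟩, rfl⟩, ?_⟩))
    simp only [List.toFinset_append, toFinset_restrictTo, *]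
  | @nriNamed P P' Q Q' a b v v' n n' he he' hs hs' hr =>
    refine saturate_closed (conStep_mono db _) (huniv hX (hbcs (.nriNamed he he' hs hs' hr))
      (restrictTo_mem V _)) ?_
    obtain ⟨h3, hn'⟩ := Finset.union_subset_iff.1 hN
    obtain ⟨h4, hv'⟩ := Finset.union_subset_iff.1 h3
    obtain ⟨hv, hn⟩ := Finset.union_subset_iff.1 h4
    simp only [conStep, Bool.or_eq_true, Bool.and_eq_true, List.any_eq_true, decide_eq_true_iff,
      sameElems_iff]
    refine .inl (.inr ⟨_, he, _, he', _, (subRun_complete hs (hra he).1 hn).2, _,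
      (subRun_complete hs' (hra he').1 hn').2, _, hr,
      ⟨⟨⟨⟨⟨⟨rfl, rfl⟩, rfl⟩, rfl⟩, rfl⟩, rfl⟩, trivial⟩, ?_⟩)
    simp only [List.toFinset_append, toFinset_restrictTo, *]
  | @nriAnon P Q Q' n n' hs hs' hr =>
    refine saturate_closed (conStep_mono db _) (huniv hX (hbcs (.nriAnon hs hs' hr))
      (restrictTo_mem V _)) ?_
    obtain ⟨hn, hn'⟩ := Finset.union_subset_iff.1 hN
    simp only [conStep, Bool.or_eq_true, Bool.and_eq_true, List.any_eq_true, decide_eq_true_iff,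
      sameElems_iff]
    refine .inr ⟨_, (subRun_complete hs (hanon hX) hn).2, _,
      (subRun_complete hs' (hanon hX) hn').2, _, hr, ⟨⟨⟨rfl, rfl⟩, rfl⟩, trivial⟩, ?_⟩
    simp only [List.toFinset_append, toFinset_restrictTo, *]

/-! ## The decision procedure runs in polynomial time, given all labels -/

instance : Enc BC where
  enc
    | .top => .pair (encNat 0) .nil
    | .bot => .pair (encNat 2) .nil
    | .goal => .pair (encNat 3) .nil
    | .tok => .pair (encNat 4) .nil
    | .atom A => .pair (encNat 1) (encNat A)

instance : InjEnc BC := ⟨fun a b h => by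
  have htag : ∀ i j : ℕ, encNat i = encNat j → i = j := InjEnc.inj (α := ℕ)
  cases a <;> cases b <;> injection h with h1 h2 <;> first
    | rfl
    | exact congrArg BC.atom (htag _ _ h2)
    | exact absurd (htag _ _ h1) (by decide)⟩

instance : Enc DB where
  enc db := enc (db.ca, db.ra, db.im, db.ex, db.gen, db.ri, db.nri, db.root)

namespace Poly

variable {Γ : Type} [Enc Γ]

section DB

variable {f : Γ → DB}

theorem toTuple (hf : Poly f) : Poly fun g => ((f g).ca, (f g).ra, (f g).im, (f g).ex, (f g).gen,
    (f g).ri, (f g).nri, (f g).root) :=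
  hf.transfer fun a => ⟨a, rfl, rfl⟩

@[fun_prop] theorem ca (hf : Poly f) : Poly fun g => (f g).ca := hf.toTuple.fst
@[fun_prop] theorem ra (hf : Poly f) : Poly fun g => (f g).ra := hf.toTuple.snd.fst
@[fun_prop] theorem im (hf : Poly f) : Poly fun g => (f g).im := hf.toTuple.snd.snd.fst
@[fun_prop] theorem ex (hf : Poly f) : Poly fun g => (f g).ex := hf.toTuple.snd.snd.snd.fst
@[fun_prop] theorem gen (hf : Poly f) : Poly fun g => (f g).gen := hf.toTuple.snd.snd.snd.snd.fst
@[fun_prop] theorem ri (hf : Poly f) : Poly fun g => (f g).ri := hf.toTuple.snd.snd.snd.snd.snd.fst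
@[fun_prop] theorem nri (hf : Poly f) : Poly fun g => (f g).nri :=
  hf.toTuple.snd.snd.snd.snd.snd.snd.fst
@[fun_prop] theorem root (hf : Poly f) : Poly fun g => (f g).root :=
  hf.toTuple.snd.snd.snd.snd.snd.snd.snd

end DB

@[fun_prop]
theorem dbMk {ca : Γ → List (BC × Ind × Lab)} {ra : Γ → List (Role × Ind × Ind × Lab)}
    {im : Γ → List (BC × BC × BC × Lab)} {ex : Γ → List (Role × BC × BC × Lab)}
    {gen : Γ → List (BC × Role × Lab)} {ri : Γ → List (Role × Role × Lab)}
    {nri : Γ → List (Role × Role)} {root : Γ → Ind} (h1 : Poly ca) (h2 : Poly ra) (h3 : Poly im)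
    (h4 : Poly ex) (h5 : Poly gen) (h6 : Poly ri) (h7 : Poly nri) (h8 : Poly root) :
    Poly fun g => DB.mk (ca g) (ra g) (im g) (ex g) (gen g) (ri g) (nri g) (root g) :=
  Poly.transfer (g := fun g => (ca g, ra g, im g, ex g, gen g, ri g, nri g, root g)) (by fun_prop)
    fun a => ⟨a, rfl, rfl⟩

@[fun_prop]
theorem roleInverse {f : Γ → Role} (hf : Poly f) : Poly fun g => (f g).inverse := by
  have h : Poly Role.inverse := by
    refine Poly.of_val (g := fun v => .pair (enc (v.fst.beq .nil)) v.snd) ?_ fun P => by cases P <;> rfl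
    have := valBeq.comp (f := fun v : Val => (v.fst, Val.nil)) (by fun_prop)
    exact valPair (enc_comp this) (by fun_prop)
  exact h.comp hf

@[fun_prop]
theorem sameElems {n l : Γ → Lab} (hn : Poly n) (hl : Poly l) :
    Poly fun g => sameElems (n g) (l g) := by
  unfold DLProv.sameElems
  fun_prop

section

variable {db : Γ → DB}

@[fun_prop]
theorem roles (h : Poly db) : Poly fun g => (db g).roles := by unfold DB.roles; fun_prop

@[fun_prop]
theorem inds (h : Poly db) : Poly fun g => (db g).inds := by unfold DB.inds; fun_prop

@[fun_prop]
theorem ctxs (h : Poly db) : Poly fun g => (db g).ctxs := by unfold DB.ctxs; fun_prop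

@[fun_prop]
theorem bcs (h : Poly db) : Poly fun g => (db g).bcs := by unfold DB.bcs; fun_prop

@[fun_prop]
theorem subStep {S : Γ → List SubFact} {f : Γ → SubFact} (h : Poly db) (hS : Poly S) (hf : Poly f) :
    Poly fun g => subStep (db g) (S g) (f g) := by
  unfold DLProv.subStep; fun_prop

@[fun_prop]
theorem subRun {L : Γ → List Lab} (h : Poly db) (hL : Poly L) :
    Poly fun g => subRun (db g) (L g) := by
  unfold DLProv.subRun; fun_prop

@[fun_prop]
theorem conStep {T : Γ → List SubFact} {S : Γ → List ConFact} {f : Γ → ConFact} (h : Poly db)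
    (hT : Poly T) (hS : Poly S) (hf : Poly f) : Poly fun g => conStep (db g) (T g) (S g) (f g) := by
  unfold DLProv.conStep
  repeat' apply or
  all_goals fun_prop

@[fun_prop]
theorem conRun {L : Γ → List Lab} (h : Poly db) (hL : Poly L) :
    Poly fun g => conRun (db g) (L g) := by
  unfold DLProv.conRun; fun_prop

end

end Poly

end DLProv


namespace DLProv

/-! ## Soundness of derivations -/

theorem Why.mul_self (f : Why) : f * f = f := by
  obtain ⟨p, rfl⟩ := RingQuot.mkRingHom_surjective IdemRel f
  rw [← map_mul]
  exact RingQuot.mkRingHom_rel (.mul p)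

section ev

variable {K : Type} [CommSemiring K]

/-- The value of a product of variables. -/
def ev (val : Var → K) (N : Finset Var) : K := ∏ x ∈ N, val x

/-- The union need not be disjoint: a shared variable is counted twice on the right, and idempotence
removes the second copy. -/
theorem ev_union (hK : ∀ x : K, x * x = x) (val : Var → K) (N N' : Finset Var) :
    ev val (N ∪ N') = ev val N * ev val N' := by
  have hins : ∀ (x : Var) (N : Finset Var), ev val (insert x N) = val x * ev val N := by
    intro x N
    by_cases h : x ∈ N
    · rw [Finset.insert_eq_of_mem h, ev, ← Finset.mul_prod_erase N val h, ← mul_assoc, hK]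
    · exact Finset.prod_insert h
  induction N using Finset.induction with
  | empty => simp [ev]
  | insert x N _ ih => rw [Finset.insert_union, hins, hins, ih, mul_assoc]

end ev

/-- Interpretations of the language of rule databases. -/
structure TInterp (K : Type) where
  Dom : Type
  ind : Ind → Dom
  con : BC → Dom → K → Prop
  rol : Role → Dom → Dom → K → Prop
  val : Var → K

namespace TInterp

variable {K : Type} [CommSemiring K]

/-- The interpretation satisfies all rules. -/
structure Models (I : TInterp K) (db : DB) : Prop where
  top : ∀ d, I.con .top d 1
  inv : ∀ P d e k, I.rol P d e k → I.rol P.inverse e d k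
  ca : ∀ A a v, (A, a, v) ∈ db.ca → I.con A (I.ind a) (ev I.val v.toFinset)
  ra : ∀ P a b v, (P, a, b, v) ∈ db.ra → I.rol P (I.ind a) (I.ind b) (ev I.val v.toFinset)
  im : ∀ A A' B v d k k', (A, A', B, v) ∈ db.im → I.con A d k → I.con A' d k' →
    I.con B d (ev I.val v.toFinset * (k * k'))
  ex : ∀ P A B v d e k k', (P, A, B, v) ∈ db.ex → I.rol P d e k → I.con A e k' →
    I.con B d (ev I.val v.toFinset * (k * k'))
  gen : ∀ A P v d k, (A, P, v) ∈ db.gen → I.con A d k → ∃ e, I.rol P d e (ev I.val v.toFinset * k)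
  ri : ∀ P Q v d e k, (P, Q, v) ∈ db.ri → I.rol P d e k → I.rol Q d e (ev I.val v.toFinset * k)
  nri : ∀ P Q d e k k', (P, Q) ∈ db.nri → I.rol P d e k → ¬ I.rol Q d e k'

/-- The elements that a context stands for, with the annotation of the edge that leads to them. -/
def At (I : TInterp K) : Ctx → I.Dom → K → Prop
  | .inl a, d, k => d = I.ind a ∧ k = 1
  | .inr P, d, k => ∃ c, I.rol P c d k

variable {I : TInterp K} {db : DB}

theorem Models.sub (hI : I.Models db) (hK : ∀ x : K, x * x = x) {P Q : Role} {n : Finset Var}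
    (h : Sub db P Q n) {d e : I.Dom} {k : K} (hd : I.rol P d e k) : I.rol Q d e (ev I.val n * k) := by
  induction h with
  | refl => simpa [ev] using hd
  | step h hr ih =>
    have := hI.ri _ _ _ _ _ _ hr ih
    rwa [ev_union hK, mul_comm (ev I.val _) (ev I.val _), mul_assoc]

/-- The factor `c` expresses that labels in anonymous contexts omit the edge annotation: `pred`
yields `k`, initial facts yield `1`, and `{1, k}` is closed under products. At an individual `k =
1`, so the label is exact. -/
theorem Models.con (hI : I.Models db) (hK : ∀ x : K, x * x = x) {X : Ctx} {B : BC} {N : Finset Var}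
    (h : Con db X B N) {d : I.Dom} {k : K} (hd : I.At X d k) :
    ∃ c, (c = 1 ∨ c = k) ∧ I.con B d (ev I.val N * c) := by
  induction h generalizing d k with
  | top X => exact ⟨1, .inl rfl, by simpa [ev] using hI.top d⟩
  | ca hr =>
    obtain ⟨rfl, rfl⟩ := hd
    exact ⟨1, .inl rfl, by simpa using hI.ca _ _ _ hr⟩
  | im hr _ _ ih1 ih2 =>
    obtain ⟨c, hc, h1⟩ := ih1 hd
    obtain ⟨c', hc', h2⟩ := ih2 hd
    refine ⟨c * c', ?_, ?_⟩
    · rcases hc with rfl | rfl <;> rcases hc' with rfl | rfl <;> simp [hK]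
    · convert hI.im _ _ _ _ _ _ _ hr h1 h2 using 1
      rw [ev_union hK, ev_union hK]; ring
  | named he hs hr _ ih =>
    obtain ⟨rfl, rfl⟩ := hd
    obtain ⟨c, hc, h1⟩ := ih ⟨rfl, rfl⟩
    obtain rfl : c = 1 := hc.elim id id
    refine ⟨1, .inl rfl, ?_⟩
    convert hI.ex _ _ _ _ _ _ _ _ hr (hI.sub hK hs (hI.ra _ _ _ _ he)) h1 using 1
    rw [ev_union hK, ev_union hK, ev_union hK]; ring
  | @succ X P Q A A' B v w n n' n'' he _ hs hr _ ih1 ih2 =>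
    obtain ⟨c, hc, h1⟩ := ih1 hd
    obtain ⟨e, h2⟩ := hI.gen _ _ _ _ _ he h1
    obtain ⟨c', hc', h3⟩ := ih2 (d := e) ⟨d, h2⟩
    refine ⟨c, hc, ?_⟩
    convert hI.ex _ _ _ _ _ _ _ _ hr (hI.sub hK hs h2) h3 using 1
    -- The edge to the generated element `e` has the annotation in parentheses, so the child's
    -- unknown factor `c'` is `1` or that annotation, and is absorbed.
    have h4 : ev I.val v.toFinset * (ev I.val n * c) * c' = ev I.val v.toFinset * (ev I.val n * c) := by
      rcases hc' with rfl | rfl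
      · rw [mul_one]
      · exact hK _
    rw [ev_union hK, ev_union hK, ev_union hK, ev_union hK]
    calc _ = ev I.val n' * ev I.val w.toFinset * ev I.val n'' *
          (ev I.val v.toFinset * (ev I.val n * c)) := by ring
      _ = ev I.val n' * ev I.val w.toFinset * ev I.val n'' *
          (ev I.val v.toFinset * (ev I.val n * c) * c') := by rw [h4]
      _ = _ := by ring
  | pred hs hr =>
    obtain ⟨c, hd⟩ := hd
    refine ⟨k, .inr rfl, ?_⟩
    convert hI.ex _ _ _ _ _ _ _ _ hr (hI.inv _ _ _ _ (hI.sub hK hs hd)) (hI.top c) using 1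
    rw [ev_union hK]; ring
  | nriNamed he he' hs hs' hr =>
    exact absurd (hI.sub hK hs' (hI.ra _ _ _ _ he')) (hI.nri _ _ _ _ _ _ hr (hI.sub hK hs (hI.ra _ _ _ _ he)))
  | nriAnon hs hs' hr =>
    obtain ⟨c, hd⟩ := hd
    exact absurd (hI.sub hK hs' hd) (hI.nri _ _ _ _ _ _ hr (hI.sub hK hs hd))

end TInterp

/-! ## The canonical model -/

theorem Role.inverse_inverse (P : Role) : P.inverse.inverse = P := by cases P <;> rfl

/-- The parts of a database that describe roles are closed under inverses, and `⊥` at a generated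
element is passed on to its parent. -/
structure DB.Closed (db : DB) : Prop where
  ra : ∀ P a b v, (P, a, b, v) ∈ db.ra → (P.inverse, b, a, v) ∈ db.ra
  ri : ∀ P Q v, (P, Q, v) ∈ db.ri → (P.inverse, Q.inverse, v) ∈ db.ri
  nri : ∀ P Q, (P, Q) ∈ db.nri → (P.inverse, Q.inverse) ∈ db.nri
  bot : ∀ A P v, (A, P, v) ∈ db.gen → (P, BC.bot, BC.bot, []) ∈ db.ex

theorem Sub.inverse {db : DB} (hdb : db.Closed) {P Q : Role} {n : Finset Var} (h : Sub db P Q n) :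
    Sub db P.inverse Q.inverse n := by
  induction h with
  | refl => exact .refl
  | step _ hr ih => exact .step ih (hdb.ri _ _ _ hr)

/-- Elements of the canonical model: an individual, and a path of generated elements, given by the
generating role and the annotation of the edge. -/
abbrev Word := Ind × List (Role × Finset Var)

namespace Word

/-- The most recent edge stands at the head of the list. -/
def ctx : Word → Ctx
  | (a, []) => .inl a
  | (_, (P, _) :: _) => .inr P

def edge : Word → Finset Var
  | (_, []) => ∅
  | (_, (_, κ) :: _) => κ

/-- Facts that hold at an element; they are saturated under the annotation of its edge. -/
def Holds (db : DB) (d : Word) (B : BC) (N : Finset Var) : Prop :=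
  ∃ n, Con db d.ctx B n ∧ N ∪ d.edge = n ∪ d.edge

/-- Generating facts that agree in the role and in `v ∪ N` share a child; nothing else about the
generating fact is visible at the child. -/
inductive Valid (db : DB) : Word → Prop
  | ind {a : Ind} : a ∈ db.inds → Valid db (a, [])
  | succ {d : Word} {A : BC} {P : Role} {v : Lab} {N : Finset Var} :
      Valid db d → (A, P, v) ∈ db.gen → Holds db d A N →
      Valid db (d.1, (P, v.toFinset ∪ N) :: d.2)

inductive Rel (db : DB) : Role → Word → Word → Finset Var → Prop
  | named {P Q : Role} {a b : Ind} {v : Lab} {n : Finset Var} :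
      (P, a, b, v) ∈ db.ra → Sub db P Q n → Rel db Q (a, []) (b, []) (v.toFinset ∪ n)
  | down {P Q : Role} {n κ : Finset Var} (d : Word) :
      Sub db P Q n → Rel db Q d (d.1, (P, κ) :: d.2) (κ ∪ n)
  | up {P Q : Role} {n κ : Finset Var} (d : Word) :
      Sub db P Q.inverse n → Rel db Q (d.1, (P, κ) :: d.2) d (κ ∪ n)

variable {db : DB}

theorem Holds.top (d : Word) : d.Holds db .top ∅ := ⟨∅, .top _, rfl⟩

theorem Holds.of_con {d : Word} {B : BC} {N : Finset Var} (h : Con db d.ctx B N) : d.Holds db B N :=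
  ⟨N, h, rfl⟩

theorem Holds.im {d : Word} {A A' B : BC} {v : Lab} {N N' : Finset Var}
    (hr : (A, A', B, v) ∈ db.im) (h : d.Holds db A N) (h' : d.Holds db A' N') :
    d.Holds db B (v.toFinset ∪ (N ∪ N')) := by
  obtain ⟨n, h1, h2⟩ := h
  obtain ⟨n', h1', h2'⟩ := h'
  refine ⟨_, .im hr h1 h1', ?_⟩
  calc v.toFinset ∪ (N ∪ N') ∪ d.edge = v.toFinset ∪ (N ∪ d.edge) ∪ (N' ∪ d.edge) := by
        ext; simp only [Finset.mem_union]; tauto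
    _ = v.toFinset ∪ n ∪ n' ∪ d.edge := by
        rw [h2, h2']; ext; simp only [Finset.mem_union]; tauto

theorem Valid.gen_of_cons {a : Ind} {P : Role} {κ : Finset Var} {l : List (Role × Finset Var)}
    (h : Valid db (a, (P, κ) :: l)) : ∃ A v N, (A, P, v) ∈ db.gen ∧ Holds db (a, l) A N ∧
      κ = v.toFinset ∪ N ∧ Valid db (a, l) := by
  cases h with
  | succ h hr hN => exact ⟨_, _, _, hr, hN, rfl, h⟩

/-- The heart of completeness. An edge from parent to child is handled by `succ`, where the edge
absorbs the imprecision of the child's labels. An edge from child to parent is handled by `pred`,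
which needs the restriction `hrestr`. -/
theorem Holds.ex {d e : Word} {Q : Role} {A B : BC} {w : Lab} {N N' : Finset Var}
    (hr : (Q, A, B, w) ∈ db.ex) (hd : Valid db d) (he : Valid db e) (h : Rel db Q d e N)
    (hA : e.Holds db A N')
    (htop : A = .top → N' = ∅)
    (hrestr : ∀ A' P v n, (A', P, v) ∈ db.gen → Sub db P Q.inverse n → A = .top) :
    d.Holds db B (w.toFinset ∪ (N ∪ N')) := by
  obtain ⟨m, h1, h2⟩ := hA
  cases h with
  | @named P _ a b v n hra hs =>
    have hN : N' = m := by simpa [edge] using h2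
    subst hN
    refine ⟨_, .named hra hs hr h1, ?_⟩
    ext; simp only [Finset.mem_union]; tauto
  -- Modulo the edge `v ∪ M` the label `N'` may be replaced by the derived `m`, and modulo the edge
  -- of `d` the label `M` by the derived `m'`.
  | @down P _ n κ _ hs =>
    obtain ⟨A', v, M, hg, ⟨m', h3, h4⟩, rfl, -⟩ := he.gen_of_cons
    refine ⟨_, .succ hg h3 hs hr h1, ?_⟩
    have h2 : N' ∪ (v.toFinset ∪ M) = m ∪ (v.toFinset ∪ M) := h2
    calc w.toFinset ∪ (v.toFinset ∪ M ∪ n ∪ N') ∪ d.edge =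
          w.toFinset ∪ n ∪ (N' ∪ (v.toFinset ∪ M)) ∪ d.edge := by ac_rfl
      _ = w.toFinset ∪ n ∪ m ∪ v.toFinset ∪ (M ∪ d.edge) := by rw [h2]; ac_rfl
      _ = w.toFinset ∪ n ∪ m ∪ v.toFinset ∪ (m' ∪ d.edge) := by rw [← h4]
      _ = _ := by ac_rfl
  -- The premise sits at the parent, whose edge is not part of the label here; `pred` does not see
  -- `N'` at all, so `htop` is needed to make it empty.
  | @up P _ n κ e hs =>
    obtain ⟨A', v, M, hg, -, -, -⟩ := hd.gen_of_cons
    obtain rfl := hrestr _ _ _ _ hg hs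
    obtain rfl := htop rfl
    refine ⟨_, .pred hs (by rwa [Role.inverse_inverse]), ?_⟩
    change w.toFinset ∪ (κ ∪ n ∪ ∅) ∪ κ = n ∪ w.toFinset ∪ κ
    ext; simp only [Finset.mem_union, Finset.notMem_empty]; tauto

theorem Rel.inverse (hdb : db.Closed) {Q : Role} {d e : Word} {N : Finset Var} (h : Rel db Q d e N) :
    Rel db Q.inverse e d N := by
  cases h with
  | named hra hs => exact .named (hdb.ra _ _ _ _ hra) (hs.inverse hdb)
  | down _ hs => exact .up d (by rwa [Role.inverse_inverse])
  | up _ hs => exact .down e hs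

theorem Rel.ri {P Q : Role} {v : Lab} {d e : Word} {N : Finset Var} (hdb : db.Closed)
    (hr : (P, Q, v) ∈ db.ri) (h : Rel db P d e N) : Rel db Q d e (v.toFinset ∪ N) := by
  cases h with
  | @named P' _ a b u n hra hs =>
    rw [show v.toFinset ∪ (u.toFinset ∪ n) = u.toFinset ∪ (n ∪ v.toFinset) by
      ext; simp only [Finset.mem_union]; tauto]
    exact .named hra (.step hs hr)
  | @down P' _ n κ _ hs =>
    rw [show v.toFinset ∪ (κ ∪ n) = κ ∪ (n ∪ v.toFinset) by
      ext; simp only [Finset.mem_union]; tauto]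
    exact .down d (.step hs hr)
  | @up P' _ n κ _ hs =>
    rw [show v.toFinset ∪ (κ ∪ n) = κ ∪ (n ∪ v.toFinset) by
      ext; simp only [Finset.mem_union]; tauto]
    exact .up e (.step hs (hdb.ri _ _ _ hr))

/-- By the closure rules for `⊥` an inconsistent child makes its parent inconsistent, so it is
enough to exclude `⊥` at individuals. -/
theorem not_holds_bot (hdb : db.Closed) (hcons : ∀ a ∈ db.inds, ∀ N, ¬ Con db (.inl a) .bot N)
    {d : Word} (hd : Valid db d) (N : Finset Var) : ¬ d.Holds db .bot N := by
  induction hd generalizing N with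
  | ind ha => rintro ⟨n, h, -⟩; exact hcons _ ha _ h
  | succ _ hr hN ih =>
    rintro ⟨n, h, -⟩
    obtain ⟨m, hm, -⟩ := hN
    exact ih _ (.of_con (.succ hr hm .refl (hdb.bot _ _ _ hr) h))

/-- Two edges between the same pair of words have the same origin: assertions about the same
individuals, or one generated edge read in the same direction. `nriNamed` and `nriAnon` then derive
`⊥`. -/
theorem not_rel_of_nri (hdb : db.Closed) (hcons : ∀ a ∈ db.inds, ∀ N, ¬ Con db (.inl a) .bot N)
    {d e : Word} (hd : Valid db d) (he : Valid db e) {P Q : Role} (hr : (P, Q) ∈ db.nri)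
    {N N' : Finset Var} (h : Rel db P d e N) : ¬ Rel db Q d e N' := by
  intro h'
  -- Excludes that each of two words is a child of the other.
  have hlen : ∀ (x y : Role × Finset Var) (l : List (Role × Finset Var)), l ≠ x :: y :: l :=
    fun x y l h => by
      have := congrArg List.length h
      rw [List.length_cons, List.length_cons] at this
      omega
  generalize hd' : d = d', he' : e = e' at h'
  cases h with
  | @named P' _ a b v n hra hs =>
    cases h' with
    | named hra' hs' =>
      cases hd'; cases he'
      exact not_holds_bot hdb hcons hd _ (.of_con (.nriNamed hra hra' hs hs' hr))
    | down => cases hd'; cases he'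
    | up => cases hd'
  | @down P' _ n κ _ hs =>
    cases h' with
    | named => cases hd'; cases he'
    | down _ hs' =>
      subst hd'; cases he'
      exact not_holds_bot hdb hcons he _ (.of_con (.nriAnon hs hs' hr))
    | up =>
      subst hd'
      exact absurd (congrArg Prod.snd he').symm (hlen _ _ _)
  | @up P' _ n κ _ hs =>
    cases h' with
    | named => cases hd'
    | down =>
      subst hd'
      exact absurd (congrArg Prod.snd he') (hlen _ _ _)
    | up _ hs' =>
      subst he'; cases hd'
      exact not_holds_bot hdb hcons hd _ (.of_con (.nriAnon hs hs' (hdb.nri _ _ hr)))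

end Word

end DLProv


namespace DLProv

/-! ## Separation of monomials -/

/-- The two-element semiring with disjunction and conjunction. -/
def BoolSemiring : Type := Bool

instance : Zero BoolSemiring := ⟨false⟩
instance : One BoolSemiring := ⟨true⟩
instance : Add BoolSemiring := ⟨or⟩
instance : Mul BoolSemiring := ⟨and⟩

instance : CommSemiring BoolSemiring where
  nsmul := nsmulRec
  npow := npowRec
  add_assoc := by unfold BoolSemiring; decide
  add_comm := by unfold BoolSemiring; decide
  zero_add := by unfold BoolSemiring; decide
  add_zero := by unfold BoolSemiring; decide
  mul_assoc := by unfold BoolSemiring; decide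
  mul_comm := by unfold BoolSemiring; decide
  one_mul := by unfold BoolSemiring; decide
  mul_one := by unfold BoolSemiring; decide
  left_distrib := by unfold BoolSemiring; decide
  right_distrib := by unfold BoolSemiring; decide
  zero_mul := by unfold BoolSemiring; decide
  mul_zero := by unfold BoolSemiring; decide

/-- Evaluate in the Boolean semiring, sending exactly the variables of `m'` to `1`. Both operations
are idempotent there, so evaluation factors through `Why`; it gives `1` on `m'` and `0` on any `m`
that is not contained in `m'`. -/
theorem monomial_injective : Function.Injective monomial := by
  have key : ∀ m m' : Finset PVar, monomial m = monomial m' → m ⊆ m' := by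
    intro m m' h x hx
    by_contra hx'
    let f : MvPolynomial PVar ℕ →+* BoolSemiring :=
      MvPolynomial.eval₂Hom (Nat.castRingHom BoolSemiring) fun y => if y ∈ m' then 1 else 0
    have hadd : ∀ b : BoolSemiring, b + b = b := by unfold BoolSemiring; decide
    have hmul : ∀ b : BoolSemiring, b * b = b := by unfold BoolSemiring; decide
    have hf : ∀ ⦃p q⦄, IdemRel p q → f p = f q := by
      rintro _ _ (p | p)
      · rw [map_add, hadd]
      · rw [map_mul, hmul]
    let g := RingQuot.lift ⟨f, hf⟩
    have hg : ∀ y, g (whyVar y) = if y ∈ m' then 1 else 0 := by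
      intro y
      rw [whyVar, RingQuot.lift_mkRingHom_apply]
      simp [f]
    have h1 : g (monomial m) = g (monomial m') := by rw [h]
    rw [monomial, monomial, map_prod, map_prod, Finset.prod_eq_zero hx (by rw [hg, if_neg hx']),
      Finset.prod_eq_one fun y hy => by rw [hg, if_pos hy]] at h1
    exact absurd h1 (show (false : Bool) ≠ true by decide)
  exact fun m m' h => Finset.Subset.antisymm (key _ _ h) (key _ _ h.symm)

theorem ev_toFinset {K : Type} [CommSemiring K] (hK : ∀ x : K, x * x = x) (val : Var → K) (l : Lab) :
    ev val l.toFinset = (l.map val).prod := by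
  induction l with
  | nil => rfl
  | cons x l ih =>
    rw [List.toFinset_cons, Finset.insert_eq, ev_union hK, ih, List.map_cons, List.prod_cons]
    simp [ev]

theorem ev_eq_monomial (f : Var → ℕ) (hf : Function.Injective f) (N : Finset Var) :
    ev (fun x => whyVar (f x)) N = monomial (N.map ⟨f, hf⟩) := by
  rw [monomial, Finset.prod_map]; rfl

theorem exists_renaming (S : Finset ℕ) :
    ∃ f : Var → ℕ, Function.Injective f ∧ ∀ x ∈ S, f (.inl x) = x := by
  obtain ⟨M, hM⟩ := S.bddAbove
  -- Numbers up to the bound `M` of `S` stay fixed; above `M`, the remaining old variables get even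
  -- offsets from `M` and the fresh ones odd offsets.
  refine ⟨Sum.elim (fun x => if x ≤ M then x else M + 2 * x)
    fun p => M + (2 * Encodable.encode p + 1), ?_, fun x hx => if_pos (hM hx)⟩
  rintro (x | p) (y | q) h <;> simp only [Sum.elim_inl, Sum.elim_inr] at h
  · exact congrArg _ (by split_ifs at h <;> omega)
  · split_ifs at h <;> omega
  · split_ifs at h <;> omega
  · exact congrArg _ (Encodable.encode_injective (by omega))

/-! ## The rule database of an ontology -/

def labOf : Option PVar → Lab
  | none => []
  | some x => [.inl x]

def Concept.toBC : Concept → BC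
  | .atom A => .atom A
  | _ => .top

def RConcept.heads : RConcept → List BC
  | .atom A => [.atom A]
  | .ex _ => []
  | .bot => [.bot]

def caRules : Ax × Option PVar → List (BC × Ind × Lab)
  | (.ca A a, l) => [(.atom A, .inl a, labOf l)]
  | _ => []

/-- A role assertion and its inverse. -/
def bothWays (P : Role) (a b : Ind) (v : Lab) : List (Role × Ind × Ind × Lab) :=
  [(P, a, b, v), (P.inverse, b, a, v)]

def raRules : Ax × Option PVar → List (Role × Ind × Ind × Lab)
  | (.ra R a b, l) => bothWays (.name R) (.inl a) (.inl b) (labOf l)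
  | _ => []

/-- A plain `A ⊑ B` is stored as `A ⊓ ⊤ ⊑ B`; `⊤` has annotation `1`, so the second premise costs
nothing. -/
def imRules : Ax × Option PVar → List (BC × BC × BC × Lab)
  | (.gci .top D, l) => D.heads.map fun B => (.top, .top, B, labOf l)
  | (.gci (.atom A) D, l) => D.heads.map fun B => (.atom A, .top, B, labOf l)
  | (.gci (.inter C C') D, l) => D.heads.map fun B => (C.toBC, C'.toBC, B, labOf l)
  | _ => []

def exRules : Ax × Option PVar → List (Role × BC × BC × Lab)
  | (.gci (.ex P C) D, l) => D.heads.map fun B => (P, C.toBC, B, labOf l)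
  | _ => []

def genRules : Ax × Option PVar → List (BC × Role × Lab)
  | (.gci .top (.ex P), l) => [(.top, P, labOf l)]
  | (.gci (.atom A) (.ex P), l) => [(.atom A, P, labOf l)]
  | _ => []

def riRules : Ax × Option PVar → List (Role × Role × Lab)
  | (.ri P Q, l) => [(P, Q, labOf l), (P.inverse, Q.inverse, labOf l)]
  | _ => []

def nriRules : Ax × Option PVar → List (Role × Role)
  | (.nri P Q, _) => [(P, Q), (P.inverse, Q.inverse)]
  | _ => []

/-- The occurrences of subconcepts, with their positions and the individuals they are asserted of.
The position of an existential restriction also serves as the name of its witness. -/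
def Concept.nodes : Concept → Path → Ind → List (Concept × Path × Ind)
  | .top, p, i => [(.top, p, i)]
  | .atom A, p, i => [(.atom A, p, i)]
  | .ex P C, p, i => (.ex P C, p, i) :: C.nodes (false :: p) (.inr p)
  | .inter C D, p, i => (.inter C D, p, i) :: (C.nodes (false :: p) i ++ D.nodes (true :: p) i)

def nodeCa : Concept × Path × Ind → List (BC × Ind × Lab)
  | (.atom A, p, i) => [(.atom A, i, [.inr p])]
  | _ => []

def nodeRa : Concept × Path × Ind → List (Role × Ind × Ind × Lab)
  | (.ex P _, p, i) => bothWays P i (.inr p) [.inr p]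
  | _ => []

def nodeVars : Concept × Path × Ind → List Var
  | (.atom _, p, _) => [.inr p]
  | (.ex _ _, p, _) => [.inr p]
  | _ => []

/-- For `⊥` there is no goal rule: entailment of `C ⊑ ⊥` is inconsistency of the frozen `C`. -/
def goalIm : RConcept → List (BC × BC × BC × Lab)
  | .atom B => [(.atom B, .top, .goal, [])]
  | _ => []

def goalEx : RConcept → List (Role × BC × BC × Lab)
  | .ex P => [(P, .top, .goal, [])]
  | _ => []

/-- The root individual is `.inr []`. Positions start at `[true]`, so no witness of an existential
restriction collides with it. -/
def Ax.nodes : Ax → List (Concept × Path × Ind)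
  | .gci C _ => C.nodes [true] (.inr [])
  | _ => []

/-- The part of the database that describes the query, given the nodes of its left-hand side. -/
def queryRules : Ax → List (Concept × Path × Ind) → DB
  | .gci _ D, ns => ⟨ns.flatMap nodeCa, ns.flatMap nodeRa, goalIm D, goalEx D, [], [], [], .inr []⟩
  -- The auxiliary concept `tok` marks the target of the frozen edge, so that `∃Q.tok ⊑ goal` tests
  -- for a `Q`-edge to this very individual.
  | .ri P Q, _ => ⟨[(.tok, .inr [false], [])], bothWays P (.inr []) (.inr [false]) [.inr []], [],
      [(Q, .tok, .goal, [])], [], [], [], .inr []⟩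
  -- A pair in both roles is frozen and there is no goal: the axiom is entailed iff these data are
  -- inconsistent.
  | .nri P Q, _ => ⟨[], bothWays P (.inr []) (.inr [false]) [.inr []] ++
      bothWays Q (.inr []) (.inr [false]) [.inr [false]],
      [], [], [], [], [], .inr []⟩
  | .ca A a, _ => ⟨[], [], [(.atom A, .top, .goal, [])], [], [], [], [], .inl a⟩
  | .ra R a b, _ => ⟨[(.tok, .inl b, [])], [], [], [(.name R, .tok, .goal, [])], [], [], [], .inl a⟩

/-- The variables that the label of the goal must contain. A negative role inclusion needs none, as
its goal is never derived. -/
def freshVars : Ax → List (Concept × Path × Ind) → List Var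
  | .gci _ _, ns => ns.flatMap nodeVars
  | .ri _ _, _ => [.inr []]
  | _, _ => []

def mkDB (O : AnnOntology) (X : DB) : DB where
  ca := O.flatMap caRules ++ X.ca
  ra := O.flatMap raRules ++ X.ra
  im := O.flatMap imRules ++ X.im
  ex := O.flatMap exRules ++ (O.flatMap genRules).map (fun r => (r.2.1, .bot, .bot, [])) ++ X.ex
  gen := O.flatMap genRules
  ri := O.flatMap riRules
  nri := O.flatMap nriRules
  root := X.root

theorem mkDB_closed (O : AnnOntology) {X : DB}
    (hX : ∀ P a b v, (P, a, b, v) ∈ X.ra → (P.inverse, b, a, v) ∈ X.ra) : (mkDB O X).Closed where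
  ra := by
    intro P a b v h
    simp only [mkDB, List.mem_append, List.mem_flatMap] at h ⊢
    refine h.imp ?_ (hX _ _ _ _)
    rintro ⟨⟨β, l⟩, hβ, h⟩
    refine ⟨_, hβ, ?_⟩
    cases β <;> simp_all [raRules, bothWays]
    rcases h with ⟨rfl, rfl, rfl, rfl⟩ | ⟨rfl, rfl, rfl, rfl⟩ <;> simp [Role.inverse]
  ri := by
    intro P Q v h
    simp only [mkDB, List.mem_flatMap] at h ⊢
    obtain ⟨⟨β, l⟩, hβ, h⟩ := h
    refine ⟨_, hβ, ?_⟩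
    cases β <;> simp_all [riRules]
    rcases h with ⟨rfl, rfl, rfl⟩ | ⟨rfl, rfl, rfl⟩ <;> simp [Role.inverse_inverse]
  nri := by
    intro P Q h
    simp only [mkDB, List.mem_flatMap] at h ⊢
    obtain ⟨⟨β, l⟩, hβ, h⟩ := h
    refine ⟨_, hβ, ?_⟩
    cases β <;> simp_all [nriRules]
    rcases h with ⟨rfl, rfl⟩ | ⟨rfl, rfl⟩ <;> simp [Role.inverse_inverse]
  bot := fun A P v h => List.mem_append_left _ (List.mem_append_right _ (List.mem_map.2 ⟨_, h, rfl⟩))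

/-! ## The restriction on the ontology -/

theorem genRules_eq {β : Ax × Option PVar} {A : BC} {P : Role} {v : Lab}
    (h : (A, P, v) ∈ genRules β) :
    ∃ C, C.IsSimple ∧ β.1 = .gci C (.ex P) ∧ A = C.toBC ∧ v = labOf β.2 := by
  obtain ⟨β, l⟩ := β
  rcases β with ⟨C, D⟩ | _ | _ | _ | _ <;> [skip; simp_all [genRules]; simp_all [genRules];
    simp_all [genRules]; simp_all [genRules]]
  rcases C with _ | _ | _ | _ <;> rcases D with _ | _ | _ <;>
    simp_all [genRules, Concept.toBC, Concept.IsSimple]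

theorem Interp.role_inverse (I : Interp) (P : Role) (d e : I.Dom) :
    (d, e) ∈ I.role P.inverse ↔ (e, d) ∈ I.role P := by cases P <;> rfl

theorem Sub.std {O : AnnOntology} {X : DB} {I : Interp} (hI : ∀ β ∈ axiomsOf O, I.Sat β)
    {P Q : Role} {n : Finset Var} (h : Sub (mkDB O X) P Q n) {d e : I.Dom} (hd : (d, e) ∈ I.role P) :
    (d, e) ∈ I.role Q := by
  induction h with
  | refl => exact hd
  | step _ hr ih =>
    simp only [mkDB, List.mem_flatMap] at hr
    obtain ⟨⟨β, l⟩, hβ, h⟩ := hr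
    have hs := hI β ⟨l, hβ⟩
    cases β <;> simp only [riRules, List.not_mem_nil, List.mem_cons, or_false] at h
    rcases h with h | h <;> cases h
    · exact hs ih
    · rw [Interp.role_inverse] at ih ⊢
      exact hs ih

/-- A rule `C ⊑ ∃P` and a derived inclusion of `P` in `inv(Q)` entail `C ⊑ ∃inv(Q)` in the standard
semantics; the restriction for the role `inv(Q)` then concerns exactly the inclusions `∃Q.A ⊑ B`. -/
theorem eq_top_of_isRestr {O : AnnOntology} {X : DB} (hO : IsRestr (axiomsOf O)) {Q : Role}
    {A : Concept} {B : RConcept} {l : Option PVar} (hβ : (Ax.gci (.ex Q A) B, l) ∈ O) {A' : BC}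
    {P : Role} {v : Lab} {n : Finset Var} (hg : (A', P, v) ∈ (mkDB O X).gen)
    (hs : Sub (mkDB O X) P Q.inverse n) : A = .top := by
  obtain ⟨β, hβ', hg⟩ := List.mem_flatMap.1 hg
  obtain ⟨C, hC, hβC, -, -⟩ := genRules_eq hg
  refine hO.2 Q.inverse ?_ A B ⟨l, by rwa [Role.inverse_inverse]⟩
  have hstd : ∀ I : Interp, (∀ β ∈ axiomsOf O, I.Sat β) → ∀ d ∈ I.concept C,
      d ∈ I.rconcept (.ex Q.inverse) := by
    intro I hI d hd
    have h1 : I.Sat (.gci C (.ex P)) := hI _ ⟨β.2, by rw [← hβC]; exact hβ'⟩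
    obtain ⟨e, he, _⟩ := h1 hd
    exact ⟨e, hs.std hI he, trivial⟩
  cases C with
  -- The restriction speaks of concept names only; when `⊤` generates, any name will do.
  | top => exact ⟨0, fun I hI d _ => hstd I hI d trivial⟩
  | atom A => exact ⟨A, hstd⟩
  | ex => exact hC.elim
  | inter => exact hC.elim

/-! ## Entailment in the canonical model -/

section canon

variable (db : DB) (val : Var → Why)

/-- The canonical model of a database. -/
noncomputable def canon : AnnInterp Why where
  Dom := {d : Word // d.Valid db}
  -- Individual names that do not occur in the database are sent to the root, an arbitrary choice.
  ind a := open Classical in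
    if h : Sum.inl a ∈ db.inds then ⟨(.inl a, []), .ind h⟩ else ⟨(db.root, []), .ind (by simp [DB.inds])⟩
  con A := {p | ∃ N, p.1.1.Holds db (.atom A) N ∧ p.2 = ev val N}
  rol R := {p | ∃ N, Word.Rel db (.name R) p.1.1 p.2.1.1 N ∧ p.2.2 = ev val N}

variable {db val}

theorem mem_canon_role (hdb : db.Closed) (P : Role) (d e : (canon db val).Dom) (k : Why) :
    (d, e, k) ∈ (canon db val).role P ↔ ∃ N, Word.Rel db P d.1 e.1 N ∧ k = ev val N := by
  cases P with
  | name R => rfl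
  | inv R =>
    constructor
    · rintro ⟨N, h, hk⟩; exact ⟨N, h.inverse hdb, hk⟩
    · rintro ⟨N, h, hk⟩; exact ⟨N, h.inverse hdb, hk⟩

theorem canon_concept_simple {C : Concept} (hC : C.IsSimple) {d : (canon db val).Dom} {k : Why}
    (h : (d, k) ∈ (canon db val).concept C) :
    ∃ N, d.1.Holds db C.toBC N ∧ k = ev val N ∧ (C.toBC = .top → N = ∅) := by
  cases C with
  | top => exact ⟨∅, .top _, h, fun _ => rfl⟩
  | atom A =>
    obtain ⟨N, h, hk⟩ := h
    exact ⟨N, h, hk, fun h => by cases h⟩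
  | ex => exact hC.elim
  | inter => exact hC.elim

theorem canon_rconcept (hdb : db.Closed) (hcons : ∀ a ∈ db.inds, ∀ N, ¬ Con db (.inl a) .bot N)
    {D : RConcept} {B : BC} (hB : B ∈ D.heads) {d : (canon db val).Dom} {N : Finset Var}
    (h : d.1.Holds db B N) : (d, ev val N) ∈ (canon db val).rconcept D := by
  cases D with
  | atom A =>
    obtain rfl := List.mem_singleton.1 hB
    exact ⟨N, h, rfl⟩
  | ex => cases hB
  | bot =>
    obtain rfl := List.mem_singleton.1 hB
    exact (Word.not_holds_bot hdb hcons d.2 _ h).elim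

theorem RConcept.IsSimple.exists_head {D : RConcept} (h : D.IsSimple) : ∃ B, B ∈ D.heads := by
  cases D with
  | atom A => exact ⟨_, List.mem_singleton_self _⟩
  | ex => exact h.elim
  | bot => exact ⟨_, List.mem_singleton_self _⟩

theorem canon_gen (hdb : db.Closed) {A : BC} {P : Role} {v : Lab} (hr : (A, P, v) ∈ db.gen)
    {d : (canon db val).Dom} {N : Finset Var} (h : d.1.Holds db A N) :
    (d, ev val (v.toFinset ∪ N)) ∈ (canon db val).rconcept (.ex P) := by
  refine ⟨⟨_, .succ d.2 hr h⟩, _, 1, (mem_canon_role hdb _ _ _ _).2 ⟨_, .down d.1 .refl, rfl⟩, rfl, ?_⟩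
  rw [Finset.union_empty, mul_one]

/-- Consistency is needed for inclusions into `⊥` and negative role inclusions, the restriction only
for `∃P.A ⊑ B`. `hval` says that `val` leaves the variables of the ontology unchanged. -/
theorem canon_sat {O : AnnOntology} {X : DB} (hO : IsRestr (axiomsOf O)) (hdb : (mkDB O X).Closed)
    (hcons : ∀ a ∈ (mkDB O X).inds, ∀ N, ¬ Con (mkDB O X) (.inl a) .bot N)
    (hval : ∀ β ∈ O, annot β.2 = ev val (labOf β.2).toFinset) :
    ∀ β ∈ O, (canon (mkDB O X) val).Sat (annot β.2) β.1 := by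
  intro β hβ
  rw [hval β hβ]
  have hnorm := hO.1 β.1 ⟨β.2, hβ⟩
  have hK := Why.mul_self
  obtain ⟨β, l⟩ := β
  have him : ∀ r, r ∈ imRules (β, l) → r ∈ (mkDB O X).im := fun r hr =>
    List.mem_append_left _ (List.mem_flatMap.2 ⟨_, hβ, hr⟩)
  have hgen : ∀ r, r ∈ genRules (β, l) → r ∈ (mkDB O X).gen := fun r hr =>
    List.mem_flatMap.2 ⟨_, hβ, hr⟩
  cases β with
  | gci C D =>
    intro d k hd
    have hsimple : C.IsSimple → (∀ B ∈ D.heads, (C.toBC, BC.top, B, labOf l) ∈ imRules (.gci C D, l)) →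
        (∀ P, D = .ex P → (C.toBC, P, labOf l) ∈ genRules (.gci C D, l)) →
        (d, ev val (labOf l).toFinset * k) ∈ (canon (mkDB O X) val).rconcept D := by
      intro hC h1 h2
      obtain ⟨N, h3, rfl, -⟩ := canon_concept_simple hC hd
      rw [← ev_union hK]
      by_cases hD : D.IsSimple
      · obtain ⟨B, hB⟩ := hD.exists_head
        have := canon_rconcept (val := val) hdb hcons hB (h3.im (him _ (h1 B hB)) (.top _))
        rwa [Finset.union_empty] at this
      · cases D with
        | ex P => exact canon_gen hdb (hgen _ (h2 P rfl)) h3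
        | atom => exact (hD trivial).elim
        | bot => exact (hD trivial).elim
    cases C with
    | top =>
      exact hsimple trivial (fun B hB => List.mem_map.2 ⟨B, hB, rfl⟩)
        fun P h => by subst h; exact List.mem_singleton_self _
    | atom A' =>
      exact hsimple trivial (fun B hB => List.mem_map.2 ⟨B, hB, rfl⟩)
        fun P h => by subst h; exact List.mem_singleton_self _
    | inter C C' =>
      obtain ⟨hC, hC', hD⟩ := hnorm
      obtain ⟨k, k', h1, h2, h3⟩ := hd
      obtain rfl : _ = k * k' := h3
      obtain ⟨N, h1, rfl, -⟩ := canon_concept_simple hC h1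
      obtain ⟨N', h2, rfl, -⟩ := canon_concept_simple hC' h2
      obtain ⟨B, hB⟩ := hD.exists_head
      rw [← ev_union hK, ← ev_union hK]
      exact canon_rconcept hdb hcons hB (h1.im (him _ (List.mem_map.2 ⟨B, hB, rfl⟩)) h2)
    | ex P C =>
      obtain ⟨hC, hD⟩ := hnorm
      obtain ⟨e, k, k', h1, h2, h3⟩ := hd
      obtain rfl : _ = k * k' := h3
      obtain ⟨N, h1, rfl⟩ := (mem_canon_role hdb _ _ _ _).1 h1
      obtain ⟨N', h4, rfl, htop⟩ := canon_concept_simple hC h2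
      obtain ⟨B, hB⟩ := hD.exists_head
      rw [← ev_union hK, ← ev_union hK]
      refine canon_rconcept hdb hcons hB (Word.Holds.ex (List.mem_append_left _ (List.mem_append_left _
        (List.mem_flatMap.2 ⟨_, hβ, List.mem_map.2 ⟨B, hB, rfl⟩⟩))) d.2 e.2 h1 h4 htop ?_)
      intro A' P' v n hg hs
      rw [eq_top_of_isRestr hO hβ hg hs]
      rfl
  | ri P Q =>
    intro d e k hd
    obtain ⟨N, h, rfl⟩ := (mem_canon_role hdb _ _ _ _).1 hd
    refine (mem_canon_role hdb _ _ _ _).2 ⟨_, h.ri hdb (List.mem_flatMap.2 ⟨_, hβ,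
      List.mem_cons_self⟩), (ev_union hK _ _ _).symm⟩
  | nri P Q =>
    intro d e k k' hd hd'
    obtain ⟨N, h, -⟩ := (mem_canon_role hdb _ _ _ _).1 hd
    obtain ⟨N', h', -⟩ := (mem_canon_role hdb _ _ _ _).1 hd'
    exact Word.not_rel_of_nri hdb hcons d.2 e.2 (List.mem_flatMap.2 ⟨_, hβ, List.mem_cons_self⟩) h h'
  | ca A a =>
    have h1 : (BC.atom A, Sum.inl a, labOf l) ∈ (mkDB O X).ca :=
      List.mem_append_left _ (List.mem_flatMap.2 ⟨_, hβ, List.mem_singleton_self _⟩)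
    have ha : Sum.inl a ∈ (mkDB O X).inds := List.mem_cons_of_mem _
      (List.mem_append_left _ (List.mem_append_left _ (List.mem_map.2 ⟨_, h1, rfl⟩)))
    refine ⟨(labOf l).toFinset, ?_, rfl⟩
    simp only [canon, dif_pos ha]
    exact .of_con (.ca h1)
  | ra R a b =>
    have h1 : (Role.name R, Sum.inl a, Sum.inl b, labOf l) ∈ (mkDB O X).ra :=
      List.mem_append_left _ (List.mem_flatMap.2 ⟨_, hβ, List.mem_cons_self⟩)
    have ha : Sum.inl a ∈ (mkDB O X).inds := List.mem_cons_of_mem _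
      (List.mem_append_left _ (List.mem_append_right _ (List.mem_map.2 ⟨_, h1, rfl⟩)))
    have hb : Sum.inl b ∈ (mkDB O X).inds := List.mem_cons_of_mem _
      (List.mem_append_right _ (List.mem_map.2 ⟨_, h1, rfl⟩))
    refine ⟨(labOf l).toFinset, ?_, rfl⟩
    simp only [canon, dif_pos ha, dif_pos hb]
    have := Word.Rel.named h1 .refl
    rwa [Finset.union_empty] at this

end canon

end DLProv


namespace DLProv

/-! ## Interpretations of the rule database of a query -/

theorem AnnInterp.role_inverse {K : Type} (I : AnnInterp K) (P : Role) (d e : I.Dom) (k : K) :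
    (d, e, k) ∈ I.role P.inverse ↔ (e, d, k) ∈ I.role P := by cases P <;> rfl

/-- An annotated interpretation, extended to fresh individuals and variables and to the auxiliary
concepts. -/
noncomputable def AnnInterp.extend (I : AnnInterp Why) (ι : Path → I.Dom) (ν : Path → Why)
    (goal tok : I.Dom → Why → Prop) : TInterp Why where
  Dom := I.Dom
  ind := Sum.elim I.ind ι
  con
    | .top, _, k => k = 1
    | .bot, _, _ => False
    | .goal, d, k => goal d k
    | .tok, d, k => tok d k
    | .atom A, d, k => (d, k) ∈ I.con A
  rol P d e k := (d, e, k) ∈ I.role P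
  val := Sum.elim whyVar ν

section extend

variable {I : AnnInterp Why} {ι : Path → I.Dom} {ν : Path → Why} {goal tok : I.Dom → Why → Prop}

theorem extend_con {C : Concept} (hC : C.IsSimple) {d : I.Dom} {k : Why} :
    (I.extend ι ν goal tok).con C.toBC d k ↔ (d, k) ∈ I.concept C := by
  cases C with
  | top => exact Iff.rfl
  | atom A => exact Iff.rfl
  | ex => exact hC.elim
  | inter => exact hC.elim

theorem extend_con_of_head {D : RConcept} {B : BC} (hB : B ∈ D.heads) {d : I.Dom} {k : Why}
    (h : (d, k) ∈ I.rconcept D) : (I.extend ι ν goal tok).con B d k := by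
  cases D with
  | atom A => obtain rfl := List.mem_singleton.1 hB; exact h
  | ex => cases hB
  | bot => exact h.elim

theorem annot_eq_ev {val : Var → Why} {l : Option PVar} (h : ∀ x, l = some x → val (.inl x) = whyVar x) :
    annot l = ev val (labOf l).toFinset := by
  rw [ev_toFinset Why.mul_self]
  cases l with
  | none => rfl
  | some x => simp [labOf, annot, h x rfl]

/-- The rules of the ontology hold however the fresh symbols are interpreted; only the rules of the
query remain as hypotheses. -/
theorem extend_models {O : AnnOntology} {X : DB} (hI : ∀ β ∈ O, I.Sat (annot β.2) β.1)
    (hO : ∀ β ∈ axiomsOf O, β.IsNormal)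
    (hca : ∀ A a v, (A, a, v) ∈ X.ca → (I.extend ι ν goal tok).con A
      ((I.extend ι ν goal tok).ind a) (ev (I.extend ι ν goal tok).val v.toFinset))
    (hra : ∀ P a b v, (P, a, b, v) ∈ X.ra → (I.extend ι ν goal tok).rol P
      ((I.extend ι ν goal tok).ind a) ((I.extend ι ν goal tok).ind b)
      (ev (I.extend ι ν goal tok).val v.toFinset))
    (him : ∀ A A' B v d k k', (A, A', B, v) ∈ X.im → (I.extend ι ν goal tok).con A d k →
      (I.extend ι ν goal tok).con A' d k' →
      (I.extend ι ν goal tok).con B d (ev (I.extend ι ν goal tok).val v.toFinset * (k * k')))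
    (hex : ∀ P A B v d e k k', (P, A, B, v) ∈ X.ex → (I.extend ι ν goal tok).rol P d e k →
      (I.extend ι ν goal tok).con A e k' →
      (I.extend ι ν goal tok).con B d (ev (I.extend ι ν goal tok).val v.toFinset * (k * k'))) :
    (I.extend ι ν goal tok).Models (mkDB O X) where
  top _ := rfl
  inv P d e k h := (I.role_inverse _ _ _ _).2 h
  ca A a v h := by
    rcases List.mem_append.1 h with h | h
    · obtain ⟨⟨β, l⟩, hβ, h⟩ := List.mem_flatMap.1 h
      have hs := hI _ hβ
      cases β <;> simp only [caRules, List.not_mem_nil, List.mem_singleton] at h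
      cases h
      rwa [annot_eq_ev (val := (I.extend ι ν goal tok).val) fun _ _ => rfl] at hs
    · exact hca _ _ _ h
  ra P a b v h := by
    rcases List.mem_append.1 h with h | h
    · obtain ⟨⟨β, l⟩, hβ, h⟩ := List.mem_flatMap.1 h
      have hs := hI _ hβ
      cases β <;> simp only [raRules, bothWays, List.not_mem_nil, List.mem_cons, or_false] at h
      rw [annot_eq_ev (val := (I.extend ι ν goal tok).val) fun _ _ => rfl] at hs
      rcases h with h | h <;> cases h <;> exact hs
    · exact hra _ _ _ _ h
  im A A' B v d k k' h h1 h2 := by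
    rcases List.mem_append.1 h with h | h
    · obtain ⟨⟨β, l⟩, hβ, h⟩ := List.mem_flatMap.1 h
      have hs := hI _ hβ
      have hn := hO _ ⟨l, hβ⟩
      rw [annot_eq_ev (val := (I.extend ι ν goal tok).val) fun _ _ => rfl] at hs
      rcases β with ⟨C, D⟩ | _ | _ | _ | _
      · cases C with
        | top =>
          obtain ⟨B, hB, h⟩ := List.mem_map.1 h
          cases h; cases h1; cases h2
          rw [mul_one]
          exact extend_con_of_head hB (hs _ _ rfl)
        | atom C =>
          obtain ⟨B, hB, h⟩ := List.mem_map.1 h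
          cases h; cases h2
          rw [mul_one]
          exact extend_con_of_head hB (hs _ _ h1)
        | inter C C' =>
          obtain ⟨B, hB, h⟩ := List.mem_map.1 h
          cases h
          exact extend_con_of_head hB (hs _ _ ⟨k, k', (extend_con hn.1).1 h1, (extend_con hn.2.1).1 h2, rfl⟩)
        | ex => cases h
      all_goals cases h
    · exact him _ _ _ _ _ _ _ h h1 h2
  ex P A B v d e k k' h h1 h2 := by
    rcases List.mem_append.1 h with h | h
    · rcases List.mem_append.1 h with h | h
      · obtain ⟨⟨β, l⟩, hβ, h⟩ := List.mem_flatMap.1 h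
        have hs := hI _ hβ
        have hn := hO _ ⟨l, hβ⟩
        rw [annot_eq_ev (val := (I.extend ι ν goal tok).val) fun _ _ => rfl] at hs
        rcases β with ⟨_ | _ | ⟨P, C⟩ | _, D⟩ | _ | _ | _ | _
        case gci.ex =>
          obtain ⟨B, hB, h⟩ := List.mem_map.1 h
          cases h
          exact extend_con_of_head hB (hs _ _ ⟨e, k, k', h1, (extend_con hn.1).1 h2, rfl⟩)
        all_goals cases h
      -- The added rules that propagate `⊥` hold because `⊥` is empty.
      · obtain ⟨r, hr, h⟩ := List.mem_map.1 h
        cases h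
        exact h2.elim
    · exact hex _ _ _ _ _ _ _ _ h h1 h2
  gen A P v d k h h1 := by
    obtain ⟨β, hβ, h⟩ := List.mem_flatMap.1 h
    obtain ⟨C, hC, hβC, rfl, rfl⟩ := genRules_eq h
    have hs := hI _ hβ
    rw [annot_eq_ev (val := (I.extend ι ν goal tok).val) fun _ _ => rfl, hβC] at hs
    obtain ⟨e, k', l', h2, h3, h4⟩ := hs _ _ ((extend_con hC).1 h1)
    obtain rfl : l' = 1 := h3
    rw [mul_one] at h4
    subst h4
    exact ⟨e, h2⟩
  ri P Q v d e k h h1 := by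
    obtain ⟨⟨β, l⟩, hβ, h⟩ := List.mem_flatMap.1 h
    have hs := hI _ hβ
    rw [annot_eq_ev (val := (I.extend ι ν goal tok).val) fun _ _ => rfl] at hs
    cases β <;> simp only [riRules, List.not_mem_nil, List.mem_cons, or_false] at h
    rcases h with h | h <;> cases h
    · exact hs _ _ _ h1
    · exact (I.role_inverse _ _ _ _).2 (hs _ _ _ ((I.role_inverse _ _ _ _).1 h1))
  nri P Q d e k k' h h1 h2 := by
    obtain ⟨⟨β, l⟩, hβ, h⟩ := List.mem_flatMap.1 h
    have hs := hI _ hβ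
    cases β <;> simp only [nriRules, List.not_mem_nil, List.mem_cons, or_false] at h
    rcases h with h | h <;> cases h
    · exact hs _ _ _ _ h1 h2
    · exact hs _ _ _ _ ((I.role_inverse _ _ _ _).1 h1) ((I.role_inverse _ _ _ _).1 h2)

end extend

/-! ## Concepts and their nodes -/

namespace Concept

/-- The product of the annotations at the nodes of a concept. -/
noncomputable def value (ν : Path → Why) : Concept → Path → Why
  | .top, _ => 1
  | .atom _, p => ν p
  | .ex _ C, p => ν p * C.value ν (false :: p)
  | .inter C D, p => C.value ν (false :: p) * D.value ν (true :: p)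

/-- The assignment shows that the element belongs to the concept. -/
def Witness (I : AnnInterp Why) (σ : Path → I.Dom × Why) : Concept → Path → I.Dom → Prop
  | .top, _, _ => True
  | .atom A, p, d => (d, (σ p).2) ∈ I.con A
  | .ex P C, p, d => (d, (σ p).1, (σ p).2) ∈ I.role P ∧ C.Witness I σ (false :: p) (σ p).1
  | .inter C D, p, d => C.Witness I σ (false :: p) d ∧ D.Witness I σ (true :: p) d

theorem value_nodes (val : Var → Why) (C : Concept) (p : Path) (i : Ind) :
    (((C.nodes p i).flatMap nodeVars).map val).prod = C.value (fun q => val (.inr q)) p := by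
  induction C generalizing p i with
  | top => simp [nodes, nodeVars, value]
  | atom A => simp [nodes, nodeVars, value]
  | ex P C ih => simp [nodes, nodeVars, value, ← ih (false :: p) (.inr p)]
  | inter C D ihC ihD =>
    simp [nodes, nodeVars, value, ← ihC (false :: p) i, ← ihD (true :: p) i]

theorem value_congr {ν ν' : Path → Why} {C : Concept} {p : Path} (h : ∀ q, p <:+ q → ν q = ν' q) :
    C.value ν p = C.value ν' p := by
  induction C generalizing p with
  | top => rfl
  | atom A => exact h p List.suffix_rfl
  | ex P C ih =>
    rw [value, value, h p List.suffix_rfl, ih fun q hq => h q ((List.suffix_cons _ _).trans hq)]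
  | inter C D ihC ihD =>
    rw [value, value, ihC fun q hq => h q ((List.suffix_cons _ _).trans hq),
      ihD fun q hq => h q ((List.suffix_cons _ _).trans hq)]

variable {I : AnnInterp Why}

theorem Witness.congr {σ σ' : Path → I.Dom × Why} {C : Concept} {p : Path} {d : I.Dom}
    (h : ∀ q, p <:+ q → σ q = σ' q) (hw : C.Witness I σ p d) : C.Witness I σ' p d := by
  induction C generalizing p d with
  | top => trivial
  | atom A => rw [Witness, ← h p List.suffix_rfl]; exact hw
  | ex P C ih =>
    rw [Witness, ← h p List.suffix_rfl]
    exact ⟨hw.1, ih (fun q hq => h q ((List.suffix_cons _ _).trans hq)) hw.2⟩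
  | inter C D ihC ihD =>
    exact ⟨ihC (fun q hq => h q ((List.suffix_cons _ _).trans hq)) hw.1,
      ihD (fun q hq => h q ((List.suffix_cons _ _).trans hq)) hw.2⟩

theorem exists_witness {C : Concept} (p : Path) {d : I.Dom} {l : Why} (h : (d, l) ∈ I.concept C) :
    ∃ σ, C.Witness I σ p d ∧ l = C.value (fun q => (σ q).2) p := by
  classical
  have hne : ∀ (b : Bool) (q : Path), ¬ b :: q <:+ q := fun b q h => by
    have := h.length_le
    rw [List.length_cons] at this
    omega
  induction C generalizing p d l with
  | top => exact ⟨fun _ => (d, 1), trivial, h⟩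
  | atom A => exact ⟨fun _ => (d, l), h, rfl⟩
  | ex P C ih =>
    obtain ⟨e, k, l', h1, h2, h3⟩ := h
    obtain rfl : l = k * l' := h3
    obtain ⟨σ, hσ, rfl⟩ := ih (false :: p) h2
    have hcongr : ∀ q, (false :: p) <:+ q → σ q = if q = p then (e, k) else σ q := fun q hq => by
      rw [if_neg]
      rintro rfl
      exact hne _ _ hq
    refine ⟨fun q => if q = p then (e, k) else σ q, ⟨by simpa using h1, ?_⟩, ?_⟩
    · simpa using hσ.congr hcongr
    · rw [value]
      dsimp only
      rw [if_pos rfl, value_congr fun q hq => congrArg Prod.snd (hcongr q hq)]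
  | inter C D ihC ihD =>
    obtain ⟨k, k', h1, h2, h3⟩ := h
    obtain rfl : l = k * k' := h3
    obtain ⟨σ, hσ, rfl⟩ := ihC (false :: p) h1
    obtain ⟨τ, hτ, rfl⟩ := ihD (true :: p) h2
    have hσ' : ∀ q, (false :: p) <:+ q → σ q = if (false :: p) <:+ q then σ q else τ q :=
      fun q hq => (if_pos hq).symm
    -- The two assignments can be glued: no position lies below both `false :: p` and `true :: p`,
    -- since two suffixes of equal length coincide.
    have hτ' : ∀ q, (true :: p) <:+ q → τ q = if (false :: p) <:+ q then σ q else τ q :=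
      fun q hq => by
        rw [if_neg]
        intro hq'
        have := List.suffix_of_suffix_length_le hq hq' (by simp)
        have := this.eq_of_length (by simp)
        simp at this
    refine ⟨fun q => if (false :: p) <:+ q then σ q else τ q, ⟨hσ.congr hσ', hτ.congr hτ'⟩, ?_⟩
    rw [value, value_congr fun q hq => congrArg Prod.snd (hσ' q hq),
      value_congr fun q hq => congrArg Prod.snd (hτ' q hq)]

theorem Witness.ca {σ : Path → I.Dom × Why} {C : Concept} {p : Path} {i : Ind}
    (hσ : C.Witness I σ p (Sum.elim I.ind (fun q => (σ q).1) i)) {A : BC} {a : Ind} {v : Lab}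
    (h : (A, a, v) ∈ (C.nodes p i).flatMap nodeCa) : ∃ A', A = .atom A' ∧
      (Sum.elim I.ind (fun q => (σ q).1) a, ev (Sum.elim whyVar fun q => (σ q).2) v.toFinset) ∈
        I.con A' := by
  induction C generalizing p i with
  | top => simp [nodes, DLProv.nodeCa] at h
  | atom A =>
    simp only [nodes, nodeCa, List.flatMap_cons, List.flatMap_nil, List.append_nil,
      List.mem_singleton] at h
    cases h
    have h1 : (Sum.elim I.ind (fun q => (σ q).1) a, (σ p).2) ∈ I.con A := hσ
    exact ⟨A, rfl, by simpa [ev] using h1⟩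
  | ex P C ih => exact ih hσ.2 (by simpa [nodes, nodeCa] using h)
  | inter C D ihC ihD =>
    simp only [nodes, nodeCa, List.flatMap_cons, List.flatMap_append, List.nil_append,
      List.mem_append] at h
    exact h.elim (ihC hσ.1) (ihD hσ.2)

theorem Witness.ra {σ : Path → I.Dom × Why} {C : Concept} {p : Path} {i : Ind}
    (hσ : C.Witness I σ p (Sum.elim I.ind (fun q => (σ q).1) i)) {P : Role} {a b : Ind} {v : Lab}
    (h : (P, a, b, v) ∈ (C.nodes p i).flatMap nodeRa) :
    (Sum.elim I.ind (fun q => (σ q).1) a, Sum.elim I.ind (fun q => (σ q).1) b,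
      ev (Sum.elim whyVar fun q => (σ q).2) v.toFinset) ∈ I.role P := by
  induction C generalizing p i with
  | top => simp [nodes, nodeRa] at h
  | atom A => simp [nodes, nodeRa] at h
  | ex Q C ih =>
    simp only [nodes, nodeRa, bothWays, List.flatMap_cons, List.cons_append, List.nil_append,
      List.mem_cons] at h
    rcases h with h | h | h
    · cases h; simpa [ev] using hσ.1
    · cases h
      exact (I.role_inverse _ _ _ _).2 (by simpa [ev] using hσ.1)
    · exact ih hσ.2 h
  | inter C D ihC ihD =>
    simp only [nodes, nodeRa, List.flatMap_cons, List.flatMap_append, List.nil_append,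
      List.mem_append] at h
    exact h.elim (ihC hσ.1) (ihD hσ.2)

/-- The frozen `C` realises itself: the named part of the canonical model contains its tree, so the
root lies in `C` with the product of all fresh variables. -/
theorem mem_canon_concept {db : DB} {val : Var → Why} (hdb : db.Closed) {C : Concept} {p : Path}
    {i : Ind} (hca : ∀ r ∈ (C.nodes p i).flatMap nodeCa, r ∈ db.ca)
    (hra : ∀ r ∈ (C.nodes p i).flatMap nodeRa, r ∈ db.ra) (hi : i ∈ db.inds) :
    ((⟨(i, []), .ind hi⟩, C.value (fun q => val (.inr q)) p) : (canon db val).Dom × Why) ∈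
      (canon db val).concept C := by
  induction C generalizing p i with
  | top => exact rfl
  | atom A =>
    have h := hca (.atom A, i, [.inr p]) (by simp [nodes, nodeCa])
    exact ⟨_, .of_con (.ca h), by simp [ev, value]⟩
  | ex P C ih =>
    have h := hra (P, i, .inr p, [.inr p]) (by simp [nodes, nodeRa, bothWays])
    have hp : Sum.inr p ∈ db.inds :=
      List.mem_cons_of_mem _ (List.mem_append_right _ (List.mem_map.2 ⟨_, h, rfl⟩))
    refine ⟨⟨(.inr p, []), .ind hp⟩, val (.inr p), _, ?_, ih (p := false :: p) ?_ ?_ hp, rfl⟩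
    · exact (mem_canon_role hdb _ _ _ _).2 ⟨_, .named h .refl, by simp [ev]⟩
    · exact fun r hr => hca r (by simpa [nodes, nodeCa] using hr)
    · exact fun r hr => hra r (by
        rw [nodes, List.flatMap_cons]; exact List.mem_append_right _ hr)
  | inter C D ihC ihD =>
    refine ⟨_, _, ihC (p := false :: p) ?_ ?_ hi, ihD (p := true :: p) ?_ ?_ hi, rfl⟩
    · exact fun r hr => hca r (by
        rw [nodes, List.flatMap_cons, List.flatMap_append]
        exact List.mem_append_right _ (List.mem_append_left _ hr))
    · exact fun r hr => hra r (by
        rw [nodes, List.flatMap_cons, List.flatMap_append]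
        exact List.mem_append_right _ (List.mem_append_left _ hr))
    · exact fun r hr => hca r (by
        rw [nodes, List.flatMap_cons, List.flatMap_append]
        exact List.mem_append_right _ (List.mem_append_right _ hr))
    · exact fun r hr => hra r (by
        rw [nodes, List.flatMap_cons, List.flatMap_append]
        exact List.mem_append_right _ (List.mem_append_right _ hr))

end Concept

/-! ## Entailment and derivability -/

/-- The database of the query `O ⊨ (α, m)`. -/
def queryDB (O : AnnOntology) (α : Ax) : DB := mkDB O (queryRules α α.nodes)

/-- The variables of the query, for a list of the variables of the monomial. -/
def queryVars (α : Ax) (ms : List ℕ) : List Var := ms.map Sum.inl ++ freshVars α α.nodes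

/-- The database has no model. -/
def DB.Inconsistent (db : DB) : Prop := ∃ a ∈ db.inds, ∃ N, Con db (.inl a) .bot N

theorem ev_queryVars {val : Var → Why} {α : Ax} {ms : List ℕ} (h : ∀ x ∈ ms, val (.inl x) = whyVar x) :
    ev val (queryVars α ms).toFinset =
      monomial ms.toFinset * ((freshVars α α.nodes).map val).prod := by
  have h1 : monomial ms.toFinset = (ms.map whyVar).prod := by
    clear h
    induction ms with
    | nil => rfl
    | cons x ms ih =>
      rw [List.map_cons, List.prod_cons, ← ih, List.toFinset_cons, monomial, monomial]
      by_cases hx : x ∈ ms.toFinset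
      · rw [Finset.insert_eq_of_mem hx, ← Finset.mul_prod_erase _ _ hx, ← mul_assoc, Why.mul_self]
      · exact Finset.prod_insert hx
  rw [ev_toFinset Why.mul_self, queryVars, List.map_append, List.prod_append, h1, List.map_map]
  congr 2
  exact List.map_congr_left fun x hx => h x hx

/-- `⊥` is empty in an extended interpretation, so the first alternative cannot occur; in the
second, the label is exact because the root is an individual. -/
theorem TInterp.Models.query {I : AnnInterp Why} {ι : Path → I.Dom} {ν : Path → Why}
    {goal tok : I.Dom → Why → Prop} {db : DB} {V : List Var}
    (hT : (I.extend ι ν goal tok).Models db)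
    (h : db.Inconsistent ∨ Con db (.inl db.root) .goal V.toFinset) :
    goal (Sum.elim I.ind ι db.root) (ev (Sum.elim whyVar ν) V.toFinset) := by
  rcases h with ⟨a, -, N, h⟩ | h
  · obtain ⟨c, -, hc⟩ := hT.con Why.mul_self h ⟨rfl, rfl⟩
    exact hc.elim
  · obtain ⟨c, hc, h⟩ := hT.con Why.mul_self h ⟨rfl, rfl⟩
    obtain rfl : c = 1 := hc.elim id id
    rwa [mul_one] at h

theorem ev_nil_mul (val : Var → Why) (k : Why) : ev val ([] : Lab).toFinset * (k * 1) = k := by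
  simp [ev]

/-- In a given model, the fresh symbols are interpreted by the elements and annotations that witness
the left-hand side, and `goal` by the conclusion to be proved. Soundness of derivations then yields
the conclusion. -/
theorem entails_of_query {O : AnnOntology} {α : Ax} {ms : List ℕ} (hO : IsRestr (axiomsOf O))
    (h : (queryDB O α).Inconsistent ∨
      Con (queryDB O α) (.inl (queryDB O α).root) .goal (queryVars α ms).toFinset) :
    Entails O α (monomial ms.toFinset) := by
  intro I hI
  have hmodels := fun ι ν goal tok =>
    extend_models (I := I) (ι := ι) (ν := ν) (goal := goal) (tok := tok) (X := queryRules α α.nodes)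
      hI hO.1
  cases α with
  | gci C D =>
    intro d l hd
    obtain ⟨σ, hσ, rfl⟩ := Concept.exists_witness [true] hd
    -- The root individual denotes `d`. The annotation `1` is a dummy, since the variable `.inr []`
    -- does not occur for a concept inclusion.
    let τ : Path → I.Dom × Why := fun q => if q = [] then (d, 1) else σ q
    have hτ : ∀ q, [true] <:+ q → σ q = τ q := fun q hq => by
      have : q ≠ [] := by rintro rfl; simp at hq
      simp only [τ, if_neg this]
    have hw : C.Witness I τ [true] (Sum.elim I.ind (fun q => (τ q).1) (.inr [])) := by
      simpa [τ] using hσ.congr hτ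
    have hT := hmodels (fun q => (τ q).1) (fun q => (τ q).2) (fun d k => (d, k) ∈ I.rconcept D)
      (fun _ _ => False) ?_ ?_ ?_ ?_
    · have := hT.query h
      rw [ev_queryVars fun _ _ => rfl] at this
      simp only [freshVars, Ax.nodes, Concept.value_nodes, Sum.elim_inr] at this
      rw [Concept.value_congr fun q hq => congrArg Prod.snd (hτ q hq)]
      simpa [queryDB, mkDB, queryRules, τ] using this
    · intro A a v h
      obtain ⟨A', rfl, h1⟩ := hw.ca h
      exact h1
    · intro P a b v h
      exact hw.ra h
    · intro A A' B v d k k' h h1 h2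
      cases D with
      | atom B =>
        obtain h := List.mem_singleton.1 h
        cases h; cases h2
        rw [ev_nil_mul]
        exact h1
      | ex => cases h
      | bot => cases h
    · intro P A B v d e k k' h h1 h2
      cases D with
      | ex P =>
        obtain h := List.mem_singleton.1 h
        cases h; cases h2
        exact ⟨e, k, 1, h1, rfl, by simp [ev]⟩
      | atom => cases h
      | bot => cases h
  | ri P Q =>
    intro d e l hd
    have hT := hmodels (fun q => if q = [] then d else e) (fun q => l)
      (fun d k => (d, e, k) ∈ I.role Q) (fun d k => d = e ∧ k = 1) ?_ ?_ ?_ ?_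
    · have := hT.query h
      rw [ev_queryVars fun _ _ => rfl] at this
      simpa [queryDB, mkDB, queryRules, freshVars] using this
    · intro A a v h
      obtain h := List.mem_singleton.1 h
      cases h
      exact ⟨rfl, rfl⟩
    · intro P' a b v h
      simp only [queryRules, bothWays, List.mem_cons, List.not_mem_nil, or_false] at h
      rcases h with h | h <;> cases h
      · simpa [ev, AnnInterp.extend] using hd
      · exact (I.role_inverse _ _ _ _).2 (by simpa [ev, AnnInterp.extend] using hd)
    · intro A A' B v d k k' h
      cases h
    · intro P' A B v d e' k k' h h1 h2
      obtain h := List.mem_singleton.1 h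
      cases h
      have h3 : e' = _ := h2.1
      have h4 : k' = 1 := h2.2
      rw [h3] at h1
      rw [h4, ev_nil_mul]
      exact h1
  | nri P Q =>
    -- With an empty `goal`, the derivation itself gives the contradiction.
    intro d e l l' hd hd'
    refine (hmodels (fun q => if q = [] then d else e) (fun q => if q = [] then l else l')
      (fun _ _ => False) (fun _ _ => False) ?_ ?_ ?_ ?_).query h
    · intro A a v h
      cases h
    · intro P' a b v h
      simp only [queryRules, bothWays, List.mem_append, List.mem_cons, List.not_mem_nil,
        or_false] at h
      rcases h with (h | h) | (h | h) <;> cases h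
      · simpa [ev, AnnInterp.extend] using hd
      · exact (I.role_inverse _ _ _ _).2 (by simpa [ev, AnnInterp.extend] using hd)
      · simpa [ev, AnnInterp.extend] using hd'
      · exact (I.role_inverse _ _ _ _).2 (by simpa [ev, AnnInterp.extend] using hd')
    · intro A A' B v d k k' h
      cases h
    · intro P A B v d e k k' h
      cases h
  | ca A a =>
    -- Fresh symbols do not occur in an assertion query, so their values are dummies.
    have hT := hmodels (fun q => I.ind 0) (fun q => 1)
      (fun d k => (d, k) ∈ I.con A) (fun d k => False) ?_ ?_ ?_ ?_
    · have := hT.query h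
      rw [ev_queryVars fun _ _ => rfl] at this
      simp only [mkDB, queryRules, freshVars, List.map_nil, List.prod_nil, mul_one] at this
      exact this
    · intro A a v h
      cases h
    · intro P' a b v h
      cases h
    · intro A A' B v d k k' h h1 h2
      obtain h := List.mem_singleton.1 h
      cases h; cases h2
      rw [ev_nil_mul]
      exact h1
    · intro P' A B v d e' k k' h h1 h2
      cases h
  | ra R a b =>
    have hT := hmodels (fun q => I.ind 0) (fun q => 1)
      (fun d k => (d, I.ind b, k) ∈ I.rol R) (fun d k => d = I.ind b ∧ k = 1) ?_ ?_ ?_ ?_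
    · have := hT.query h
      rw [ev_queryVars fun _ _ => rfl] at this
      simp only [mkDB, queryRules, freshVars, List.map_nil, List.prod_nil, mul_one] at this
      exact this
    · intro A a v h
      obtain h := List.mem_singleton.1 h
      cases h
      exact ⟨rfl, rfl⟩
    · intro P' a b v h
      cases h
    · intro A A' B v d k k' h
      cases h
    · intro P' A B v d e' k k' h h1 h2
      obtain h := List.mem_singleton.1 h
      cases h
      have h3 : e' = _ := h2.1
      have h4 : k' = 1 := h2.2
      rw [h3] at h1
      rw [h4, ev_nil_mul]
      exact h1

theorem queryRules_inv {α : Ax} {ns : List (Concept × Path × Ind)} (P : Role) (a b : Ind) (v : Lab)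
    (h : (P, a, b, v) ∈ (queryRules α ns).ra) : (P.inverse, b, a, v) ∈ (queryRules α ns).ra := by
  have hboth : ∀ {Q : Role} {i j : Ind} {u : Lab}, (P, a, b, v) ∈ bothWays Q i j u →
      (P.inverse, b, a, v) ∈ bothWays Q i j u := by
    intro Q i j u h
    simp only [bothWays, List.mem_cons, List.not_mem_nil, or_false] at h ⊢
    rcases h with h | h <;> cases h
    · exact .inr rfl
    · exact .inl (by rw [Role.inverse_inverse])
  cases α with
  | gci C D =>
    obtain ⟨⟨E, p, i⟩, hE, h⟩ := List.mem_flatMap.1 h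
    refine List.mem_flatMap.2 ⟨_, hE, ?_⟩
    cases E <;> first | exact hboth h | cases h
  | ri P Q => exact hboth h
  | nri P Q =>
    rcases List.mem_append.1 h with h | h
    · exact List.mem_append_left _ (hboth h)
    · exact List.mem_append_right _ (hboth h)
  | ca => cases h
  | ra => cases h

/-! ### From facts of the canonical model back to derivations of the goal. -/

section goal

variable {db : DB}

theorem Word.Holds.con {a : Ind} {B : BC} {N : Finset Var} (h : Word.Holds db (a, []) B N) :
    Con db (.inl a) B N := by
  obtain ⟨n, hn, h⟩ := h
  have h : N = n := by simpa [Word.edge] using h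
  rwa [h]

theorem Con.goal_of_im {X : Ctx} {B : BC} {N : Finset Var} (hr : (B, .top, .goal, []) ∈ db.im)
    (h : Con db X B N) : Con db X .goal N := by
  simpa using Con.im hr h (.top X)

theorem Word.Rel.goal_of_ex {a : Ind} {e : Word} {P : Role} {N : Finset Var}
    (h : Word.Rel db P (a, []) e N) (he : e.Valid db) (hr : (P, .top, .goal, []) ∈ db.ex) :
    Con db (.inl a) .goal N := by
  generalize hd : ((a, []) : Word) = d at h
  cases h with
  | named hra hs =>
    cases hd
    simpa using Con.named hra hs hr (.top _)
  | down _ hs =>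
    subst hd
    obtain ⟨A', v, M, hg, h, rfl, -⟩ := he.gen_of_cons
    simpa using Con.succ hg h.con hs hr (.top _)
  | up => cases hd

theorem Word.Rel.goal_of_tok {a b : Ind} {P : Role} {N : Finset Var}
    (h : Word.Rel db P (a, []) (b, []) N) (hb : (.tok, b, []) ∈ db.ca)
    (hr : (P, .tok, .goal, []) ∈ db.ex) : Con db (.inl a) .goal N := by
  generalize hd : ((a, []) : Word) = d, he : ((b, []) : Word) = e at h
  cases h with
  | named hra hs =>
    cases hd; cases he
    simpa using Con.named hra hs hr (.ca hb)
  | down => cases he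
  | up => cases hd

theorem canon_ind {val : Var → Why} {a : ℕ} (h : Sum.inl a ∈ db.inds) :
    (canon db val).ind a = ⟨(.inl a, []), .ind h⟩ := dif_pos h

end goal

/-- The canonical model satisfies the ontology, hence the query. The resulting fact carries some
derived label with the value of `m` times the fresh variables, and injectivity identifies the label.
-/
theorem query_of_entails {O : AnnOntology} {α : Ax} {ms : List ℕ} (hO : IsRestr (axiomsOf O))
    (h : Entails O α (monomial ms.toFinset)) : (queryDB O α).Inconsistent ∨
      Con (queryDB O α) (.inl (queryDB O α).root) .goal (queryVars α ms).toFinset := by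
  by_cases hinc : (queryDB O α).Inconsistent
  · exact .inl hinc
  refine .inr ?_
  have hcons : ∀ a ∈ (queryDB O α).inds, ∀ N, ¬ Con (queryDB O α) (.inl a) .bot N :=
    fun a ha N hN => hinc ⟨a, ha, N, hN⟩
  have hdb : (queryDB O α).Closed := mkDB_closed O queryRules_inv
  -- Fresh variables must become genuine ones, distinct from each other and from all variables of
  -- the ontology and of the monomial.
  obtain ⟨f, hf, hfx⟩ := exists_renaming
    (ms.toFinset ∪ (O.flatMap fun β => β.2.toList).toFinset)
  have hms : ∀ x ∈ ms, whyVar (f (.inl x)) = whyVar x := fun x hx => by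
    rw [hfx x (Finset.mem_union_left _ (List.mem_toFinset.2 hx))]
  let val : Var → Why := fun x => whyVar (f x)
  have hJ := h _ (canon_sat (val := val) hO hdb hcons fun β hβ => annot_eq_ev fun x hx => by
    have : x ∈ O.flatMap fun β => β.2.toList := List.mem_flatMap.2 ⟨β, hβ, by rw [hx]; simp⟩
    simp only [val, hfx x (Finset.mem_union_right _ (List.mem_toFinset.2 this))])
  have hev := ev_queryVars (val := val) (α := α) hms
  have hinj : ∀ {N}, ev val (queryVars α ms).toFinset = ev val N → N = (queryVars α ms).toFinset := by
    intro N hN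
    rw [ev_eq_monomial f hf, ev_eq_monomial f hf] at hN
    exact (Finset.map_injective _ (monomial_injective hN)).symm
  have hroot : (queryDB O α).root ∈ (queryDB O α).inds := List.mem_cons_self
  cases α with
  | gci C D =>
    have h1 := hJ _ _ (Concept.mem_canon_concept (val := val) (C := C) (p := [true]) (i := .inr [])
      hdb (fun r hr => List.mem_append_right _ hr) (fun r hr => List.mem_append_right _ hr) hroot)
    rw [← Concept.value_nodes val C [true] (.inr [])] at h1
    simp only [freshVars, Ax.nodes] at hev
    rw [← hev] at h1
    cases D with
    | atom B =>
      obtain ⟨N, hN, h2⟩ := h1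
      obtain rfl := hinj h2
      exact hN.con.goal_of_im (List.mem_append_right _ (List.mem_singleton_self _))
    | ex P =>
      obtain ⟨e, k, l, h2, h3, h4⟩ := h1
      obtain rfl : l = 1 := h3
      obtain ⟨N, h5, h6⟩ := (mem_canon_role hdb _ _ _ _).1 h2
      rw [mul_one] at h4
      obtain rfl := hinj (h4.trans h6)
      exact h5.goal_of_ex e.2 (List.mem_append_right _ (List.mem_singleton_self _))
    | bot => exact h1.elim
  | ri P Q =>
    have hra : (P, Sum.inr [], Sum.inr [false], [Sum.inr []]) ∈ (queryDB O (.ri P Q)).ra :=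
      List.mem_append_right _ List.mem_cons_self
    have hb : Sum.inr [false] ∈ (queryDB O (.ri P Q)).inds :=
      List.mem_cons_of_mem _ (List.mem_append_right _ (List.mem_map.2 ⟨_, hra, rfl⟩))
    have h1 := hJ ⟨(.inr [], []), .ind hroot⟩ ⟨(.inr [false], []), .ind hb⟩ _
      ((mem_canon_role hdb _ _ _ _).2 ⟨_, .named hra .refl, rfl⟩)
    obtain ⟨N, h2, h3⟩ := (mem_canon_role hdb _ _ _ _).1 h1
    simp only [freshVars, List.map_cons, List.map_nil, List.prod_cons, List.prod_nil, mul_one] at hev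
    rw [show ev val (List.toFinset [Sum.inr []] ∪ ∅) = val (.inr []) by simp [ev], ← hev] at h3
    obtain rfl := hinj h3
    exact h2.goal_of_tok (List.mem_append_right _ (List.mem_singleton_self _))
      (List.mem_append_right _ (List.mem_singleton_self _))
  | nri P Q =>
    have hra : (P, Sum.inr [], Sum.inr [false], [Sum.inr []]) ∈ (queryDB O (.nri P Q)).ra :=
      List.mem_append_right _ List.mem_cons_self
    have hra' : (Q, Sum.inr [], Sum.inr [false], [Sum.inr [false]]) ∈ (queryDB O (.nri P Q)).ra :=
      List.mem_append_right _ (List.mem_append_right _ List.mem_cons_self)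
    have hb : Sum.inr [false] ∈ (queryDB O (.nri P Q)).inds :=
      List.mem_cons_of_mem _ (List.mem_append_right _ (List.mem_map.2 ⟨_, hra, rfl⟩))
    -- The frozen pair lies in both roles, so a consistent canonical model refutes the axiom.
    exact (hJ ⟨(.inr [], []), .ind hroot⟩ ⟨(.inr [false], []), .ind hb⟩ _ _
      ((mem_canon_role hdb _ _ _ _).2 ⟨_, .named hra .refl, rfl⟩)
      ((mem_canon_role hdb _ _ _ _).2 ⟨_, .named hra' .refl, rfl⟩)).elim
  | ca A a =>
    obtain ⟨N, hN, h2⟩ := hJ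
    simp only [freshVars, List.map_nil, List.prod_nil, mul_one] at hev
    obtain rfl := hinj (hev.trans h2)
    have e := congrArg Subtype.val (canon_ind (val := val) hroot)
    have hN' : Word.Holds (queryDB O (.ca A a)) (.inl a, []) (.atom A) _ := e ▸ hN
    exact hN'.con.goal_of_im (List.mem_append_right _ (List.mem_singleton_self _))
  | ra R a b =>
    have hb : (.tok, Sum.inl b, []) ∈ (queryDB O (.ra R a b)).ca :=
      List.mem_append_right _ (List.mem_singleton_self _)
    have hb' : Sum.inl b ∈ (queryDB O (.ra R a b)).inds :=
      List.mem_cons_of_mem _ (List.mem_append_left _ (List.mem_append_left _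
        (List.mem_map.2 ⟨_, hb, rfl⟩)))
    obtain ⟨N, hN, h2⟩ := hJ
    simp only [freshVars, List.map_nil, List.prod_nil, mul_one] at hev
    obtain rfl := hinj (hev.trans h2)
    have e := congrArg Subtype.val (canon_ind (val := val) hroot)
    have e' := congrArg Subtype.val (canon_ind (val := val) hb')
    have hN' : Word.Rel (queryDB O (.ra R a b)) (.name R) (.inl a, []) (.inl b, []) _ :=
      e' ▸ e ▸ hN
    exact hN'.goal_of_tok hb (List.mem_append_right _ (List.mem_singleton_self _))

theorem entails_iff {O : AnnOntology} {α : Ax} {ms : List ℕ} (hO : IsRestr (axiomsOf O)) :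
    Entails O α (monomial ms.toFinset) ↔ (queryDB O α).Inconsistent ∨
      Con (queryDB O α) (.inl (queryDB O α).root) .goal (queryVars α ms).toFinset :=
  ⟨query_of_entails hO, entails_of_query hO⟩

end DLProv


namespace DLProv

/-! ## Deciding inconsistency and the query -/

/-- Forget the labels. -/
def DB.erase (db : DB) : DB where
  ca := db.ca.map fun r => (r.1, r.2.1, [])
  ra := db.ra.map fun r => (r.1, r.2.1, r.2.2.1, [])
  im := db.im.map fun r => (r.1, r.2.1, r.2.2.1, [])
  ex := db.ex.map fun r => (r.1, r.2.1, r.2.2.1, [])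
  gen := db.gen.map fun r => (r.1, r.2.1, [])
  ri := db.ri.map fun r => (r.1, r.2.1, [])
  nri := db.nri
  root := db.root

section erase

variable {db : DB} {P Q : Role} {X : Ctx} {A B B' : BC} {a b : Ind} {v : Lab} {N : Finset Var}

theorem DB.mem_erase_ca : (A, a, v) ∈ db.erase.ca ↔ v = [] ∧ ∃ w, (A, a, w) ∈ db.ca := by
  simp only [erase, List.mem_map, Prod.exists, Prod.mk.injEq]
  exact ⟨by rintro ⟨_, _, w, h, rfl, rfl, rfl⟩; exact ⟨rfl, w, h⟩,
    by rintro ⟨rfl, w, h⟩; exact ⟨_, _, w, h, rfl, rfl, rfl⟩⟩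

theorem DB.mem_erase_ra : (P, a, b, v) ∈ db.erase.ra ↔ v = [] ∧ ∃ w, (P, a, b, w) ∈ db.ra := by
  simp only [erase, List.mem_map, Prod.exists, Prod.mk.injEq]
  exact ⟨by rintro ⟨_, _, _, w, h, rfl, rfl, rfl, rfl⟩; exact ⟨rfl, w, h⟩,
    by rintro ⟨rfl, w, h⟩; exact ⟨_, _, _, w, h, rfl, rfl, rfl, rfl⟩⟩

theorem DB.mem_erase_im : (A, B, B', v) ∈ db.erase.im ↔ v = [] ∧ ∃ w, (A, B, B', w) ∈ db.im := by
  simp only [erase, List.mem_map, Prod.exists, Prod.mk.injEq]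
  exact ⟨by rintro ⟨_, _, _, w, h, rfl, rfl, rfl, rfl⟩; exact ⟨rfl, w, h⟩,
    by rintro ⟨rfl, w, h⟩; exact ⟨_, _, _, w, h, rfl, rfl, rfl, rfl⟩⟩

theorem DB.mem_erase_ex : (P, A, B, v) ∈ db.erase.ex ↔ v = [] ∧ ∃ w, (P, A, B, w) ∈ db.ex := by
  simp only [erase, List.mem_map, Prod.exists, Prod.mk.injEq]
  exact ⟨by rintro ⟨_, _, _, w, h, rfl, rfl, rfl, rfl⟩; exact ⟨rfl, w, h⟩,
    by rintro ⟨rfl, w, h⟩; exact ⟨_, _, _, w, h, rfl, rfl, rfl, rfl⟩⟩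

theorem DB.mem_erase_gen : (A, P, v) ∈ db.erase.gen ↔ v = [] ∧ ∃ w, (A, P, w) ∈ db.gen := by
  simp only [erase, List.mem_map, Prod.exists, Prod.mk.injEq]
  exact ⟨by rintro ⟨_, _, w, h, rfl, rfl, rfl⟩; exact ⟨rfl, w, h⟩,
    by rintro ⟨rfl, w, h⟩; exact ⟨_, _, w, h, rfl, rfl, rfl⟩⟩

theorem DB.mem_erase_ri : (P, Q, v) ∈ db.erase.ri ↔ v = [] ∧ ∃ w, (P, Q, w) ∈ db.ri := by
  simp only [erase, List.mem_map, Prod.exists, Prod.mk.injEq]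
  exact ⟨by rintro ⟨_, _, w, h, rfl, rfl, rfl⟩; exact ⟨rfl, w, h⟩,
    by rintro ⟨rfl, w, h⟩; exact ⟨_, _, w, h, rfl, rfl, rfl⟩⟩

theorem Sub.erase (h : Sub db P Q N) : Sub db.erase P Q ∅ := by
  induction h with
  | refl => exact .refl
  | step _ hr ih => exact ih.step (DB.mem_erase_ri.2 ⟨rfl, _, hr⟩)

theorem Sub.of_erase (h : Sub db.erase P Q N) : ∃ N, Sub db P Q N := by
  induction h with
  | refl => exact ⟨_, .refl⟩
  | step _ hr ih =>
    obtain ⟨-, _, hr⟩ := DB.mem_erase_ri.1 hr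
    exact ⟨_, ih.choose_spec.step hr⟩

/-- No rule has a side condition on labels, so erasing them preserves and reflects derivability with
some label. -/
theorem Con.erase (h : Con db X B N) : Con db.erase X B ∅ := by
  induction h with
  | top X => exact .top X
  | ca h => exact .ca (DB.mem_erase_ca.2 ⟨rfl, _, h⟩)
  | im h _ _ h1 h2 => exact .im (DB.mem_erase_im.2 ⟨rfl, _, h⟩) h1 h2
  | named he hs hr _ h =>
    exact .named (DB.mem_erase_ra.2 ⟨rfl, _, he⟩) hs.erase (DB.mem_erase_ex.2 ⟨rfl, _, hr⟩) h
  | succ he _ hs hr _ h1 h2 =>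
    exact .succ (DB.mem_erase_gen.2 ⟨rfl, _, he⟩) h1 hs.erase (DB.mem_erase_ex.2 ⟨rfl, _, hr⟩) h2
  | pred hs hr => exact .pred hs.erase (DB.mem_erase_ex.2 ⟨rfl, _, hr⟩)
  | nriNamed he he' hs hs' hr =>
    exact .nriNamed (DB.mem_erase_ra.2 ⟨rfl, _, he⟩) (DB.mem_erase_ra.2 ⟨rfl, _, he'⟩) hs.erase
      hs'.erase hr
  | nriAnon hs hs' hr => exact .nriAnon hs.erase hs'.erase hr

theorem Con.of_erase (h : Con db.erase X B N) : ∃ N, Con db X B N := by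
  induction h with
  | top X => exact ⟨_, .top X⟩
  | ca h =>
    obtain ⟨-, _, h⟩ := DB.mem_erase_ca.1 h
    exact ⟨_, .ca h⟩
  | im h _ _ h1 h2 =>
    obtain ⟨-, _, h⟩ := DB.mem_erase_im.1 h
    exact ⟨_, .im h h1.choose_spec h2.choose_spec⟩
  | named he hs hr _ h =>
    obtain ⟨-, _, he⟩ := DB.mem_erase_ra.1 he
    obtain ⟨-, _, hr⟩ := DB.mem_erase_ex.1 hr
    exact ⟨_, .named he hs.of_erase.choose_spec hr h.choose_spec⟩
  | succ he _ hs hr _ h1 h2 =>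
    obtain ⟨-, _, he⟩ := DB.mem_erase_gen.1 he
    obtain ⟨-, _, hr⟩ := DB.mem_erase_ex.1 hr
    exact ⟨_, .succ he h1.choose_spec hs.of_erase.choose_spec hr h2.choose_spec⟩
  | pred hs hr =>
    obtain ⟨-, _, hr⟩ := DB.mem_erase_ex.1 hr
    exact ⟨_, .pred hs.of_erase.choose_spec hr⟩
  | nriNamed he he' hs hs' hr =>
    obtain ⟨-, _, he⟩ := DB.mem_erase_ra.1 he
    obtain ⟨-, _, he'⟩ := DB.mem_erase_ra.1 he'
    exact ⟨_, .nriNamed he he' hs.of_erase.choose_spec hs'.of_erase.choose_spec hr⟩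
  | nriAnon hs hs' hr =>
    exact ⟨_, .nriAnon hs.of_erase.choose_spec hs'.of_erase.choose_spec hr⟩

theorem DB.inds_erase : db.erase.inds = db.inds := by
  simp [inds, erase, Function.comp_def]

theorem restrictTo_self (V : Lab) : restrictTo V V.toFinset = V :=
  List.filter_eq_self.2 fun x hx => by simpa using hx

theorem mem_ctxs_of_mem_inds (h : a ∈ db.inds) : Sum.inl a ∈ db.ctxs :=
  List.mem_append_left _ (List.mem_map.2 ⟨a, h, rfl⟩)

/-- Derivability of a fact about an individual with exactly the variables in `V`. -/
theorem mem_conRun_iff (ha : a ∈ db.inds) {V : Lab} :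
    (.inl a, B, V) ∈ conRun db (sublistsOf V) ↔ Con db (.inl a) B V.toFinset := by
  refine ⟨fun h => conRun_sound _ h, fun h => ?_⟩
  have := conRun_complete h (mem_ctxs_of_mem_inds ha) Finset.Subset.rfl
  rwa [restrictTo_self] at this

/-- Deciding inconsistency, or derivability of the goal with the variables in `V`. -/
noncomputable def decideQuery (db : DB) (V : Lab) : Bool :=
  (db.inds.any fun a => (conRun db.erase [[]]).any fun f => decide (f = (.inl a, .bot, []))) ||
    (conRun db (sublistsOf V)).any fun f => decide (f = (.inl db.root, .goal, V))

theorem decideQuery_iff {V : Lab} : decideQuery db V = true ↔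
    db.Inconsistent ∨ Con db (.inl db.root) .goal V.toFinset := by
  simp only [decideQuery, Bool.or_eq_true, List.any_eq_true, decide_eq_true_iff, exists_eq_right]
  refine or_congr (exists_congr fun a => and_congr_right fun ha => ?_)
    (mem_conRun_iff List.mem_cons_self)
  -- The list `[[]]` of labels is `sublistsOf []` by definition.
  refine (mem_conRun_iff (V := []) (by rwa [DB.inds_erase])).trans ⟨fun h => h.of_erase, ?_⟩
  rintro ⟨N, h⟩
  exact h.erase

end erase

/-! ### Running time of the decision, relative to padding. -/

namespace Poly

variable {Γ : Type} [Enc Γ] {db : Γ → DB}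

@[fun_prop]
theorem erase (h : Poly db) : Poly fun g => (db g).erase := by unfold DB.erase; fun_prop

theorem decideQuery {V : Γ → Lab} (h : Poly db) (hV : Poly V)
    (hpad : ∃ k, ∀ g, 2 ^ (V g).length ≤ (sz g + 2) ^ k) :
    Poly fun g => decideQuery (db g) (V g) := by
  have := Poly.sublistsOf hV hpad
  unfold DLProv.decideQuery
  fun_prop

end Poly

end DLProv


namespace DLProv

open Enc (enc)

/-! ## Case analysis in polynomial time -/

def Ax.toSum : Ax → (Concept × RConcept) ⊕ (Role × Role) ⊕ (Role × Role) ⊕ (ℕ × ℕ) ⊕ (ℕ × ℕ × ℕ)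
  | .gci C D => .inl (C, D)
  | .ri P Q => .inr (.inl (P, Q))
  | .nri P Q => .inr (.inr (.inl (P, Q)))
  | .ca A a => .inr (.inr (.inr (.inl (A, a))))
  | .ra R a b => .inr (.inr (.inr (.inr (R, a, b))))

def Concept.toSum : Concept → Unit ⊕ ℕ ⊕ (Role × Concept) ⊕ (Concept × Concept)
  | .top => .inl ()
  | .atom A => .inr (.inl A)
  | .ex P C => .inr (.inr (.inl (P, C)))
  | .inter C D => .inr (.inr (.inr (C, D)))

def RConcept.toSum : RConcept → ℕ ⊕ Role ⊕ Unit
  | .atom A => .inl A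
  | .ex P => .inr (.inl P)
  | .bot => .inr (.inr ())

/-- The encoding of the value of a case analysis by tags. -/
def Val.bySum (v : Val) : ℕ → ℕ → Val
  | _, 0 => v.snd
  | k, n + 1 => bif v.fst.beq (encNat k) then .pair .nil v.snd
      else .pair (.pair .nil .nil) (v.bySum (k + 1) n)

theorem beq_encNat (j k : ℕ) : (encNat j).beq (encNat k) = decide (j = k) := by
  rw [Bool.eq_iff_iff, Val.beq_iff, decide_eq_true_iff]
  exact ⟨InjEnc.inj (α := ℕ) _ _, congrArg _⟩

namespace Poly

variable {Γ α β σ : Type} [Enc Γ] [Enc α] [Enc β] [Enc σ]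

theorem bySum (k n : ℕ) : Poly fun v : Val => v.bySum k n := by
  induction n generalizing k with
  | zero => unfold Val.bySum; fun_prop
  | succ n ih =>
    have h1 := ih (k + 1)
    have h2 := valBeq.comp (f := fun v : Val => (v.fst, encNat k)) (by fun_prop)
    unfold Val.bySum
    fun_prop

theorem axToSum_id : Poly Ax.toSum := by
  refine of_val (bySum 0 4) fun β => ?_
  cases β <;> simp [enc, encAx, Ax.toSum, Val.bySum, Val.fst, Val.snd, beq_encNat]

theorem conceptToSum_id : Poly Concept.toSum := by
  refine of_val (bySum 0 3) fun β => ?_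
  cases β <;> simp [enc, encConcept, Concept.toSum, Val.bySum, Val.fst, Val.snd, beq_encNat]

theorem rconceptToSum_id : Poly RConcept.toSum := by
  refine of_val (bySum 0 2) fun β => ?_
  cases β <;> simp [enc, encRConcept, RConcept.toSum, Val.bySum, Val.fst, Val.snd, beq_encNat]

@[fun_prop]
theorem axToSum {f : Γ → Ax} (hf : Poly f) : Poly fun g => (f g).toSum := axToSum_id.comp hf

@[fun_prop]
theorem conceptToSum {f : Γ → Concept} (hf : Poly f) : Poly fun g => (f g).toSum :=
  conceptToSum_id.comp hf

@[fun_prop]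
theorem rconceptToSum {f : Γ → RConcept} (hf : Poly f) : Poly fun g => (f g).toSum :=
  rconceptToSum_id.comp hf

-- Unlike in `cond`, only the selected branch runs, since each branch needs an argument of its own
-- type.
@[fun_prop]
theorem sumElim {f : Γ → α ⊕ β} {g : Γ → α → σ} {h : Γ → β → σ} (hf : Poly f)
    (hg : Poly fun x : Γ × α => g x.1 x.2) (hh : Poly fun x : Γ × β => h x.1 x.2) :
    Poly fun x => Sum.elim (g x) (h x) (f x) := by
  suffices hc : Poly fun x : Γ × (α ⊕ β) => Sum.elim (g x.1) (h x.1) x.2 from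
    hc.comp (f := fun x => (x, f x)) (by fun_prop)
  obtain ⟨p, k, hp, hk⟩ := hg
  obtain ⟨q, l, hq, hl⟩ := hh
  let arg : Exp := .pair (.fst (.var 0)) (.snd (.snd (.var 0)))
  let main : Prog := [.ite (.fst (.snd (.var 0))) (.call (1 + p.length) arg) (.call 1 arg)]
  have hB := ((PolyBounded.two_pow k).add (PolyBounded.two_pow l)).add (PolyBounded.const 20)
  refine of_bounds (p := linked main p q []) hB hB ?_ ?_
  · rintro ⟨x, a | b⟩
    · have hx := EvalLE.arg (p := linked main p q []) (enc (x, (Sum.inl a : α ⊕ β)))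
      have h1 := EvalLE.link (embeds_linked_fst main p q []) (hp (x, a)) (hx.fst.pair hx.snd.snd)
      refine (EvalLE.call (linked_main rfl) hx (EvalLE.ite_nil hx.snd.fst h1)).mono ?_
      have := Nat.pow_le_pow_left (n := sz (x, a) + 2) (m := sz (x, (Sum.inl a : α ⊕ β)) + 2) (by
        simp only [sz, enc, Sum.elim_inl, Val.size]; omega) k
      dsimp only
      omega
    · have hx := EvalLE.arg (p := linked main p q []) (enc (x, (Sum.inr b : α ⊕ β)))
      have h1 := EvalLE.link (embeds_linked_snd main p q []) (hq (x, b)) (hx.fst.pair hx.snd.snd)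
      refine (EvalLE.call (linked_main rfl) hx (EvalLE.ite_pair hx.snd.fst h1)).mono ?_
      have := Nat.pow_le_pow_left (n := sz (x, b) + 2) (m := sz (x, (Sum.inr b : α ⊕ β)) + 2) (by
        simp only [sz, enc, Sum.elim_inr, Val.size]; omega) l
      dsimp only
      omega
  · rintro ⟨x, a | b⟩
    · have := Nat.pow_le_pow_left (n := sz (x, a) + 2) (m := sz (x, (Sum.inl a : α ⊕ β)) + 2) (by
        simp only [sz, enc, Sum.elim_inl, Val.size]; omega) k
      have := hk (x, a)
      simp only [Sum.elim_inl] at *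
      omega
    · have := Nat.pow_le_pow_left (n := sz (x, b) + 2) (m := sz (x, (Sum.inr b : α ⊕ β)) + 2) (by
        simp only [sz, enc, Sum.elim_inr, Val.size]; omega) l
      have := hl (x, b)
      simp only [Sum.elim_inr] at *
      omega

@[fun_prop]
theorem labOf {f : Γ → Option ℕ} (hf : Poly f) : Poly fun g => labOf (f g) := by
  suffices h : Poly DLProv.labOf from h.comp hf
  refine of_val (g := fun v => bif v.beq .nil then .nil else .pair (.pair .nil v.fst) .nil) ?_
    fun l => by cases l <;> rfl
  have := valBeq.comp (f := fun v : Val => (v, Val.nil)) (by fun_prop)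
  fun_prop

@[fun_prop]
theorem roleName {f : Γ → ℕ} (hf : Poly f) : Poly fun g => Role.name (f g) :=
  Poly.transfer (g := fun g => (Sum.inl (f g) : ℕ ⊕ ℕ)) (by fun_prop) fun a => ⟨a, rfl, rfl⟩

@[fun_prop]
theorem bcAtom {f : Γ → ℕ} (hf : Poly f) : Poly fun g => BC.atom (f g) :=
  Poly.transfer (g := fun g => (1, f g)) (by fun_prop) fun a => ⟨a, rfl, rfl⟩

/-! ## Building the database -/

@[fun_prop]
theorem toBC {f : Γ → Concept} (hf : Poly f) : Poly fun g => (f g).toBC := by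
  suffices h : Poly Concept.toBC from h.comp hf
  have h : Concept.toBC = fun C => Sum.elim (fun _ => .top) (Sum.elim .atom fun _ => .top) C.toSum := by
    funext C; cases C <;> rfl
  rw [h]
  fun_prop

@[fun_prop]
theorem heads {f : Γ → RConcept} (hf : Poly f) : Poly fun g => (f g).heads := by
  suffices h : Poly RConcept.heads from h.comp hf
  have h : RConcept.heads = fun D => Sum.elim (fun A => [.atom A])
      (Sum.elim (fun _ => []) fun _ => [.bot]) D.toSum := by
    funext D; cases D <;> rfl
  rw [h]
  fun_prop

@[fun_prop]
theorem bothWays {P : Γ → Role} {a b : Γ → Ind} {v : Γ → Lab} (hP : Poly P) (ha : Poly a)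
    (hb : Poly b) (hv : Poly v) : Poly fun g => bothWays (P g) (a g) (b g) (v g) := by
  unfold DLProv.bothWays; fun_prop

theorem caRules : Poly caRules := by
  have h : DLProv.caRules = fun β => Sum.elim (fun _ => []) (Sum.elim (fun _ => [])
      (Sum.elim (fun _ => []) (Sum.elim (fun x => [(.atom x.1, .inl x.2, DLProv.labOf β.2)])
        fun _ => []))) β.1.toSum := by
    funext ⟨β, l⟩; cases β <;> rfl
  rw [h]
  fun_prop

theorem raRules : Poly raRules := by
  have h : DLProv.raRules = fun β => Sum.elim (fun _ => []) (Sum.elim (fun _ => [])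
      (Sum.elim (fun _ => []) (Sum.elim (fun _ => [])
        fun x => DLProv.bothWays (.name x.1) (.inl x.2.1) (.inl x.2.2) (DLProv.labOf β.2))))
          β.1.toSum := by
    funext ⟨β, l⟩; cases β <;> rfl
  rw [h]
  fun_prop

theorem imRules : Poly imRules := by
  have h : DLProv.imRules = fun β => Sum.elim (fun x => Sum.elim
      (fun _ => x.2.heads.map fun B => (.top, .top, B, DLProv.labOf β.2))
      (Sum.elim (fun A => x.2.heads.map fun B => (.atom A, .top, B, DLProv.labOf β.2))
        (Sum.elim (fun _ => [])
          fun y => x.2.heads.map fun B => (y.1.toBC, y.2.toBC, B, DLProv.labOf β.2))) x.1.toSum)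
      (fun _ => []) β.1.toSum := by
    funext ⟨β, l⟩; rcases β with ⟨_ | _ | _ | _, D⟩ | _ | _ | _ | _ <;> rfl
  rw [h]
  fun_prop

theorem exRules : Poly exRules := by
  have h : DLProv.exRules = fun β => Sum.elim (fun x => Sum.elim (fun _ => [])
      (Sum.elim (fun _ => []) (Sum.elim
        (fun y => x.2.heads.map fun B => (y.1, y.2.toBC, B, DLProv.labOf β.2))
          fun _ => [])) x.1.toSum)
      (fun _ => []) β.1.toSum := by
    funext ⟨β, l⟩; rcases β with ⟨_ | _ | _ | _, D⟩ | _ | _ | _ | _ <;> rfl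
  rw [h]
  fun_prop

theorem genRules : Poly genRules := by
  have h : DLProv.genRules = fun β => Sum.elim (fun x => Sum.elim (fun _ => [])
      (Sum.elim (fun P => Sum.elim (fun _ => [(.top, P, DLProv.labOf β.2)])
        (Sum.elim (fun A => [(.atom A, P, DLProv.labOf β.2)]) fun _ => []) x.1.toSum)
          fun _ => []) x.2.toSum)
      (fun _ => []) β.1.toSum := by
    funext ⟨β, l⟩
    rcases β with ⟨_ | _ | _ | _, _ | _ | _⟩ | _ | _ | _ | _ <;> rfl
  rw [h]
  fun_prop

theorem riRules : Poly riRules := by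
  have h : DLProv.riRules = fun β => Sum.elim (fun _ => [])
      (Sum.elim (fun x => [(x.1, x.2, DLProv.labOf β.2), (x.1.inverse, x.2.inverse, DLProv.labOf β.2)])
        fun _ => []) β.1.toSum := by
    funext ⟨β, l⟩; rcases β with _ | _ | _ | _ | _ <;> rfl
  rw [h]
  fun_prop

theorem nriRules : Poly nriRules := by
  have h : DLProv.nriRules = fun β => Sum.elim (fun _ => []) (Sum.elim (fun _ => [])
      (Sum.elim (fun x => [(x.1, x.2), (x.1.inverse, x.2.inverse)]) fun _ => [])) β.1.toSum := by
    funext ⟨β, l⟩; rcases β with _ | _ | _ | _ | _ <;> rfl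
  rw [h]
  fun_prop

@[fun_prop]
theorem mkDB {O : Γ → AnnOntology} {X : Γ → DB} (hO : Poly O) (hX : Poly X) :
    Poly fun g => mkDB (O g) (X g) := by
  have hsnd : Poly (Prod.snd : Γ × (Ax × Option PVar) → Ax × Option PVar) := by fun_prop
  have h1 := hO.flatMap (f := fun _ => DLProv.caRules) (caRules.comp hsnd)
  have h2 := hO.flatMap (f := fun _ => DLProv.raRules) (raRules.comp hsnd)
  have h3 := hO.flatMap (f := fun _ => DLProv.imRules) (imRules.comp hsnd)
  have h4 := hO.flatMap (f := fun _ => DLProv.exRules) (exRules.comp hsnd)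
  have h5 := hO.flatMap (f := fun _ => DLProv.genRules) (genRules.comp hsnd)
  have h6 := hO.flatMap (f := fun _ => DLProv.riRules) (riRules.comp hsnd)
  have h7 := hO.flatMap (f := fun _ => DLProv.nriRules) (nriRules.comp hsnd)
  unfold DLProv.mkDB
  fun_prop

theorem nodeCa : Poly nodeCa := by
  have h : DLProv.nodeCa = fun x => Sum.elim (fun _ => [])
      (Sum.elim (fun A => [(.atom A, x.2.2, [.inr x.2.1])]) fun _ => []) x.1.toSum := by
    funext ⟨C, p, i⟩; cases C <;> rfl
  rw [h]
  fun_prop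

theorem nodeRa : Poly nodeRa := by
  have h : DLProv.nodeRa = fun x => Sum.elim (fun _ => []) (Sum.elim (fun _ => []) (Sum.elim
      (fun y => DLProv.bothWays y.1 x.2.2 (.inr x.2.1) [.inr x.2.1]) fun _ => [])) x.1.toSum := by
    funext ⟨C, p, i⟩; cases C <;> rfl
  rw [h]
  fun_prop

theorem nodeVars : Poly nodeVars := by
  have h : DLProv.nodeVars = fun x => Sum.elim (fun _ => []) (Sum.elim (fun _ => [.inr x.2.1])
      (Sum.elim (fun _ => [.inr x.2.1]) fun _ => [])) x.1.toSum := by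
    funext ⟨C, p, i⟩; cases C <;> rfl
  rw [h]
  fun_prop

@[fun_prop]
theorem goalIm {f : Γ → RConcept} (hf : Poly f) : Poly fun g => goalIm (f g) := by
  suffices h : Poly DLProv.goalIm from h.comp hf
  have h : DLProv.goalIm = fun D => Sum.elim (fun B => [(.atom B, .top, .goal, [])])
      (fun _ => []) D.toSum := by
    funext D; cases D <;> rfl
  rw [h]
  fun_prop

@[fun_prop]
theorem goalEx {f : Γ → RConcept} (hf : Poly f) : Poly fun g => goalEx (f g) := by
  suffices h : Poly DLProv.goalEx from h.comp hf
  have h : DLProv.goalEx = fun D => Sum.elim (fun _ => [])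
      (Sum.elim (fun P => [(P, .top, .goal, [])]) fun _ => []) D.toSum := by
    funext D; cases D <;> rfl
  rw [h]
  fun_prop

theorem queryRules : Poly fun x : Ax × List (Concept × Path × Ind) => queryRules x.1 x.2 := by
  have hsnd {α : Type} [Enc α] : Poly (Prod.snd : α × Concept × Path × Ind → _) := by fun_prop
  have h1 {α : Type} [Enc α] := nodeCa.comp (hsnd (α := α))
  have h2 {α : Type} [Enc α] := nodeRa.comp (hsnd (α := α))
  have h : (fun x : Ax × List (Concept × Path × Ind) => DLProv.queryRules x.1 x.2) = fun x => Sum.elim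
      (fun y => ⟨x.2.flatMap DLProv.nodeCa, x.2.flatMap DLProv.nodeRa, DLProv.goalIm y.2,
        DLProv.goalEx y.2, [], [], [], .inr []⟩)
      (Sum.elim (fun y => ⟨[(.tok, .inr [false], [])],
          DLProv.bothWays y.1 (.inr []) (.inr [false]) [.inr []], [],
          [(y.2, .tok, .goal, [])], [], [], [], .inr []⟩)
        (Sum.elim (fun y => ⟨[], DLProv.bothWays y.1 (.inr []) (.inr [false]) [.inr []] ++
            DLProv.bothWays y.2 (.inr []) (.inr [false]) [.inr [false]],
            [], [], [], [], [], .inr []⟩)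
          (Sum.elim (fun y => ⟨[], [], [(.atom y.1, .top, .goal, [])], [], [], [], [], .inl y.2⟩)
            fun y => ⟨[(.tok, .inl y.2.2, [])], [], [], [(.name y.1, .tok, .goal, [])], [], [], [],
              .inl y.2.1⟩))) x.1.toSum := by
    funext ⟨α, ns⟩; cases α <;> rfl
  rw [h]
  fun_prop

theorem freshVars : Poly fun x : Ax × List (Concept × Path × Ind) => freshVars x.1 x.2 := by
  have hsnd {α : Type} [Enc α] : Poly (Prod.snd : α × Concept × Path × Ind → _) := by fun_prop
  have h1 {α : Type} [Enc α] := nodeVars.comp (hsnd (α := α))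
  have h : (fun x : Ax × List (Concept × Path × Ind) => DLProv.freshVars x.1 x.2) = fun x => Sum.elim
      (fun _ => x.2.flatMap DLProv.nodeVars) (Sum.elim (fun _ => [.inr []]) fun _ => [])
        x.1.toSum := by
    funext ⟨α, ns⟩; cases α <;> rfl
  rw [h]
  fun_prop

end Poly

end DLProv


namespace DLProv

open Enc (enc)

/-! ## The query in polynomial time -/

/-- The body of a program that prepends the nodes of a concept to a list; its argument is
`(C, (p, (i, l)))`. -/
def nodesExp : Exp :=
  let C : Exp := .snd (.fst (.var 0))
  let p : Exp := .fst (.snd (.var 0))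
  let i : Exp := .fst (.snd (.snd (.var 0)))
  let l : Exp := .snd (.snd (.snd (.var 0)))
  let tag : Exp := .fst (.fst (.var 0))
  .pair (.pair (.fst (.var 0)) (.pair p i))
    -- Tags are in binary with the least significant bit first: the tail is `nil` for `0` and `1`
    -- (leaves), and the head separates `3` (conjunction) from `2` (existential). One and the same
    -- tree encodes the position `true :: p` and the individual `.inr p`.
    (.ite (.snd tag)
      (.ite (.fst tag)
        (.call 1 (.pair (.fst C) (.pair (.pair .nil p) (.pair i
          (.call 1 (.pair (.snd C) (.pair (.pair (.pair .nil .nil) p) (.pair i l))))))))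
        (.call 1 (.pair (.snd C) (.pair (.pair .nil p) (.pair (.pair (.pair .nil .nil) p) l)))))
      l)

/-- The number of subconcepts. -/
def Concept.numNodes : Concept → ℕ
  | .top => 1
  | .atom _ => 1
  | .ex _ C => C.numNodes + 1
  | .inter C D => C.numNodes + D.numNodes + 1

theorem Concept.numNodes_le (C : Concept) : C.numNodes ≤ sz C := by
  induction C with
  | top => exact sz_pos _
  | atom => exact sz_pos _
  | ex P C ih => simp only [sz, enc, encConcept, Val.size, numNodes] at *; omega
  | inter C D ihC ihD => simp only [sz, enc, encConcept, Val.size, numNodes] at *; omega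

theorem encNat_two : encNat 2 = .pair .nil (.pair (.pair .nil .nil) .nil) := by
  simp [encNat, encList, encBool, Nat.bits, Nat.binaryRec]

theorem encNat_three : encNat 3 = .pair (.pair .nil .nil) (.pair (.pair .nil .nil) .nil) := by
  simp [encNat, encList, encBool, Nat.bits, Nat.binaryRec]

theorem encNat_zero : encNat 0 = .nil := by
  simp [encNat, encList, Nat.bits]

theorem encNat_one : encNat 1 = .pair (.pair .nil .nil) .nil := by
  simp [encNat, encList, encBool, Nat.bits]

theorem evalLE_nodesExp {P : Prog} (hP : P[1]? = some nodesExp) (C : Concept) (p : Path) (i : Ind)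
    (l : List (Concept × Path × Ind)) :
    EvalLE P [enc (C, p, i, l)] nodesExp (enc (C.nodes p i ++ l)) (100 * C.numNodes) := by
  induction C generalizing p i l with
  | top =>
    have hx := EvalLE.arg (p := P) (enc (Concept.top, p, i, l))
    have h1 : (enc Concept.top).fst.snd = .nil := by simp [enc, encConcept, encNat_zero, Val.fst, Val.snd]
    have h2 := hx.fst.fst.snd
    rw [show (enc (Concept.top, p, i, l)).fst.fst.snd = .nil from h1] at h2
    exact (EvalLE.pair (hx.fst.pair (hx.snd.fst.pair hx.snd.snd.fst)) (.ite_nil h2 hx.snd.snd.snd)).mono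
      (by simp [Concept.numNodes])
  | atom A =>
    have hx := EvalLE.arg (p := P) (enc (Concept.atom A, p, i, l))
    have h1 : (enc (Concept.atom A)).fst.snd = .nil := by
      simp [enc, encConcept, encNat_one, Val.fst, Val.snd]
    have h2 := hx.fst.fst.snd
    rw [show (enc (Concept.atom A, p, i, l)).fst.fst.snd = .nil from h1] at h2
    exact (EvalLE.pair (hx.fst.pair (hx.snd.fst.pair hx.snd.snd.fst)) (.ite_nil h2 hx.snd.snd.snd)).mono
      (by simp [Concept.numNodes])
  | ex R C ih =>
    have hx := EvalLE.arg (p := P) (enc (Concept.ex R C, p, i, l))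
    have h0 : (enc (Concept.ex R C)).fst = encNat 2 := rfl
    have h2 := hx.fst.fst
    rw [show (enc (Concept.ex R C, p, i, l)).fst.fst = encNat 2 from rfl, encNat_two] at h2
    have h3 := EvalLE.call hP (hx.fst.snd.snd.pair ((EvalLE.nil.pair hx.snd.fst).pair
      (((EvalLE.nil.pair .nil).pair hx.snd.fst).pair hx.snd.snd.snd))) (ih (false :: p) (.inr p) l)
    exact (EvalLE.pair (hx.fst.pair (hx.snd.fst.pair hx.snd.snd.fst))
      (.ite_pair h2.snd (.ite_nil h2.fst h3))).mono (by simp only [Concept.numNodes]; omega)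
  | inter C D ihC ihD =>
    have hx := EvalLE.arg (p := P) (enc (Concept.inter C D, p, i, l))
    have h2 := hx.fst.fst
    rw [show (enc (Concept.inter C D, p, i, l)).fst.fst = encNat 3 from rfl, encNat_three] at h2
    have h3 := EvalLE.call hP (hx.fst.snd.snd.pair (((EvalLE.nil.pair .nil).pair hx.snd.fst).pair
      (hx.snd.snd.fst.pair hx.snd.snd.snd))) (ihD (true :: p) i l)
    have h4 := EvalLE.call hP (hx.fst.snd.fst.pair ((EvalLE.nil.pair hx.snd.fst).pair
      (hx.snd.snd.fst.pair h3))) (ihC (false :: p) i (D.nodes (true :: p) i ++ l))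
    rw [Concept.nodes, List.cons_append, List.append_assoc]
    exact (EvalLE.pair (hx.fst.pair (hx.snd.fst.pair hx.snd.snd.fst))
      (.ite_pair h2.snd (.ite_pair h2.fst h4))).mono (by simp only [Concept.numNodes]; omega)

theorem Concept.length_nodes (C : Concept) (p : Path) (i : Ind) :
    (C.nodes p i).length = C.numNodes := by
  induction C generalizing p i with
  | top => rfl
  | atom => rfl
  | ex P C ih => rw [nodes, List.length_cons, ih, numNodes]
  | inter C D ihC ihD => rw [nodes, List.length_cons, List.length_append, ihC, ihD, numNodes]

/-- Each descent lengthens the position by a boolean, at most `4` nodes, while the concept shrinks.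
The individual is `i` or a position met on the way. -/
theorem Concept.sz_mem_nodes {C : Concept} {p : Path} {i : Ind} {x : Concept × Path × Ind}
    (h : x ∈ C.nodes p i) : sz x ≤ 10 * sz C + 2 * sz p + sz i + 20 := by
  have hcons : ∀ (b : Bool) (p : Path), sz (b :: p) ≤ sz p + 4 := fun b p => by
    have := Poly.sz_bool_le b
    rw [sz_cons]; omega
  have hinr : ∀ p : Path, sz (Sum.inr p : Ind) = sz p + 4 := fun p => by
    simp only [sz, enc, Sum.elim_inr, Val.size]; omega
  suffices sz x.1 ≤ sz C ∧ sz x.2.1 ≤ 4 * sz C + sz p ∧ (sz x.2.2 ≤ sz i ∨ sz x.2.2 ≤ 4 * sz C + sz p + 4) by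
    obtain ⟨C, p, i⟩ := x
    simp only [sz_prod] at *
    omega
  induction C generalizing p i with
  | top => obtain rfl := List.mem_singleton.1 h; dsimp only; omega
  | atom A => obtain rfl := List.mem_singleton.1 h; dsimp only; omega
  | ex P C ih =>
    have h2 : sz C + 1 ≤ sz (Concept.ex P C) := by
      simp only [sz, enc, encConcept, Val.size]; omega
    rcases List.mem_cons.1 h with rfl | h
    · dsimp only; omega
    · have h1 := ih h
      have h3 := hcons false p
      rw [hinr] at h1
      omega
  | inter C D ihC ihD =>
    have h2 : sz C + sz D + 1 ≤ sz (Concept.inter C D) := by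
      simp only [sz, enc, encConcept, Val.size]; omega
    rcases List.mem_cons.1 h with rfl | h
    · dsimp only; omega
    · rcases List.mem_append.1 h with h | h
      · have h1 := ihC h
        have h3 := hcons false p
        omega
      · have h1 := ihD h
        have h3 := hcons true p
        omega

namespace Poly

variable {Γ : Type} [Enc Γ]

theorem conceptNodes : Poly fun x : Concept × Path × Ind => x.1.nodes x.2.1 x.2.2 := by
  let main : Prog := [.call 1 (.pair (.fst (.var 0)) (.pair (.fst (.snd (.var 0)))
    (.pair (.snd (.snd (.var 0))) .nil))), nodesExp]
  refine of_bounds (p := main) (T := fun n => 100 * n + 30) (S := fun n => n * (20 * n + 20 + 1) + 1)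
    (((PolyBounded.const 100).mul .id).add (.const 30))
    ((PolyBounded.id.mul ((((PolyBounded.const 20).mul .id).add (.const 20)).add (.const 1))).add
      (.const 1)) ?_ ?_
  · rintro ⟨C, p, i⟩
    have hx := EvalLE.arg (p := main) (enc (C, p, i))
    have h1 := evalLE_nodesExp (P := main) rfl C p i []
    rw [List.append_nil] at h1
    refine (EvalLE.call rfl hx (EvalLE.call rfl (hx.fst.pair (hx.snd.fst.pair
      (hx.snd.snd.pair .nil))) h1)).mono ?_
    have := C.numNodes_le
    simp only [sz_prod]
    omega
  · rintro ⟨C, p, i⟩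
    have h1 := C.numNodes_le
    refine (sz_list_le fun x hx => Concept.sz_mem_nodes hx).trans (Nat.add_le_add_right
      (Nat.mul_le_mul ?_ ?_) 1)
    · rw [Concept.length_nodes]; simp only [sz_prod]; omega
    · simp only [sz_prod]; omega

theorem axNodes : Poly Ax.nodes := by
  have h1 : Poly fun x : Ax × Concept × RConcept => x.2.1.nodes [true] (.inr []) :=
    conceptNodes.comp (f := fun x : Ax × Concept × RConcept => (x.2.1, [true], .inr [])) (by fun_prop)
  have h : Ax.nodes = fun α => Sum.elim (fun y => y.1.nodes [true] (.inr [])) (fun _ => [])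
      α.toSum := by
    funext α; cases α <;> rfl
  rw [h]
  fun_prop

theorem queryDB : Poly fun x : AnnOntology × Ax => queryDB x.1 x.2 := by
  have h1 : Poly fun x : AnnOntology × Ax => x.2.nodes := axNodes.comp (by fun_prop)
  have h2 := queryRules.comp (f := fun x : AnnOntology × Ax => (x.2, x.2.nodes)) (by fun_prop)
  unfold DLProv.queryDB
  fun_prop

theorem queryVars : Poly fun x : Ax × List ℕ => queryVars x.1 x.2 := by
  have h1 : Poly fun x : Ax × List ℕ => x.1.nodes := axNodes.comp (by fun_prop)
  have h2 := freshVars.comp (f := fun x : Ax × List ℕ => (x.1, x.1.nodes)) (by fun_prop)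
  unfold DLProv.queryVars
  fun_prop

end Poly

theorem Concept.length_nodeVars (C : Concept) (p : Path) (i : Ind) :
    ((C.nodes p i).flatMap nodeVars).length = C.numAtoms := by
  induction C generalizing p i with
  | top => rfl
  | atom => rfl
  | ex P C ih =>
    rw [nodes, List.flatMap_cons, List.length_append, ih, numAtoms]
    exact Nat.add_comm _ _
  | inter C D ihC ihD =>
    rw [nodes, List.flatMap_cons, List.flatMap_append, List.length_append, List.length_append, ihC,
      ihD, numAtoms]
    exact Nat.zero_add _

/-- The extra `1` is the variable of the frozen edge in a role inclusion query. -/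
theorem length_queryVars (α : Ax) (ms : List ℕ) :
    (queryVars α ms).length ≤ ms.length + α.lhsAtoms + 1 := by
  rw [queryVars, List.length_append, List.length_map]
  cases α with
  | gci C D =>
    have := C.length_nodeVars [true] (.inr [])
    simp only [freshVars, Ax.nodes, Ax.lhsAtoms, this]
    omega
  | ri => simp [freshVars, Ax.lhsAtoms]
  | nri => simp [freshVars, Ax.lhsAtoms]
  | ca => simp [freshVars, Ax.lhsAtoms]
  | ra => simp [freshVars, Ax.lhsAtoms]

/-! ## The program -/

/-- A tree with exponentially many nodes in the length of the list. -/
def padding {α : Type} (l : List α) : Val := l.foldr (fun _ v => .pair v v) .nil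

theorem size_padding {α : Type} (l : List α) : (padding l).size + 1 = 2 ^ (l.length + 1) := by
  induction l with
  | nil => rfl
  | cons a l ih =>
    rw [padding, List.foldr_cons, List.length_cons, pow_succ, ← ih, padding, Val.size]
    omega

/-- Pairs its argument `(x, l)` with a padding for `l`. -/
def padProg : Prog :=
  [.pair (.var 0) (.call 1 (.snd (.var 0))),
    .ite (.var 0) (.call 2 (.call 1 (.snd (.var 0)))) .nil,
    .pair (.var 0) (.var 0)]

/-- Pairing a value with itself takes constantly many steps, so an exponentially large tree is built
in time linear in the length of the list. -/
theorem padProg_computes {α β : Type} [Enc α] [Enc β] :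
    Computes padProg (fun x : α × List β => (x, padding x.2)) fun x => 10 * x.2.length + 20 := by
  rintro ⟨x, l⟩
  have hpad : ∀ l : List β, EvalLE padProg [enc l]
      (.ite (.var 0) (.call 2 (.call 1 (.snd (.var 0)))) .nil) (padding l) (10 * l.length + 5) := by
    intro l
    induction l with
    | nil => exact (EvalLE.ite_nil (EvalLE.arg _) .nil).mono (by omega)
    | cons a l ih =>
      have hx := EvalLE.arg (p := padProg) (enc (a :: l))
      have hd := EvalLE.arg (p := padProg) (padding l)
      exact (EvalLE.ite_pair hx (.call rfl (.call rfl hx.snd ih) (hd.pair hd))).mono (by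
        rw [List.length_cons]; omega)
  have hx := EvalLE.arg (p := padProg) (enc (x, l))
  exact (EvalLE.call rfl hx (hx.pair (.call rfl hx.snd (hpad l)))).mono (by dsimp only; omega)

/-- A polynomial-time function whose input is padded runs in time exponential in the amount of
padding. -/
theorem Computes.padded {α β γ δ : Type} [Enc α] [Enc β] [Enc γ] [Enc δ] {f : α → β × List γ}
    (hf : Poly f) {g : β × List γ → δ}
    (hg : Poly fun x : {x : (β × List γ) × Val // 2 ^ x.1.2.length ≤ x.2.size} => g x.1.1) :
    ∃ (p : Prog) (k c : ℕ), Computes p (fun a => g (f a))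
      fun a => (sz a + 2) ^ k * 2 ^ (c * ((f a).2.length + 1)) := by
  obtain ⟨p, k, hp, hk⟩ := hf
  obtain ⟨q, l, hq, -⟩ := hg
  let main : Prog := [.call (1 + p.length + padProg.length) (.call (1 + p.length) (.call 1 (.var 0)))]
  obtain ⟨K, hK⟩ := (((((PolyBounded.two_pow k).add (.const 3)).pow l).add
    ((PolyBounded.two_pow k).add (.const 3))).add
      (((PolyBounded.const 10).mul (.two_pow k)).add (.const 30)))
  refine ⟨linked main p padProg q, K, l, fun a => ?_⟩
  have h1 := EvalLE.link (embeds_linked_fst main p padProg q) (hp a) (EvalLE.arg (enc a))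
  have h2 := EvalLE.link (embeds_linked_snd main p padProg q) (padProg_computes (f a)) h1
  have h3 := EvalLE.link (embeds_linked_trd main p padProg q)
    (hq ⟨(f a, padding (f a).2), by
      have := size_padding (f a).2
      have := Nat.one_le_two_pow (n := (f a).2.length)
      rw [pow_succ] at *
      dsimp only
      omega⟩) h2
  refine (EvalLE.call (linked_main rfl) (EvalLE.arg (enc a)) h3).mono ?_
  have hlen := length_lt_sz (f a).2
  have hsz := hk a
  have hpad := size_padding (f a).2
  have h4 : sz (f a, padding (f a).2) = sz (f a) + (padding (f a).2).size + 1 := rfl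
  have hE1 : 1 ≤ 2 ^ ((f a).2.length + 1) := Nat.one_le_two_pow
  -- The padded size is at most a polynomial times `2 ^ (length + 1)`; the `l`-th power separates
  -- the two factors, so the degree `l` becomes the constant in the exponent.
  have hb : sz (f a, padding (f a).2) + 2 ≤ ((sz a + 2) ^ k + 3) * 2 ^ ((f a).2.length + 1) := by
    nlinarith
  have h5 := Nat.pow_le_pow_left hb l
  rw [mul_pow, ← pow_mul, mul_comm _ l] at h5
  have h6 := hK (sz a)
  have h7 : 1 ≤ 2 ^ (l * ((f a).2.length + 1)) := Nat.one_le_two_pow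
  refine le_trans ?_ (Nat.mul_le_mul_right _ h6)
  change 1 + (1 + (sz a + 2) ^ k + (10 * (f a).2.length + 20) +
    (sz (f a, padding (f a).2) + 2) ^ l) + 1 ≤ _
  have h8 : (f a).2.length ≤ (sz a + 2) ^ k := by
    rw [sz_prod] at hsz
    omega
  dsimp only
  nlinarith

end DLProv


namespace DLProv

open Enc (enc)

/-- The decision procedure, as a function of the ontology, the query and the list of variables. -/
theorem exists_program : ∃ (p : Prog) (k c : ℕ),
    Computes p (fun x : AnnOntology × Ax × List ℕ => decideQuery (queryDB x.1 x.2.1)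
        (queryVars x.2.1 x.2.2))
      fun x => (sz x + 2) ^ k * 2 ^ (c * ((queryVars x.2.1 x.2.2).length + 1)) := by
  have h1 := Poly.queryDB.comp (f := fun x : AnnOntology × Ax × List ℕ => (x.1, x.2.1)) (by fun_prop)
  have h2 := Poly.queryVars.comp (f := fun x : AnnOntology × Ax × List ℕ => x.2) (by fun_prop)
  refine Computes.padded (h1.prodMk h2) (g := fun x => decideQuery x.1 x.2) ?_
  have hval : Poly fun x : {x : (DB × Lab) × Val // 2 ^ x.1.2.length ≤ x.2.size} => x.1 :=
    Poly.id.transfer fun a => ⟨a, rfl, rfl⟩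
  -- The padding is part of the input, so `2 ^ |V|` is linear in its size.
  refine Poly.decideQuery hval.fst.fst hval.fst.snd ⟨1, fun x => x.2.trans ?_⟩
  have : sz x = sz x.1.1 + x.1.2.size + 1 := rfl
  rw [pow_one]
  omega

end DLProv

/-! ### The main theorem. -/

theorem mainTheorem4 :
    ∃ (prog : DLProv.Prog) (q : Polynomial ℕ) (c : ℕ),
      ∀ (O : DLProv.AnnOntology) (α : DLProv.Ax) (m : Finset DLProv.PVar),
        DLProv.IsRestr (DLProv.axiomsOf O) →
        ∃ (out : DLProv.Val) (t : ℕ),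
          prog.Runs (DLProv.encInput O α m) out t ∧
          (out ≠ DLProv.Val.nil ↔ DLProv.Entails O α (DLProv.monomial m)) ∧
          t ≤ q.eval (DLProv.encInput O α m).size * 2 ^ (c * (m.card + α.lhsAtoms)) := by
  open DLProv in
  obtain ⟨p, k, c, hp⟩ := exists_program
  -- The exponent `c * (|V| + 1)` exceeds `c * (|m| + w(α))` by at most `2 * c`: one `c` for the
  -- edge variable of a role inclusion, one for the padding. This constant factor goes into the
  -- polynomial.
  refine ⟨p, (.X + 2) ^ k * 2 ^ (2 * c), c, fun O α m hO => ?_⟩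
  obtain ⟨t, ht, hrun⟩ := hp (O, α, m.sort (· ≤ ·))
  refine ⟨_, t, hrun, ?_, ht.trans ?_⟩
  · have h1 := entails_iff (α := α) (ms := m.sort (· ≤ ·)) hO
    rw [Finset.sort_toFinset, ← decideQuery_iff] at h1
    rw [h1]
    change encBool (decideQuery (queryDB O α) (queryVars α (m.sort (· ≤ ·)))) ≠ .nil ↔ _
    cases decideQuery (queryDB O α) (queryVars α (m.sort (· ≤ ·))) <;> simp [encBool]
  · have h1 := length_queryVars α (m.sort (· ≤ ·))
    rw [Finset.length_sort] at h1
    have h2 : sz (O, α, m.sort (· ≤ ·)) = (encInput O α m).size := rfl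
    dsimp only
    rw [h2]
    simp only [Polynomial.eval_mul, Polynomial.eval_pow, Polynomial.eval_add, Polynomial.eval_X,
      Polynomial.eval_ofNat]
    rw [mul_assoc, ← pow_add]
    refine Nat.mul_le_mul_left _ (Nat.pow_le_pow_right (by omega) ?_)
    calc c * ((queryVars α (m.sort (· ≤ ·))).length + 1)
        ≤ c * (m.card + α.lhsAtoms + 1 + 1) := Nat.mul_le_mul_left _ (by omega)
      _ = 2 * c + c * (m.card + α.lhsAtoms) := by ring
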